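/- Let $k$ be a field and let $G$ be a finite group. Let $\mathrm{Sch}^G/k$ be the category of separated schemes of finite type over $k$ with a left action of $G$ by $k$-automorphisms, and $G$-equivariant $k$-morphisms. For $X \in \mathrm{Sch}^G/k$ a $G$-linearization of a line bundle $\mathcal{L}$ on $X$ is a family of isomorphisms $\phi_g : g^*\mathcal{L} \to \mathcal{L}$ $(g \in G)$ with $\phi_e = \mathrm{id}$ and $\phi_{gh} = \phi_h \circ h^*(\phi_g)$. Let $\mathrm{Pic}^G(X)$ be the group (under $\otimes$) of equivariant isomorphism classes of $G$-linearized line bundles on $X$, let $\mathrm{Pic}(X)$ be the usual Picard group, and let $\eta : \mathrm{Pic}^G \Rightarrow \mathrm{Pic}$, $[(\mathcal{L},\phi)] \mapsto [\mathcal{L}]$, be the forgetful natural transformation of contravariant functors from $\mathrm{Sch}^G/k$ to abelian groups. For $X \in \mathrm{Sch}^G/k$ write $X[t] = X \times_k \mathrm{Spec}\, k[t]$, $X[t^{-1}] = X \times_k \mathrm{Spec}\, k[t^{-1}]$ and $X[t,t^{-1}] = X \times_k \mathrm{Spec}\, k[t,t^{-1}]$, with $G$ acting trivially on $t$. For a contravariant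 functor $F$ from $\mathrm{Sch}^G/k$ to abelian groups, the contraction $LF(X)$ is the cokernel of the map $F(X[t]) \times F(X[t^{-1}]) \to F(X[t,t^{-1}])$, $(a,b) \mapsto a|_{X[t,t^{-1}]} + b|_{X[t,t^{-1}]}$, and $F$ is called contracted if for every $X$ the sequence $$0 \to F(X) \xrightarrow{x \mapsto (x,-x)} F(X[t]) \times F(X[t^{-1}]) \xrightarrow{+} F(X[t,t^{-1}]) \to LF(X) \to 0$$ is exact and the map $F(X[t,t^{-1}]) \to LF(X)$ has a section that is natural in $X$. Then: 1. the functor $\ker(\eta)$, $X \mapsto \ker(\eta_X)$, is contracted on $\mathrm{Sch}^G/k$; 2. there is an isomorphism $\ker(\eta_X) \cong H^1(G, H^0(X, \mathcal{O}_X^\times))$, natural in $X \in \mathrm{Sch}^G/k$; 3. there is an isomorphism $L\ker(\eta)(X) \cong H^1(G, H^0_{\mathrm{et}}(X, \mathbb{Z}))$, natural in $X \in \mathrm{Sch}^G/k$. Here $H^1(G,-)$ is group cohomology, and $g \in G$ acts on $H^0(X, \mathcal{O}_X^\times)$ and on $H^0_{\mathrm{et}}(X,\mathbb{Z})$ by pullback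 along the automorphism $g^{-1}$ of $X$. -/

import Mathlib

open CategoryTheory Limits Opposite TopologicalSpace AlgebraicGeometry

universe u

namespace EquivariantPicard

noncomputable section

variable {X Y : Scheme.{u}}

/-- Restriction of a section. -/
abbrev res {M : X.Modules} {U V : X.Opens} (h : V ≤ U) (s : Γ(M, U)) : Γ(M, V) :=
  M.presheaf.map (homOfLE h).op s

/-- Restriction of a function. -/
abbrev fres {U V : X.Opens} (h : V ≤ U) (s : Γ(X, U)) : Γ(X, V) :=
  X.presheaf.map (homOfLE h).op s

/-- A section `s` of `M` over `U` is a frame if `a ↦ a • s` is an isomorphism `𝒪_U ≅ M|_U`. -/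
def IsFrame (M : X.Modules) (U : X.Opens) (s : Γ(M, U)) : Prop :=
  ∀ (V : X.Opens) (h : V ≤ U), Function.Bijective (fun a : Γ(X, V) => a • res h s)

lemma res_res {M : X.Modules} {U V W : X.Opens} (h : V ≤ U) (h' : W ≤ V) (s : Γ(M, U)) :
    res h' (res h s) = res (h'.trans h) s := by
  simp only [res]
  rw [← ConcreteCategory.comp_apply, ← Functor.map_comp]; rfl

lemma fres_fres {U V W : X.Opens} (h : V ≤ U) (h' : W ≤ V) (s : Γ(X, U)) :
    fres h' (fres h s) = fres (h'.trans h) s := by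
  simp only [fres]
  rw [← ConcreteCategory.comp_apply, ← Functor.map_comp]; rfl

lemma fres_self {U : X.Opens} (s : Γ(X, U)) : fres le_rfl s = s :=
  congr($(X.presheaf.map_id (op U)) s)

lemma fapp_res (f : X ⟶ Y) {U V : Y.Opens} {W : X.Opens} (h : V ≤ U) (h' : W ≤ f ⁻¹ᵁ V)
    (a : Γ(Y, U)) (h'' : W ≤ f ⁻¹ᵁ U) : fres h' (f.app V (fres h a)) = fres h'' (f.app U a) := by
  have := congr($(f.naturality (homOfLE h).op) a)
  rw [ConcreteCategory.comp_apply, ConcreteCategory.comp_apply] at this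
  rw [fres, fres, this]
  exact fres_fres _ _ _

lemma res_self {M : X.Modules} {U : X.Opens} (s : Γ(M, U)) :
    res le_rfl s = s := by
  simp only [res]
  exact congr($(M.presheaf.map_id (op U)) s)

lemma res_smul {M : X.Modules} {U V : X.Opens} (h : V ≤ U) (a : Γ(X, U)) (s : Γ(M, U)) :
    res h (a • s) = fres h a • res h s := M.map_smul _ _ _

lemma res_app {M N : X.Modules} (φ : M ⟶ N) {U V : X.Opens} (h : V ≤ U) (s : Γ(M, U)) :
    res h (φ.app U s) = φ.app V (res h s) :=
  (congr($(φ.mapPresheaf.naturality (homOfLE h).op) s)).symm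

/-- The action of a morphism `L ⟶ f_* M` on sections. -/
def papp {f : X ⟶ Y} {L : Y.Modules} {M : X.Modules}
    (θ : L ⟶ (Scheme.Modules.pushforward f).obj M) {U : Y.Opens} (s : Γ(L, U)) : Γ(M, f ⁻¹ᵁ U) :=
  θ.app U s

section
variable {f : X ⟶ Y} {L : Y.Modules} {M : X.Modules}
  (θ : L ⟶ (Scheme.Modules.pushforward f).obj M) {U V : Y.Opens}

lemma papp_smul (a : Γ(Y, U)) (s : Γ(L, U)) : papp θ (a • s) = f.app U a • papp θ s := by
  unfold papp
  rw [Scheme.Modules.Hom.app_smul]; rfl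

lemma papp_res (h : V ≤ U) (s : Γ(L, U)) :
    papp θ (res h s) = res (f.preimage_mono h) (papp θ s) :=
  (res_app θ h s).symm

lemma push_hom_ext {θ θ' : L ⟶ (Scheme.Modules.pushforward f).obj M}
    (h : ∀ (U : Y.Opens) (s : Γ(L, U)), papp θ s = papp θ' s) : θ = θ' := by
  refine Scheme.Modules.hom_ext _ _ fun U => ?_
  ext s
  exact h U s
end

lemma eq_of_locally {M : X.Modules} {ι : Type*} (U : ι → X.Opens) {V : X.Opens} 
   (hU : ∀ x ∈ V, ∃ i, x ∈ U i) (s t : Γ(M, V))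
   (h : ∀ i (W : X.Opens) (hV : W ≤ V) (_ : W ≤ U i), res hV s = res hV t) : s = t := by
  refine TopCat.Sheaf.eq_of_locally_eq' (C := Ab) ⟨M.presheaf, M.isSheaf⟩ (fun i => U i ⊓ V) V (fun i => homOfLE inf_le_right) ?_ s t ?_
  · intro x hx
    obtain ⟨i, hi⟩ := hU x hx
    exact Opens.mem_iSup.2 ⟨i, hi, hx⟩
  · intro i; exact h i _ _ inf_le_left

lemma frame_res {M : X.Modules} {U V : X.Opens} {s : Γ(M, U)} (hs : IsFrame M U s) (h : V ≤ U) :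
    IsFrame M V (res h s) := by
  intro W hW
  rw [res_res]; exact hs W _

/-- A morphism of sheaves of modules from its maps on sections. -/
def mkHom (M P : X.Modules) (θ : ∀ V : X.Opens, Γ(M, V) → Γ(P, V))
    (hadd : ∀ V s t, θ V (s + t) = θ V s + θ V t) (hsmul : ∀ V (a : Γ(X, V)) s, θ V (a • s) = a • θ V s)
    (hres : ∀ (U V : X.Opens) (h : V ≤ U) s, res h (θ U s) = θ V (res h s)) : M ⟶ P :=
  ⟨PresheafOfModules.homMk
    { app := fun V => AddCommGrpCat.ofHom (AddMonoidHom.mk' (θ V.unop) (hadd V.unop))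
      naturality := fun V W f => by
        ext s
        exact (hres V.unop W.unop (leOfHom f.unop) s).symm }
    (fun V a s => hsmul V.unop a s)⟩

lemma mkHom_app (M P : X.Modules) (θ : ∀ V : X.Opens, Γ(M, V) → Γ(P, V)) (h1 h2 h3) (V) (s : Γ(M, V)) :
   (mkHom M P θ h1 h2 h3).app V s = θ V s := rfl

section MO
variable {M P : X.Modules} {ι : Type*} {U : ι → X.Opens}

/-- `s` and `t` have the same local coefficients with respect to `m` and `p`. -/
def Corr (m : ∀ i, Γ(M, U i)) (p : ∀ i, Γ(P, U i)) (V : X.Opens) (s : Γ(M, V)) (t : Γ(P, V)) : Prop :=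
  ∀ i (W : X.Opens) (hV : W ≤ V) (hi : W ≤ U i) (a : Γ(X, W)),
    res hV s = a • res hi (m i) → res hV t = a • res hi (p i)

lemma Corr.unique (cover : ∀ x : X, ∃ i, x ∈ U i)
    {m : ∀ i, Γ(M, U i)} (hm : ∀ i, IsFrame M (U i) (m i)) {p : ∀ i, Γ(P, U i)}
    {V : X.Opens} {s : Γ(M, V)} {t t' : Γ(P, V)} (h : Corr m p V s t)
    (h' : Corr m p V s t') : t = t' := by
  refine eq_of_locally U (fun x _ => cover x) _ _ fun i W hV hi => ?_
  obtain ⟨a, ha⟩ := (hm i W hi).2 (res hV s)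
  rw [h i W hV hi a ha.symm, h' i W hV hi a ha.symm]

lemma Corr.exists (cover : ∀ x : X, ∃ i, x ∈ U i)
    {m : ∀ i, Γ(M, U i)} (hm : ∀ i, IsFrame M (U i) (m i)) {p : ∀ i, Γ(P, U i)}
    (compat : ∀ i j (V : X.Opens) (hi : V ≤ U i) (hj : V ≤ U j) (a : Γ(X, V)),
      res hj (m j) = a • res hi (m i) → res hj (p j) = a • res hi (p i))
    {V : X.Opens} (s : Γ(M, V)) : ∃ t : Γ(P, V), Corr m p V s t := by
  choose a ha using fun i => (hm i (V ⊓ U i) inf_le_right).2 (res inf_le_left s)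
  simp only at ha
  have key : ∀ i j (W : X.Opens) (hi : W ≤ V ⊓ U i) (hj : W ≤ U j) (b : Γ(X, W)),
      res (hi.trans inf_le_left) s = b • res hj (m j) →
      b • res hj (p j) = fres hi (a i) • res (hi.trans inf_le_right) (p i) := by
    intro i j W hi hj b hb
    obtain ⟨c, hc⟩ := (hm i W (hi.trans inf_le_right)).2 (res hj (m j))
    simp only at hc
    have hc' := compat i j W (hi.trans inf_le_right) hj c hc.symm
    have h1 := congr(res hi $(ha i))
    rw [res_smul, res_res, res_res, hb, ← hc, smul_smul] at h1
    have := (hm i W (hi.trans inf_le_right)).1 h1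
    rw [hc', smul_smul, this]
  have := TopCat.Sheaf.existsUnique_gluing' (C := Ab) ⟨P.presheaf, P.isSheaf⟩ (fun i => V ⊓ U i) V
    (fun i => homOfLE inf_le_left) (fun x hx => by
      obtain ⟨i, hi⟩ := cover x
      exact Opens.mem_iSup.2 ⟨i, hx, hi⟩) (fun i => a i • res inf_le_right (p i)) ?_
  · obtain ⟨t, ht, -⟩ := this
    refine ⟨t, fun j W hV hj b hb => ?_⟩
    have ht : ∀ i, res inf_le_left t = a i • res inf_le_right (p i) := ht
    refine eq_of_locally U (fun x _ => cover x) _ _ fun i W' hW' hi => ?_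
    have h2 : W' ≤ V ⊓ U i := le_inf (hW'.trans hV) hi
    have h1 := congr(res h2 $(ht i))
    rw [res_res, res_smul, res_res] at h1
    rw [res_res, h1, res_smul, res_res, key i j W' h2 (hW'.trans hj) (fres hW' b)]
    rw [← res_res hV hW', hb, res_smul, res_res]
  · intro i j
    change res inf_le_left (a i • res inf_le_right (p i)) = res inf_le_right (a j • res inf_le_right (p j))
    rw [res_smul, res_smul, res_res, res_res]
    refine (key i j _ inf_le_left (inf_le_right.trans inf_le_right) (fres inf_le_right (a j)) ?_).symm
    have := congr(res (inf_le_right : (V ⊓ U i) ⊓ (V ⊓ U j) ≤ V ⊓ U j) $(ha j))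
    rw [res_smul, res_res, res_res] at this
    exact this.symm

lemma exists_hom (cover : ∀ x : X, ∃ i, x ∈ U i)
    {m : ∀ i, Γ(M, U i)} (hm : ∀ i, IsFrame M (U i) (m i)) {p : ∀ i, Γ(P, U i)}
    (compat : ∀ i j (V : X.Opens) (hi : V ≤ U i) (hj : V ≤ U j) (a : Γ(X, V)),
      res hj (m j) = a • res hi (m i) → res hj (p j) = a • res hi (p i)) :
    ∃ φ : M ⟶ P, ∀ i, φ.app (U i) (m i) = p i := by
  choose θ hθ using fun V (s : Γ(M, V)) => Corr.exists (V := V) cover hm compat s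
  refine ⟨mkHom M P θ ?_ ?_ ?_, ?_⟩
  · intro V s t
    refine Corr.unique cover hm (hθ V _) fun i W hV hi a ha => ?_
    obtain ⟨b, hb⟩ := (hm i W hi).2 (res hV s)
    obtain ⟨c, hc⟩ := (hm i W hi).2 (res hV t)
    simp only at hb hc
    have h1 := hθ V s i W hV hi b hb.symm
    have h2 := hθ V t i W hV hi c hc.symm
    rw [res, map_add] at ha ⊢
    change res hV s + res hV t = _ at ha
    change res hV _ + res hV _ = _
    rw [h1, h2, ← add_smul]
    rw [← hb, ← hc, ← add_smul] at ha
    rw [(hm i W hi).1 ha]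
  · intro V r s
    refine Corr.unique cover hm (hθ V _) fun i W hV hi a ha => ?_
    obtain ⟨b, hb⟩ := (hm i W hi).2 (res hV s)
    simp only at hb
    have h1 := hθ V s i W hV hi b hb.symm
    rw [res_smul] at ha ⊢
    rw [← hb, smul_smul] at ha
    rw [h1, smul_smul, (hm i W hi).1 ha]
  · intro V V' h s
    refine (Corr.unique cover hm (hθ V' _) fun i W hV hi a ha => ?_).symm
    rw [res_res] at ha ⊢
    exact hθ V s i W _ hi a ha
  · intro i
    rw [mkHom_app]
    have := hθ (U i) (m i) i (U i) le_rfl le_rfl 1 (by rw [one_smul])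
    rwa [one_smul, res_self, res_self] at this


lemma hom_ext_frames (cover : ∀ x : X, ∃ i, x ∈ U i)
    {m : ∀ i, Γ(M, U i)} (hm : ∀ i, IsFrame M (U i) (m i))
    {φ ψ : M ⟶ P} (h : ∀ i, φ.app (U i) (m i) = ψ.app (U i) (m i)) : φ = ψ := by
  refine Scheme.Modules.hom_ext _ _ fun V => ?_
  ext s
  refine eq_of_locally U (fun x _ => cover x) _ _ fun i W hV hi => ?_
  obtain ⟨a, ha⟩ := (hm i W hi).2 (res hV s)
  simp only at ha
  rw [res_app, res_app, ← ha, Scheme.Modules.Hom.app_smul, Scheme.Modules.Hom.app_smul, ← res_app, ← res_app, h]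

lemma exists_iso (cover : ∀ x : X, ∃ i, x ∈ U i)
    {m : ∀ i, Γ(M, U i)} (hm : ∀ i, IsFrame M (U i) (m i))
    {p : ∀ i, Γ(P, U i)} (hp : ∀ i, IsFrame P (U i) (p i))
    (compat : ∀ i j (V : X.Opens) (hi : V ≤ U i) (hj : V ≤ U j) (a : Γ(X, V)),
      res hj (m j) = a • res hi (m i) → res hj (p j) = a • res hi (p i)) :
    ∃ e : M ≅ P, ∀ i, e.hom.app (U i) (m i) = p i := by
  obtain ⟨φ, hφ⟩ := exists_hom cover hm compat
  obtain ⟨ψ, hψ⟩ := exists_hom cover hp (p := m) fun i j V hi hj a h => by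
    obtain ⟨b, hb⟩ := (hm i V hi).2 (res hj (m j))
    simp only at hb
    have h' := compat i j V hi hj b hb.symm
    rw [h] at h'
    rw [(hp i V hi).1 h', hb]
  refine ⟨⟨φ, ψ, hom_ext_frames cover hm fun i => ?_, hom_ext_frames cover hp fun i => ?_⟩, hφ⟩
  · rw [Scheme.Modules.Hom.comp_app, ConcreteCategory.comp_apply, hφ, hψ]; rfl
  · rw [Scheme.Modules.Hom.comp_app, ConcreteCategory.comp_apply, hψ, hφ]; rfl
end MO

lemma isFrame_of_locally {M : X.Modules} {U : X.Opens} {s : Γ(M, U)}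
    (inj : ∀ (V : X.Opens) (h : V ≤ U) (a : Γ(X, V)), a • res h s = 0 → a = 0)
    (surj : ∀ (V : X.Opens) (h : V ≤ U) (t : Γ(M, V)), ∀ x ∈ V, ∃ (W : X.Opens) (hW : W ≤ V),
      x ∈ W ∧ ∃ a : Γ(X, W), a • res (hW.trans h) s = res hW t) : IsFrame M U s := by
  have inj' : ∀ (V : X.Opens) (h : V ≤ U) (a b : Γ(X, V)), a • res h s = b • res h s → a = b := by
    intro V h a b hab
    exact sub_eq_zero.1 (inj V h _ (by rw [sub_smul, hab, sub_self]))
  refine fun V h => ⟨fun a b => inj' V h a b, fun t => ?_⟩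
  choose W hW hx a ha using fun x : V => surj V h t x.1 x.2
  obtain ⟨b, hb, -⟩ := X.sheaf.existsUnique_gluing' W V (fun x => homOfLE (hW x))
    (fun x hxV => Opens.mem_iSup.2 ⟨⟨x, hxV⟩, hx _⟩) a (by
      intro x y
      refine inj' (W x ⊓ W y) ((inf_le_left.trans (hW x)).trans h) _ _ ?_
      have h1 := congr(res (inf_le_left : W x ⊓ W y ≤ W x) $(ha x))
      have h2 := congr(res (inf_le_right : W x ⊓ W y ≤ W y) $(ha y))
      rw [res_smul, res_res, res_res] at h1 h2
      exact h1.trans h2.symm)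
  refine ⟨b, eq_of_locally W (fun x hx' => ⟨⟨x, hx'⟩, hx _⟩) _ _ fun x W' hV hi => ?_⟩
  have hb' : fres (hW x) b = a x := hb x
  have h1 := congr(res hi $(ha x))
  rw [← hb', res_smul, res_res, res_res] at h1
  change res hV ((show Γ(X, V) from b) • res h s) = _
  rw [res_smul, res_res, ← h1]
  congr 1
  exact (fres_fres _ _ _).symm

section Sheafify

/-- Presheaves of `𝒪_X`-modules. -/
abbrev PreMod (X : Scheme.{u}) := PresheafOfModules.{u} (X.presheaf ⋙ forget₂ CommRingCat RingCat)

instance (P : PreMod X) (U : X.Opens) : Module Γ(X, U) (P.obj (op U)) := (P.obj (op U)).isModule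

/-- The sheaf of modules associated to a presheaf of modules. -/
def shf (P : PreMod X) : X.Modules :=
  (PresheafOfModules.sheafification (𝟙 X.ringCatSheaf.obj)).obj P

/-- The canonical map to the associated sheaf. -/
def shfUnit (P : PreMod X) :
    P ⟶ (PresheafOfModules.restrictScalars (𝟙 X.ringCatSheaf.obj)).obj (shf P).val :=
  (PresheafOfModules.sheafificationAdjunction (𝟙 X.ringCatSheaf.obj)).unit.app P

/-- The canonical map to the associated sheaf, on sections. -/
def toShf {P : PreMod X} {U : X.Opens} : P.obj (op U) →+ Γ(shf P, U) :=
  ((shfUnit P).app (op U)).hom.toAddMonoidHom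

variable {P : PreMod X} {U V : X.Opens}

/-- Restriction of a section of a presheaf of modules. -/
def pres (h : V ≤ U) (z : P.obj (op U)) : P.obj (op V) := P.map (homOfLE h).op z

lemma toShf_smul (a : Γ(X, U)) (z : P.obj (op U)) : toShf (a • z) = a • toShf z :=
  ((shfUnit P).app (op U)).hom.map_smul a z

lemma res_toShf (h : V ≤ U) (z : P.obj (op U)) : res h (toShf z) = toShf (pres h z) :=
  (PresheafOfModules.naturality_apply (shfUnit P) (homOfLE h).op z).symm

lemma toShf_inj (z : P.obj (op U)) (hz : toShf z = 0) (x : X) (hx : x ∈ U) :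
    ∃ (V : X.Opens) (h : V ≤ U), x ∈ V ∧ pres h z = 0 := by
  have := Presheaf.equalizerSieve_mem (Opens.grothendieckTopology X)
    (CategoryTheory.toSheafify (Opens.grothendieckTopology X) P.presheaf)
    (X := op U) z 0 (hz.trans (map_zero (toShf (P := P) (U := U))).symm)
  obtain ⟨V, f, hf, hV⟩ := this x hx
  exact ⟨V, leOfHom f, hV, Eq.trans hf (map_zero (P.map (homOfLE (leOfHom f)).op).hom)⟩

lemma toShf_surj (t : Γ(shf P, U)) (x : X) (hx : x ∈ U) :
    ∃ (V : X.Opens) (h : V ≤ U), x ∈ V ∧ ∃ z : P.obj (op V), toShf z = res h t := by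
  have := Presheaf.imageSieve_mem (Opens.grothendieckTopology X)
    (CategoryTheory.toSheafify (Opens.grothendieckTopology X) P.presheaf) (U := op U) t
  obtain ⟨V, f, ⟨z, hz⟩, hV⟩ := this x hx
  exact ⟨V, leOfHom f, hV, z, hz⟩

lemma isFrame_toShf {z : P.obj (op U)}
    (hz : ∀ (V : X.Opens) (h : V ≤ U), Function.Bijective (fun a : Γ(X, V) => a • pres h z)) :
    IsFrame (shf P) U (toShf z) := by
  have hp : ∀ (W V : X.Opens) (hW : W ≤ V) (h : V ≤ U) (a : Γ(X, V)),
      pres hW (a • pres h z) = fres hW a • pres (hW.trans h) z := by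
    intro W V hW h a
    refine (P.map_smul (homOfLE hW).op a _).trans ?_
    change fres hW a • pres hW (pres h z) = _
    congr 1
    exact (congr($(P.presheaf.map_comp (homOfLE h).op (homOfLE hW).op) z)).symm
  refine isFrame_of_locally (fun V h a ha => ?_) fun V h t' x hx => ?_
  · have ha' : toShf (a • pres h z) = 0 := by rw [toShf_smul, ← ha, res_toShf]
    refine TopCat.Sheaf.eq_of_locally_eq' X.sheaf
      (fun W : {W : X.Opens // ∃ h : W ≤ V, fres h a = 0} => W.1) V (fun W => homOfLE W.2.1) ?_ a 0
      fun W => W.2.2.trans (map_zero (X.presheaf.map (homOfLE W.2.1).op).hom).symm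
    intro x hx
    obtain ⟨W, hW, hxW, h0⟩ := toShf_inj _ ha' x hx
    refine Opens.mem_iSup.2 ⟨⟨W, hW, (hz W (hW.trans h)).1 ?_⟩, hxW⟩
    rw [hp] at h0
    exact h0.trans (zero_smul Γ(X, W) (pres (hW.trans h) z)).symm
  · obtain ⟨W, hW, hxW, y, hy⟩ := toShf_surj t' x hx
    obtain ⟨a, ha⟩ := (hz W (hW.trans h)).2 y
    refine ⟨W, hW, hxW, a, ?_⟩
    rw [← hy, ← ha, toShf_smul, res_toShf]

end Sheafify

section Tensor

/-- The underlying presheaf of modules of a sheaf of modules. -/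
abbrev pre (L : X.Modules) : PreMod X := L.val

/-- The tensor product of sheaves of modules. -/
def tensor (L L' : X.Modules) : X.Modules :=
  shf (MonoidalCategory.tensorObj (pre L) (pre L'))

variable {L L' : X.Modules} {U V : X.Opens}

open scoped TensorProduct in
/-- The section `s ⊗ t` of `L ⊗ L'`. -/
def tmul (s : Γ(L, U)) (t : Γ(L', U)) : Γ(tensor L L', U) :=
  toShf (P := MonoidalCategory.tensorObj (pre L) (pre L'))
    ((show (pre L).obj (op U) from s) ⊗ₜ[X.presheaf.obj (op U)] (show (pre L').obj (op U) from t))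

lemma smul_tmul (a b : Γ(X, U)) (s : Γ(L, U)) (t : Γ(L', U)) :
    tmul (a • s) (b • t) = (a * b) • tmul s t := by
  refine Eq.trans ?_ (toShf_smul _ _)
  refine congrArg toShf ?_
  exact TensorProduct.smul_tmul_smul (R := X.presheaf.obj (op U)) a b
    (show (pre L).obj (op U) from s) (show (pre L').obj (op U) from t)

lemma res_tmul (h : V ≤ U) (s : Γ(L, U)) (t : Γ(L', U)) :
    res h (tmul s t) = tmul (res h s) (res h t) :=
  res_toShf h _

lemma tmul_bijective_aux (R : CommRingCat.{u}) (A B : Type u) [AddCommGroup A] [AddCommGroup B]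
    [Module R A] [Module R B] (s : A) (t : B)
    (hs : Function.Bijective (fun a : R => a • s)) (ht : Function.Bijective (fun a : R => a • t)) :
    Function.Bijective (fun a : R => a • (TensorProduct.tmul R s t)) := by
  have := (TensorProduct.congr (LinearEquiv.ofBijective (LinearMap.toSpanSingleton R A s) hs)
    (LinearEquiv.ofBijective (LinearMap.toSpanSingleton R B t) ht)).bijective.comp
      (TensorProduct.lid R R).symm.bijective
  convert this using 2 with a
  change a • TensorProduct.tmul R s t = TensorProduct.tmul R ((1 : R) • s) (a • t)
  rw [one_smul, TensorProduct.tmul_smul]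

lemma IsFrame.tmul {s : Γ(L, U)} {t : Γ(L', U)} (hs : IsFrame L U s) (ht : IsFrame L' U t) :
    IsFrame (tensor L L') U (tmul s t) :=
  isFrame_toShf fun V h => tmul_bijective_aux (X.presheaf.obj (op V))
    ((pre L).obj (op V)) ((pre L').obj (op V)) (res h s) (res h t) (hs V h) (ht V h)

end Tensor

section Dual

variable (L : X.Modules)

lemma fres_mul {U V : X.Opens} (h : V ≤ U) (a b : Γ(X, U)) : fres h (a * b) = fres h a * fres h b :=
  map_mul (X.presheaf.map (homOfLE h).op).hom a b

lemma fres_one {U V : X.Opens} (h : V ≤ U) : fres (X := X) h 1 = 1 :=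
  map_one (X.presheaf.map (homOfLE h).op).hom

/-- The `𝒪_U`-linear maps `L|_U ⟶ 𝒪_U`. -/
def dualSub (U : X.Opens) : AddSubgroup (∀ V : {V : X.Opens // V ≤ U}, Γ(L, V) → Γ(X, V)) where
  carrier := {l | (∀ V s s', l V (s + s') = l V s + l V s') ∧ (∀ V a s, l V (a • s) = a * l V s) ∧
    ∀ (V W : {V : X.Opens // V ≤ U}) (h : W.1 ≤ V.1) s, l W (res h s) = fres h (l V s)}
  zero_mem' := ⟨fun _ _ _ => (add_zero _).symm, fun _ _ _ => (mul_zero _).symm,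
    fun V W h s => (map_zero (X.presheaf.map (homOfLE h).op).hom).symm⟩
  add_mem' := fun {l l'} hl hl' => ⟨fun V s s' => by
      simp only [Pi.add_apply, hl.1, hl'.1]; abel, fun V a s => by
      simp only [Pi.add_apply, hl.2.1, hl'.2.1, mul_add], fun V W h s => by
      simp only [Pi.add_apply, hl.2.2 V W h, hl'.2.2 V W h, fres, map_add]⟩
  neg_mem' := fun {l} hl => ⟨fun V s s' => by
      simp only [Pi.neg_apply, hl.1]; abel, fun V a s => by
      simp only [Pi.neg_apply, hl.2.1, mul_neg], fun V W h s => by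
      simp only [Pi.neg_apply, hl.2.2 V W h, fres, map_neg]⟩

/-- The scalar multiplication on `𝒪_U`-linear maps. -/
def dualSmul (U : X.Opens) (a : Γ(X, U)) (l : dualSub L U) : dualSub L U :=
  ⟨fun V s => fres V.2 a * l.1 V s, fun V s s' => by
    change _ * l.1 V _ = _ * l.1 V _ + _ * l.1 V _
    rw [l.2.1, mul_add], fun V b s => by
    change _ * l.1 V _ = _ * (_ * l.1 V _)
    rw [l.2.2.1]; ring, fun V W h s => by
    change _ * l.1 W _ = fres h (_ * l.1 V _)
    rw [l.2.2.2 V W h, fres_mul, fres_fres]⟩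

instance (U : X.Opens) : Module Γ(X, U) (dualSub L U) where
  smul := dualSmul L U
  one_smul l := Subtype.ext <| funext₂ fun V s => by
    change fres V.2 1 * l.1 V s = _
    rw [fres_one, one_mul]
  mul_smul a b l := Subtype.ext <| funext₂ fun V s => by
    change fres V.2 (a * b) * l.1 V s = fres V.2 a * (fres V.2 b * l.1 V s)
    rw [fres_mul, mul_assoc]
  smul_zero a := Subtype.ext <| funext₂ fun V s => mul_zero _
  smul_add a l l' := Subtype.ext <| funext₂ fun V s => mul_add _ _ _
  add_smul a b l := Subtype.ext <| funext₂ fun V s => by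
    change fres V.2 (a + b) * l.1 V s = fres V.2 a * l.1 V s + fres V.2 b * l.1 V s
    rw [fres, map_add, add_mul]
  zero_smul l := Subtype.ext <| funext₂ fun V s => by
    change fres V.2 0 * l.1 V s = 0
    rw [fres, map_zero, zero_mul]

/-- Restriction of `𝒪_U`-linear maps. -/
def dualRes {U V : X.Opens} (h : V ≤ U) : dualSub L U →+ dualSub L V where
  toFun l := ⟨fun W s => l.1 ⟨W.1, W.2.trans h⟩ s, fun W s s' => l.2.1 ⟨W.1, W.2.trans h⟩ s s',
    fun W a s => l.2.2.1 ⟨W.1, W.2.trans h⟩ a s,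
    fun W W' h' s => l.2.2.2 ⟨W.1, W.2.trans h⟩ ⟨W'.1, W'.2.trans h⟩ h' s⟩
  map_zero' := rfl
  map_add' _ _ := rfl

/-- The presheaf of abelian groups `U ↦ Hom(L|_U, 𝒪_U)`. -/
def dualAb : X.Opensᵒᵖ ⥤ Ab.{u} where
  obj U := .of (dualSub L U.unop)
  map i := AddCommGrpCat.ofHom (dualRes L (leOfHom i.unop))
  map_id _ := rfl
  map_comp _ _ := rfl

instance (U : X.Opensᵒᵖ) : Module ((X.presheaf ⋙ forget₂ CommRingCat RingCat).obj U) ((dualAb L).obj U) :=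
  inferInstanceAs (Module Γ(X, U.unop) (dualSub L U.unop))

lemma dualAb_map_smul ⦃U V : X.Opensᵒᵖ⦄ (i : U ⟶ V) (a : Γ(X, U.unop)) (l : dualSub L U.unop) :
    dualRes L (leOfHom i.unop) (a • l) = (fres (leOfHom i.unop) a) • dualRes L (leOfHom i.unop) l :=
  Subtype.ext <| funext₂ fun W s => by
    change fres _ a * _ = fres W.2 (fres _ a) * _
    rw [fres_fres]; rfl

/-- The presheaf of modules `U ↦ Hom(L|_U, 𝒪_U)`. -/
def dualPre : PreMod X := PresheafOfModules.ofPresheaf (dualAb L) (dualAb_map_smul L)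

/-- The dual `ℋom(L, 𝒪_X)`. -/
def dual : X.Modules := shf (dualPre L)

variable {L} {U V : X.Opens}

/-- The coefficient of a section with respect to a frame. -/
def dcoef {s : Γ(L, U)} (hs : IsFrame L U s) (V : {V : X.Opens // V ≤ U}) (t : Γ(L, V)) : Γ(X, V) :=
  ((hs V.1 V.2).2 t).choose

lemma dcoef_spec {s : Γ(L, U)} (hs : IsFrame L U s) (V : {V : X.Opens // V ≤ U}) (t : Γ(L, V)) :
    dcoef hs V t • res V.2 s = t := ((hs V.1 V.2).2 t).choose_spec

lemma dcoef_eq {s : Γ(L, U)} (hs : IsFrame L U s) {V : {V : X.Opens // V ≤ U}} {t : Γ(L, V)}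
    {a : Γ(X, V)} (h : a • res V.2 s = t) : dcoef hs V t = a :=
  (hs V.1 V.2).1 ((dcoef_spec hs V t).trans h.symm)

/-- The linear form dual to a frame. -/
def dsecSub {s : Γ(L, U)} (hs : IsFrame L U s) : dualSub L U :=
  ⟨dcoef hs, fun V t t' => dcoef_eq hs (by rw [add_smul, dcoef_spec, dcoef_spec]),
    fun V a t => dcoef_eq hs (by rw [mul_smul, dcoef_spec]),
    fun V W h t => dcoef_eq hs (by
      have := congr(res h $(dcoef_spec hs V t))
      rwa [res_smul, res_res] at this)⟩

/-- The linear form dual to a frame, as a section of the presheaf dual. -/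
def dsecPre {s : Γ(L, U)} (hs : IsFrame L U s) : (dualPre L).obj (op U) := dsecSub hs

/-- The section of the dual that is dual to a frame `s`. -/
def dsec {s : Γ(L, U)} (hs : IsFrame L U s) : Γ(dual L, U) := toShf (dsecPre hs)

lemma dsecSub_res {s : Γ(L, U)} (hs : IsFrame L U s) (h : V ≤ U) :
    dualRes L h (dsecSub hs) = dsecSub (frame_res hs h) :=
  Subtype.ext <| funext₂ fun W t => (dcoef_eq (frame_res hs h) (by
    rw [res_res]
    exact dcoef_spec hs ⟨W.1, W.2.trans h⟩ t)).symm

lemma dsecSub_bijective {s : Γ(L, U)} (hs : IsFrame L U s) :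
    Function.Bijective (fun a : Γ(X, U) => a • dsecSub hs) := by
  have key : ∀ a : Γ(X, U), (a • dsecSub hs).1 ⟨U, le_rfl⟩ s = a := by
    intro a
    change fres le_rfl a * dcoef hs ⟨U, le_rfl⟩ s = a
    rw [fres_self, dcoef_eq hs (a := 1) (by rw [one_smul, res_self]), mul_one]
  refine ⟨fun a b hab => ?_, fun l => ⟨l.1 ⟨U, le_rfl⟩ s, ?_⟩⟩
  · rw [← key a, ← key b]
    exact congr(($hab).1 ⟨U, le_rfl⟩ s)
  · refine Subtype.ext <| funext₂ fun V t => ?_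
    change fres V.2 _ * dcoef hs V t = l.1 V t
    conv_rhs => rw [← dcoef_spec hs V t, l.2.2.1, l.2.2.2 ⟨U, le_rfl⟩ V V.2]
    rw [mul_comm]

lemma isFrame_dsec {s : Γ(L, U)} (hs : IsFrame L U s) : IsFrame (dual L) U (dsec hs) := by
  refine isFrame_toShf fun V h => ?_
  have := dsecSub_bijective (frame_res hs h)
  rw [← dsecSub_res] at this
  exact this

lemma res_dsec {s : Γ(L, U)} (hs : IsFrame L U s) (h : V ≤ U) :
    res h (dsec hs) = dsec (frame_res hs h) :=
  (res_toShf h _).trans (congrArg (toShf (P := dualPre L)) (dsecSub_res hs h))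

lemma smul_dsec {s t : Γ(L, U)} (hs : IsFrame L U s) (ht : IsFrame L U t) (a : Γ(X, U)) (h : t = a • s) :
    dsec hs = a • dsec ht := by
  refine Eq.trans (congrArg (toShf (P := dualPre L)) ?_) (toShf_smul _ _)
  refine Subtype.ext <| funext₂ fun W r => ?_
  change dcoef hs W r = fres W.2 a * dcoef ht W r
  refine dcoef_eq hs ?_
  rw [mul_comm, mul_smul, ← res_smul, ← h]
  exact dcoef_spec ht W r

end Dual

section Pullback

/-- The pullback `f^* L`. -/
abbrev pull (f : X ⟶ Y) (L : Y.Modules) : X.Modules := (Scheme.Modules.pullback f).obj L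

/-- The canonical map `L ⟶ f_* f^* L`. -/
def pullUnit (f : X ⟶ Y) (L : Y.Modules) : L ⟶ (Scheme.Modules.pushforward f).obj (pull f L) :=
  (Scheme.Modules.pullbackPushforwardAdjunction f).unit.app L

/-- The pullback of a section. -/
def pullSec (f : X ⟶ Y) {L : Y.Modules} {U : Y.Opens} (s : Γ(L, U)) : Γ(pull f L, f ⁻¹ᵁ U) :=
  papp (pullUnit f L) s

variable (f : X ⟶ Y) {L : Y.Modules} {U V : Y.Opens}

lemma pullSec_res (h : V ≤ U) (s : Γ(L, U)) :
    pullSec f (res h s) = res (f.preimage_mono h) (pullSec f s) :=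
  papp_res _ h s

lemma pullSec_smul (a : Γ(Y, U)) (s : Γ(L, U)) :
    pullSec f (a • s) = f.app U a • pullSec f s :=
  papp_smul _ a s

variable {f} in
lemma pull_hom_ext {N : X.Modules} {φ ψ : pull f L ⟶ N}
    (h : ∀ U (s : Γ(L, U)), φ.app _ (pullSec f s) = ψ.app _ (pullSec f s)) : φ = ψ := by
  apply ((Scheme.Modules.pullbackPushforwardAdjunction f).homEquiv _ _).injective
  rw [Adjunction.homEquiv_unit, Adjunction.homEquiv_unit]
  refine Scheme.Modules.hom_ext _ _ fun U => ?_
  ext s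
  exact h U s

variable {f} in
lemma pull_exists_hom {N : X.Modules} (θ : L ⟶ (Scheme.Modules.pushforward f).obj N) :
    ∃ φ : pull f L ⟶ N, ∀ U (s : Γ(L, U)), φ.app _ (pullSec f s) = papp θ s := by
  refine ⟨((Scheme.Modules.pullbackPushforwardAdjunction f).homEquiv _ _).symm θ, fun U s => ?_⟩
  have := ((Scheme.Modules.pullbackPushforwardAdjunction f).homEquiv _ _).apply_symm_apply θ
  rw [Adjunction.homEquiv_unit] at this
  exact congr(papp $this s)

/-- `j_* j^* M` for the inclusion `j` of an open subscheme. -/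
def jj (U : X.Opens) (M : X.Modules) : X.Modules :=
  (Scheme.Modules.pushforward U.ι).obj (M.restrict U.ι)

/-- The structure sheaf. -/
abbrev unitM (X : Scheme.{u}) : X.Modules := SheafOfModules.unit X.ringCatSheaf

lemma jj_smul (U : X.Opens) (M : X.Modules) (V : X.Opens) (a : Γ(X, V)) 
    (s : Γ(M, U.ι ''ᵁ (U.ι ⁻¹ᵁ V))) (h) :
    (show Γ(M, U.ι ''ᵁ (U.ι ⁻¹ᵁ V)) from a • (show Γ(jj U M, V) from s)) =
      fres (V := U.ι ''ᵁ (U.ι ⁻¹ᵁ V)) h a • s := by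
  change (U.ι.appIso _).inv (U.ι.app V a) • s = _
  congr 1
  simp
  rfl

lemma jj_res (U : X.Opens) (M : X.Modules) {V W : X.Opens} (h : W ≤ V)
    (s : Γ(M, U.ι ''ᵁ (U.ι ⁻¹ᵁ V))) (h') :
    (show Γ(M, U.ι ''ᵁ (U.ι ⁻¹ᵁ W)) from res (M := jj U M) h (show Γ(jj U M, V) from s)) =
      res (M := M) (U := U.ι ''ᵁ (U.ι ⁻¹ᵁ V)) h' s := rfl
/-- The open set `U ⊓ V`, as an image of an open subset of `U`. -/
abbrev im (U V : X.Opens) : X.Opens := U.ι ''ᵁ (U.ι ⁻¹ᵁ V)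

lemma mem_im {U V : X.Opens} {x : X} : x ∈ im U V ↔ x ∈ U ∧ x ∈ V := by
  simp [im, Scheme.Hom.image_preimage_eq_opensRange_inf]

lemma im_le_left {U V : X.Opens} : im U V ≤ U := fun _ hx => (mem_im.1 hx).1
lemma im_le {U V : X.Opens} : im U V ≤ V := fun _ hx => (mem_im.1 hx).2
lemma le_im {U V : X.Opens} (h : V ≤ U) : V ≤ im U V := fun _ hx => mem_im.2 ⟨h hx, hx⟩
lemma im_mono {U V W : X.Opens} (h : W ≤ V) : im U W ≤ im U V :=
  fun _ hx => mem_im.2 ⟨(mem_im.1 hx).1, h (mem_im.1 hx).2⟩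

/-- The canonical map `M ⟶ j_* j^* M`. -/
def jjCan (U : X.Opens) (M : X.Modules) : M ⟶ jj U M :=
  mkHom M (jj U M) (fun V t => res (V := im U V) im_le t)
    (fun V s t => map_add (M.presheaf.map (homOfLE (im_le : im U V ≤ V)).op).hom s t)
    (fun V a s => (res_smul _ a s).trans (jj_smul U M V a _ im_le).symm)
    (fun _ _ h s => (jj_res U M h _ (im_mono h)).trans ((res_res _ _ s).trans (res_res _ _ s).symm))

/-- Multiplication of functions with a section. -/
def jjMul {U : X.Opens} {M : X.Modules} (e : Γ(M, U)) : jj U (unitM X) ⟶ jj U M :=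
  mkHom _ (jj U M) (fun V b => (show Γ(X, im U V) from b) • res (V := im U V) im_le_left e)
    (fun V a b => add_smul (show Γ(X, im U V) from a) (show Γ(X, im U V) from b)
      (res (M := M) (V := im U V) im_le_left e))
    (fun V a b => by
      refine Eq.trans ?_ (jj_smul U M V a _ im_le).symm
      refine Eq.trans ?_ (smul_smul (fres (V := im U V) im_le a) (show Γ(X, im U V) from b)
        (res (M := M) (V := im U V) im_le_left e)).symm
      exact congr((show Γ(X, im U V) from $(jj_smul U (unitM X) V a b im_le)) •
        (res (M := M) (V := im U V) im_le_left e)))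
    (fun V W h b => by
      refine (jj_res U M h _ (im_mono h)).trans ?_
      refine (res_smul _ _ _).trans ?_
      rw [res_res]; rfl)

section
variable {s : Γ(L, U)} (hs : IsFrame L U s)

/-- The coefficient of a section with respect to a frame. -/
def coef (W : Y.Opens) (t : Γ(L, W)) : Γ(Y, W ⊓ U) :=
  ((hs (W ⊓ U) inf_le_right).2 (res inf_le_left t)).choose

lemma coef_spec (W : Y.Opens) (t : Γ(L, W)) : coef hs W t • res inf_le_right s = res inf_le_left t :=
  ((hs (W ⊓ U) inf_le_right).2 (res inf_le_left t)).choose_spec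

lemma coef_unique {W : Y.Opens} {t : Γ(L, W)} {a : Γ(Y, W ⊓ U)}
    (h : a • res inf_le_right s = res inf_le_left t) : coef hs W t = a :=
  (hs (W ⊓ U) inf_le_right).1 ((coef_spec hs W t).trans h.symm)

lemma im_pre_le (W : Y.Opens) : im (f ⁻¹ᵁ U) (f ⁻¹ᵁ W) ≤ f ⁻¹ᵁ (W ⊓ U) :=
  fun _ hx => ⟨(mem_im.1 hx).2, (mem_im.1 hx).1⟩

/-- The coefficient with respect to a frame, as a semilinear map. -/
def coefHom : L ⟶ (Scheme.Modules.pushforward f).obj (jj (f ⁻¹ᵁ U) (unitM X)) :=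
  mkHom _ _ (fun W t => (fres (im_pre_le f W) (f.app (W ⊓ U) (coef hs W t)) : Γ(X, im (f ⁻¹ᵁ U) (f ⁻¹ᵁ W))))
    (fun W t t' => by
      rw [coef_unique hs (t := t + t') (a := coef hs W t + coef hs W t') (by
        rw [add_smul, coef_spec, coef_spec, res, res, res, map_add])]
      rw [map_add]
      exact map_add (X.presheaf.map (homOfLE (im_pre_le f W)).op).hom _ _)
    (fun W a t => by
      rw [coef_unique hs (t := a • t) (a := fres inf_le_left a * coef hs W t) (by
        rw [mul_smul, coef_spec, res_smul])]
      rw [map_mul]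
      refine (map_mul (X.presheaf.map (homOfLE (im_pre_le f W)).op).hom _ _).trans ?_
      refine Eq.trans ?_ (jj_smul (f ⁻¹ᵁ U) (unitM X) (f ⁻¹ᵁ W) (f.app W a) _ im_le).symm
      exact congrArg (fun z : Γ(X, im (f ⁻¹ᵁ U) (f ⁻¹ᵁ W)) => z *
        fres (im_pre_le f W) (f.app (W ⊓ U) (coef hs W t))) (fapp_res f inf_le_left _ a im_le))
    (fun W W' h t => by
      rw [coef_unique hs (W := W') (t := res h t) (a := fres (inf_le_inf_right U h) (coef hs W t)) (by
        have := congr(res (inf_le_inf_right U h : W' ⊓ U ≤ W ⊓ U) $(coef_spec hs W t))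
        rw [res_smul, res_res, res_res] at this
        rw [this, res_res])]
      rw [fapp_res f _ _ _ ((im_pre_le f W').trans (f.preimage_mono (inf_le_inf_right U h)))]
      exact (jj_res (f ⁻¹ᵁ U) (unitM X) (f.preimage_mono h) _
        (im_mono (f.preimage_mono h))).trans (fres_fres (im_pre_le f W) _ _))
end

lemma IsFrame.of_universal {E : X.Modules} (η : L ⟶ (Scheme.Modules.pushforward f).obj E)
    (hext : ∀ (N : X.Modules) (φ ψ : E ⟶ N), (∀ (W : Y.Opens) (t : Γ(L, W)),
      φ.app (f ⁻¹ᵁ W) (papp η t) = ψ.app (f ⁻¹ᵁ W) (papp η t)) → φ = ψ)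
    (hex : ∀ (N : X.Modules) (θ : L ⟶ (Scheme.Modules.pushforward f).obj N), ∃ φ : E ⟶ N,
      ∀ (W : Y.Opens) (t : Γ(L, W)), φ.app (f ⁻¹ᵁ W) (papp η t) = papp θ t)
    {s : Γ(L, U)} (hs : IsFrame L U s) : IsFrame E (f ⁻¹ᵁ U) (papp η s) := by
  obtain ⟨κ, hκ⟩ := hex _ (coefHom f hs)
  have key : κ ≫ jjMul (M := E) (papp η s) = jjCan (f ⁻¹ᵁ U) E := by
    refine hext _ _ _ fun W t => ?_
    have h1 := hκ W t
    change (jjMul (M := E) (papp η s)).app _ (κ.app _ _) = _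
    rw [h1]
    change fres (im_pre_le f W) (f.app (W ⊓ U) (coef hs W t)) •
        res (M := E) (V := im (f ⁻¹ᵁ U) (f ⁻¹ᵁ W)) im_le_left (papp η s) =
      res (M := E) (V := im (f ⁻¹ᵁ U) (f ⁻¹ᵁ W)) im_le (papp η t)
    have h2 := congr(res (im_pre_le f W) (papp η $(coef_spec hs W t)))
    rw [papp_smul, res_smul, papp_res, papp_res, res_res, res_res] at h2
    exact h2
  have hκs : κ.app _ (papp η s) = (show Γ(X, im (f ⁻¹ᵁ U) (f ⁻¹ᵁ U)) from 1) := by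
    rw [hκ]
    change fres (im_pre_le f U) (f.app (U ⊓ U) (coef hs U s)) = 1
    rw [coef_unique hs (W := U) (t := s) (a := 1) (one_smul _ _), map_one]
    exact map_one (X.presheaf.map (homOfLE (im_pre_le f U)).op).hom
  intro V hV
  have hκa : ∀ a : Γ(X, V), κ.app V (a • res hV (papp η s)) =
      (show Γ(X, im (f ⁻¹ᵁ U) V) from fres im_le a) := by
    intro a
    rw [Scheme.Modules.Hom.app_smul, ← res_app, hκs]
    refine (jj_smul (f ⁻¹ᵁ U) (unitM X) V a _ im_le).trans ?_
    refine Eq.trans ?_ (mul_one (fres im_le a))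
    refine congrArg (fun z : Γ(X, im (f ⁻¹ᵁ U) V) => fres im_le a * z) ?_
    refine (jj_res (f ⁻¹ᵁ U) (unitM X) hV _ (im_mono hV)).trans ?_
    exact map_one (X.presheaf.map (homOfLE (im_mono hV)).op).hom
  refine ⟨fun a b hab => ?_, fun t => ?_⟩
  · have h1 := congr(κ.app V $hab)
    simp only [hκa] at h1
    have h2 := congr(fres (le_im hV) $h1)
    rwa [fres_fres, fres_fres, fres_self, fres_self] at h2
  · refine ⟨fres (le_im hV) (show Γ(X, im (f ⁻¹ᵁ U) V) from κ.app V t), ?_⟩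
    have h1 : (show Γ(X, im (f ⁻¹ᵁ U) V) from κ.app V t) • res im_le_left (papp η s) =
      res im_le t := congr(($key).app V t)
    have h2 := congr(res (le_im hV) $h1)
    rw [res_smul, res_res, res_res, res_self] at h2
    exact h2

lemma IsFrame.pullSec {s : Γ(L, U)} (hs : IsFrame L U s) :
    IsFrame (pull f L) (f ⁻¹ᵁ U) (pullSec f s) :=
  IsFrame.of_universal f (pullUnit f L)
    (fun _ _ _ h => pull_hom_ext h) (fun _ θ => pull_exists_hom θ) hs

end Pullback

section Semilinear

lemma papp_add {f : X ⟶ Y} {L : Y.Modules} {M : X.Modules}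
    (θ : L ⟶ (Scheme.Modules.pushforward f).obj M) {U : Y.Opens} (s t : Γ(L, U)) :
    papp θ (s + t) = papp θ s + papp θ t :=
  map_add (θ.app U).hom s t

lemma exists_push {f : X ⟶ Y} {M : Y.Modules} {P : X.Modules} {ι : Type*} {U : ι → Y.Opens}
    (cover : ∀ x : Y, ∃ i, x ∈ U i)
    {m : ∀ i, Γ(M, U i)} (hm : ∀ i, IsFrame M (U i) (m i)) {p : ∀ i, Γ(P, f ⁻¹ᵁ U i)}
    (compat : ∀ i j (V : Y.Opens) (hi : V ≤ U i) (hj : V ≤ U j) (a : Γ(Y, V)),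
      res hj (m j) = a • res hi (m i) →
      res (f.preimage_mono hj) (p j) = f.app V a • res (f.preimage_mono hi) (p i)) :
    ∃ θ : M ⟶ (Scheme.Modules.pushforward f).obj P, ∀ i, papp θ (m i) = p i :=
  exists_hom (P := (Scheme.Modules.pushforward f).obj P) cover hm compat

/-- The identity, as a semilinear map. -/
def pid (M : X.Modules) : M ⟶ (Scheme.Modules.pushforward (𝟙 X)).obj M :=
  mkHom _ _ (fun _ s => s) (fun _ _ _ => rfl)
    (fun _ _ _ => rfl) (fun _ _ _ _ => rfl)

/-- The composition of semilinear maps. -/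
def pcomp {Z : Scheme.{u}} {f : X ⟶ Y} {g : Y ⟶ Z} {L : Z.Modules} {M : Y.Modules} {N : X.Modules}
    (θ : L ⟶ (Scheme.Modules.pushforward g).obj M) (θ' : M ⟶ (Scheme.Modules.pushforward f).obj N) :
    L ⟶ (Scheme.Modules.pushforward (f ≫ g)).obj N :=
  mkHom _ _ (fun _ s => papp θ' (papp θ s))
    (fun V s t => by
      rw [papp_add, papp_add]; rfl)
    (fun V a s => by
      rw [papp_smul, papp_smul]; rfl)
    (fun U V h s => by
      rw [papp_res, papp_res]; rfl)

lemma push_ext_frames {f f' : X ⟶ Y} (hf : f = f') {L : Y.Modules} {M : X.Modules}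
    {θ : L ⟶ (Scheme.Modules.pushforward f).obj M} {θ' : L ⟶ (Scheme.Modules.pushforward f').obj M}
    {ι : Type*} {U : ι → Y.Opens} (cover : ∀ x : Y, ∃ i, x ∈ U i)
    {m : ∀ i, Γ(L, U i)} (hm : ∀ i, IsFrame L (U i) (m i))
    (h : ∀ i (V : X.Opens) (h : V ≤ f ⁻¹ᵁ U i) (h' : V ≤ f' ⁻¹ᵁ U i),
      res h (papp θ (m i)) = res h' (papp θ' (m i)))
    {W : Y.Opens} (s : Γ(L, W)) (V : X.Opens) (h1 : V ≤ f ⁻¹ᵁ W) (h2 : V ≤ f' ⁻¹ᵁ W) :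
    res h1 (papp θ s) = res h2 (papp θ' s) := by
  subst hf
  have : θ = θ' := hom_ext_frames cover hm fun i => by
    have := h i _ le_rfl le_rfl
    rw [res_self, res_self] at this
    exact this
  rw [this]

lemma IsFrame.iso_app {M P : X.Modules} (e : M ≅ P) {U : X.Opens} {s : Γ(M, U)} (hs : IsFrame M U s) :
    IsFrame P U (e.hom.app U s) := by
  have h1 : ∀ V (t : Γ(P, V)), e.hom.app V (e.inv.app V t) = t := fun V t => by
    rw [← ConcreteCategory.comp_apply, ← Scheme.Modules.Hom.comp_app, e.inv_hom_id]; rfl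
  have h2 : ∀ V (t : Γ(M, V)), e.inv.app V (e.hom.app V t) = t := fun V t => by
    rw [← ConcreteCategory.comp_apply, ← Scheme.Modules.Hom.comp_app, e.hom_inv_id]; rfl
  refine fun V h => ⟨fun a b hab => (hs V h).1 ?_, fun t => ?_⟩
  · have := congr(e.inv.app V $hab)
    simp only [res_app, ← Scheme.Modules.Hom.app_smul, h2] at this
    exact this
  · obtain ⟨a, ha⟩ := (hs V h).2 (e.inv.app V t)
    refine ⟨a, ?_⟩
    simp only at ha ⊢
    rw [res_app, ← Scheme.Modules.Hom.app_smul, ha, h1]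

lemma exists_iso_of_hom {M P : X.Modules} (φ : M ⟶ P) {ι : Type*} {U : ι → X.Opens}
    (cover : ∀ x : X, ∃ i, x ∈ U i) {m : ∀ i, Γ(M, U i)} (hm : ∀ i, IsFrame M (U i) (m i))
    (hp : ∀ i, IsFrame P (U i) (φ.app _ (m i))) : ∃ e : M ≅ P, e.hom = φ := by
  obtain ⟨e, he⟩ := exists_iso cover hm hp fun i j V hi hj a h => by
    rw [res_app, h, Scheme.Modules.Hom.app_smul, ← res_app]
  exact ⟨e, hom_ext_frames cover hm he⟩

end Semilinear

section LineBundles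

/-- A sheaf of modules is a line bundle if it is locally free of rank one: locally there is a
section `s` such that `a ↦ a • s` is an isomorphism `𝒪_U ≅ L|_U`. -/
def IsLineBundle (L : X.Modules) : Prop :=
  ∀ x : X, ∃ (U : X.Opens) (_ : x ∈ U) (s : Γ(L, U)), IsFrame L U s

/-- The local frames of a sheaf of modules. -/
structure Fr (L : X.Modules) where
  U : X.Opens
  s : Γ(L, U)
  hs : IsFrame L U s

lemma IsLineBundle.cover {L : X.Modules} (h : IsLineBundle L) (x : X) : ∃ i : Fr L, x ∈ i.U := by
  obtain ⟨U, hx, s, hs⟩ := h x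
  exact ⟨⟨U, s, hs⟩, hx⟩

lemma isLineBundle_of_cover {L : X.Modules} {ι : Type*} {U : ι → X.Opens}
    (cover : ∀ x : X, ∃ i, x ∈ U i) {m : ∀ i, Γ(L, U i)} (hm : ∀ i, IsFrame L (U i) (m i)) :
    IsLineBundle L := fun x => by
  obtain ⟨i, hi⟩ := cover x
  exact ⟨U i, hi, m i, hm i⟩

/-- Pairs of local frames on the same open set. -/
structure FrTwo (L L' : X.Modules) where
  U : X.Opens
  s : Γ(L, U)
  hs : IsFrame L U s
  t : Γ(L', U)
  ht : IsFrame L' U t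

lemma FrTwo.cover {L L' : X.Modules} (h : IsLineBundle L) (h' : IsLineBundle L') (x : X) :
    ∃ i : FrTwo L L', x ∈ i.U := by
  obtain ⟨U, hx, s, hs⟩ := h x
  obtain ⟨U', hx', s', hs'⟩ := h' x
  exact ⟨⟨U ⊓ U', res inf_le_left s, frame_res hs _, res inf_le_right s', frame_res hs' _⟩, hx, hx'⟩

/-- Triples of local frames on the same open set. -/
structure FrThree (L L' L'' : X.Modules) where
  U : X.Opens
  s : Γ(L, U)
  hs : IsFrame L U s
  t : Γ(L', U)
  ht : IsFrame L' U t
  r : Γ(L'', U)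
  hr : IsFrame L'' U r

lemma FrThree.cover {L L' L'' : X.Modules} (h : IsLineBundle L) (h' : IsLineBundle L')
    (h'' : IsLineBundle L'') (x : X) : ∃ i : FrThree L L' L'', x ∈ i.U := by
  obtain ⟨i, hi⟩ := FrTwo.cover h h' x
  obtain ⟨U', hx', s', hs'⟩ := h'' x
  exact ⟨⟨i.U ⊓ U', res inf_le_left i.s, frame_res i.hs _, res inf_le_left i.t, frame_res i.ht _,
    res inf_le_right s', frame_res hs' _⟩, hi, hx'⟩

lemma IsFrame.exists_smul {L : X.Modules} {U V : X.Opens} {s : Γ(L, U)} (hs : IsFrame L U s)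
    (h : V ≤ U) (t : Γ(L, V)) : ∃ a : Γ(X, V), t = a • res h s := by
  obtain ⟨a, ha⟩ := (hs V h).2 t
  exact ⟨a, ha.symm⟩

lemma IsFrame.smul_inj {L : X.Modules} {U V : X.Opens} {s : Γ(L, U)} (hs : IsFrame L U s)
    (h : V ≤ U) {a b : Γ(X, V)} (hab : a • res h s = b • res h s) : a = b := (hs V h).1 hab

lemma IsLineBundle.tensor {L L' : X.Modules} (h : IsLineBundle L) (h' : IsLineBundle L') :
    IsLineBundle (tensor L L') :=
  isLineBundle_of_cover (FrTwo.cover h h') fun i => i.hs.tmul i.ht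

lemma IsLineBundle.dual {L : X.Modules} (h : IsLineBundle L) : IsLineBundle (dual L) :=
  isLineBundle_of_cover h.cover fun i => isFrame_dsec i.hs

lemma IsLineBundle.pull (f : X ⟶ Y) {L : Y.Modules} (h : IsLineBundle L) : IsLineBundle (pull f L) :=
  isLineBundle_of_cover (ι := Fr L) (U := fun i => f ⁻¹ᵁ i.U) (fun x => h.cover (f x))
    fun i => i.hs.pullSec f

/-- The unit section of `𝒪_X`. -/
def oneSec (U : X.Opens) : Γ(unitM X, U) := (1 : Γ(X, U))

lemma res_oneSec {U V : X.Opens} (h : V ≤ U) : res h (oneSec U) = oneSec V := fres_one h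

lemma isFrame_oneSec (U : X.Opens) : IsFrame (unitM X) U (oneSec U) := by
  intro V h
  rw [res_oneSec]
  have : (fun a : Γ(X, V) => a • oneSec V) = fun a : Γ(X, V) => (show Γ(unitM X, V) from a) :=
    funext fun a => mul_one a
  rw [this]
  exact Function.bijective_id

lemma isLineBundle_unit : IsLineBundle (unitM X) := fun _ => ⟨⊤, trivial, _, isFrame_oneSec ⊤⟩

end LineBundles

section Compat
variable {L L' L'' M M' : X.Modules}

lemma compat_iso (e : L ≅ M) (e' : L' ≅ M') (i j : FrTwo L L') (V : X.Opens) (hi : V ≤ i.U)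
    (hj : V ≤ j.U) (a : Γ(X, V)) (h : res hj (tmul j.s j.t) = a • res hi (tmul i.s i.t)) :
    res hj (tmul (e.hom.app _ j.s) (e'.hom.app _ j.t)) =
      a • res hi (tmul (e.hom.app _ i.s) (e'.hom.app _ i.t)) := by
  obtain ⟨x, hx⟩ := i.hs.exists_smul hi (res hj j.s)
  obtain ⟨y, hy⟩ := i.ht.exists_smul hi (res hj j.t)
  rw [res_tmul, hx, hy, smul_tmul, ← res_tmul] at h
  rw [← (i.hs.tmul i.ht).smul_inj hi h, res_tmul, res_tmul, res_app, res_app, res_app, res_app, hx, hy,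
    Scheme.Modules.Hom.app_smul, Scheme.Modules.Hom.app_smul, smul_tmul]

lemma compat_comm (i j : FrTwo L L') (V : X.Opens) (hi : V ≤ i.U)
    (hj : V ≤ j.U) (a : Γ(X, V)) (h : res hj (tmul j.s j.t) = a • res hi (tmul i.s i.t)) :
    res hj (tmul j.t j.s) = a • res hi (tmul i.t i.s) := by
  obtain ⟨x, hx⟩ := i.hs.exists_smul hi (res hj j.s)
  obtain ⟨y, hy⟩ := i.ht.exists_smul hi (res hj j.t)
  rw [res_tmul, hx, hy, smul_tmul, ← res_tmul] at h
  rw [← (i.hs.tmul i.ht).smul_inj hi h, res_tmul, res_tmul, hx, hy, smul_tmul, mul_comm]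

lemma compat_assoc (i j : FrThree L L' L'') (V : X.Opens) (hi : V ≤ i.U)
    (hj : V ≤ j.U) (a : Γ(X, V))
    (h : res hj (tmul (tmul j.s j.t) j.r) = a • res hi (tmul (tmul i.s i.t) i.r)) :
    res hj (tmul j.s (tmul j.t j.r)) = a • res hi (tmul i.s (tmul i.t i.r)) := by
  obtain ⟨x, hx⟩ := i.hs.exists_smul hi (res hj j.s)
  obtain ⟨y, hy⟩ := i.ht.exists_smul hi (res hj j.t)
  obtain ⟨z, hz⟩ := i.hr.exists_smul hi (res hj j.r)
  rw [res_tmul, res_tmul, hx, hy, hz, smul_tmul, smul_tmul, ← res_tmul, ← res_tmul] at h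
  rw [← ((i.hs.tmul i.ht).tmul i.hr).smul_inj hi h, res_tmul, res_tmul, hx, hy, hz, smul_tmul, smul_tmul,
    ← res_tmul, ← res_tmul, mul_assoc]

lemma compat_one (i j : Fr L) (V : X.Opens) (hi : V ≤ i.U)
    (hj : V ≤ j.U) (a : Γ(X, V))
    (h : res hj (tmul (oneSec _) j.s) = a • res hi (tmul (oneSec _) i.s)) :
    res hj j.s = a • res hi i.s := by
  obtain ⟨x, hx⟩ := i.hs.exists_smul hi (res hj j.s)
  rw [res_tmul, res_oneSec, ← one_smul Γ(X, V) (oneSec V), hx, smul_tmul, ← res_oneSec hi,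
    ← res_tmul, one_mul] at h
  rw [← ((isFrame_oneSec _).tmul i.hs).smul_inj hi h, hx]

lemma dsec_eq {U : X.Opens} {s t : Γ(L, U)} (hs : IsFrame L U s) (ht : IsFrame L U t) (h : s = t) :
    dsec hs = dsec ht := by subst h; rfl

lemma compat_dual_aux (i j : Fr L) (V : X.Opens) (hi : V ≤ i.U)
    (hj : V ≤ j.U) (a : Γ(X, V)) (h : res hi i.s = a • res hj j.s) :
    res hj (dsec j.hs) = a • res hi (dsec i.hs) := by
  rw [res_dsec, res_dsec]
  exact smul_dsec _ _ a h

lemma compat_dual (i j : Fr L) (V : X.Opens) (hi : V ≤ i.U)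
    (hj : V ≤ j.U) (a : Γ(X, V)) (h : res hj (dsec j.hs) = a • res hi (dsec i.hs)) :
    res hi i.s = a • res hj j.s := by
  obtain ⟨x, hx⟩ := j.hs.exists_smul hj (res hi i.s)
  rw [compat_dual_aux i j V hi hj x hx] at h
  rwa [← (isFrame_dsec i.hs).smul_inj hi h]

lemma compat_inv (i j : Fr L) (V : X.Opens) (hi : V ≤ i.U)
    (hj : V ≤ j.U) (a : Γ(X, V))
    (h : res hj (tmul (dsec j.hs) j.s) = a • res hi (tmul (dsec i.hs) i.s)) :
    res hj (oneSec j.U) = a • res hi (oneSec i.U) := by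
  obtain ⟨x, hx⟩ := j.hs.exists_smul hj (res hi i.s)
  have h1 := compat_dual_aux i j V hi hj x hx
  have key : res hj (tmul (dsec j.hs) j.s) = res hi (tmul (dsec i.hs) i.s) := by
    rw [res_tmul, res_tmul, h1, hx]
    have e1 := smul_tmul x 1 (res hi (dsec i.hs)) (res hj j.s)
    have e2 := smul_tmul 1 x (res hi (dsec i.hs)) (res hj j.s)
    rw [one_smul] at e1 e2
    rw [e1, e2, mul_comm]
  rw [key] at h
  have ha : 1 = a := ((isFrame_dsec i.hs).tmul i.hs).smul_inj hi ((one_smul _ _).trans h)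
  rw [← ha, one_smul, res_oneSec, res_oneSec]
end Compat

section Linearizations

variable {G : Type u} [Group G]

/-- The automorphism of the scheme underlying a `G`-scheme given by `g`. -/
abbrev sg (X : Action Scheme.{u} G) (g : G) : X.V ⟶ X.V := X.ρ g

lemma sg_one (X : Action Scheme.{u} G) : sg X 1 = 𝟙 X.V := map_one X.ρ

lemma sg_mul (X : Action Scheme.{u} G) (g h : G) : sg X (g * h) = sg X h ≫ sg X g := map_mul X.ρ g h

/-- A `G`-linearization of a sheaf of modules `L` on a `G`-scheme: isomorphisms `φ_g : g^* L ≅ L`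
with `φ_1 = id` and `φ_{gh} = φ_h ∘ h^*(φ_g)`. Both identities are tested on the pulled back
sections `g^* s`, which generate `g^* L`; since `1^* L` and `L`, respectively `(gh)^* L` and
`h^* g^* L`, live over open sets that agree only propositionally, sections are compared after
restriction to an open set `V`. -/
structure Linearization (X : Action Scheme.{u} G) (L : X.V.Modules) where
  φ : ∀ g : G, pull (sg X g) L ≅ L
  φ_one : ∀ (U : X.V.Opens) (s : Γ(L, U)) (V : X.V.Opens) (h : V ≤ sg X 1 ⁻¹ᵁ U) (h' : V ≤ U),
    res h ((φ 1).hom.app _ (pullSec (sg X 1) s)) = res h' s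
  φ_mul : ∀ (g k : G) (U : X.V.Opens) (s : Γ(L, U)) (V : X.V.Opens) (h : V ≤ sg X (g * k) ⁻¹ᵁ U)
    (h' : V ≤ sg X k ⁻¹ᵁ (sg X g ⁻¹ᵁ U)),
    res h ((φ (g * k)).hom.app _ (pullSec (sg X (g * k)) s)) =
      res h' ((φ k).hom.app _ (pullSec (sg X k) ((φ g).hom.app _ (pullSec (sg X g) s))))

variable {X Y Z : Action Scheme.{u} G}

/-- The semilinear map `s ↦ φ_g (g^* s)`. -/
def Linearization.act {L : X.V.Modules} (Λ : Linearization X L) (g : G) {U : X.V.Opens} (s : Γ(L, U)) :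
    Γ(L, sg X g ⁻¹ᵁ U) := (Λ.φ g).hom.app _ (pullSec (sg X g) s)

section
variable {L : X.V.Modules} (Λ : Linearization X L) (g : G) {U V : X.V.Opens}

lemma act_smul (a : Γ(X.V, U)) (s : Γ(L, U)) : Λ.act g (a • s) = (sg X g).app U a • Λ.act g s := by
  rw [Linearization.act, pullSec_smul, Scheme.Modules.Hom.app_smul]; rfl

lemma act_res (h : V ≤ U) (s : Γ(L, U)) : Λ.act g (res h s) = res ((sg X g).preimage_mono h) (Λ.act g s) := by
  rw [Linearization.act, pullSec_res, ← res_app]; rfl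

lemma act_frame {s : Γ(L, U)} (hs : IsFrame L U s) : IsFrame L (sg X g ⁻¹ᵁ U) (Λ.act g s) :=
  (hs.pullSec (sg X g)).iso_app (Λ.φ g)

end

lemma exists_lin {L : X.V.Modules} {ι : Type*} {U : ι → X.V.Opens} (cover : ∀ x : X.V, ∃ i, x ∈ U i)
    {m : ∀ i, Γ(L, U i)} (hm : ∀ i, IsFrame L (U i) (m i)) (a : G → ι → ι)
    (hU : ∀ g i, sg X g ⁻¹ᵁ U i = U (a g i))
    (compat : ∀ (g : G) (i j : ι) (V : X.V.Opens) (hi : V ≤ U i) (hj : V ≤ U j) (c : Γ(X.V, V))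
      (hi' : sg X g ⁻¹ᵁ V ≤ U (a g i)) (hj' : sg X g ⁻¹ᵁ V ≤ U (a g j)),
      res hj (m j) = c • res hi (m i) →
      res hj' (m (a g j)) = (sg X g).app V c • res hi' (m (a g i)))
    (one : ∀ (i : ι) (V : X.V.Opens) (h : V ≤ U (a 1 i)) (h' : V ≤ U i),
      res h (m (a 1 i)) = res h' (m i))
    (mul : ∀ (g k : G) (i : ι) (V : X.V.Opens) (h : V ≤ U (a (g * k) i)) (h' : V ≤ U (a k (a g i))),
      res h (m (a (g * k) i)) = res h' (m (a k (a g i)))) :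
    ∃ Λ : Linearization X L, ∀ g i, Λ.act g (m i) = res (hU g i).le (m (a g i)) := by
  have hθ : ∀ g, ∃ θ : L ⟶ (Scheme.Modules.pushforward (sg X g)).obj L, ∀ i,
      papp θ (m i) = res (hU g i).le (m (a g i)) := fun g =>
    exists_push cover hm fun i j V hi hj c h => by
      rw [res_res, res_res]
      exact compat g i j V hi hj c _ _ h
  choose θ hθ using hθ
  choose ψ hψ using fun g => pull_exists_hom (θ g)
  have hcov : ∀ g, ∀ x : X.V, ∃ i, x ∈ sg X g ⁻¹ᵁ U i := fun g x => cover (sg X g x)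
  choose φ hφ using fun g => exists_iso_of_hom (ψ g) (hcov g) (fun i => (hm i).pullSec (sg X g))
    (fun i => by
      rw [hψ, hθ]
      exact frame_res (hm _) _)
  have hφ' : ∀ g (W : X.V.Opens) (s : Γ(L, W)), (φ g).hom.app _ (pullSec (sg X g) s) = papp (θ g) s :=
    fun g W s => by rw [hφ, hψ]
  refine ⟨⟨φ, fun W s V h h' => ?_, fun g k W s V h h' => ?_⟩, fun g i => by
    rw [Linearization.act, hφ', hθ]⟩
  · rw [hφ']
    refine push_ext_frames (sg_one X) (θ' := pid L) cover hm (fun i V h h' => ?_) s V h h'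
    rw [hθ, res_res]
    exact one i V _ _
  · rw [hφ', hφ', hφ']
    refine push_ext_frames (sg_mul X g k) (θ' := pcomp (θ g) (θ k)) cover hm (fun i V h h' => ?_) s V h h'
    have h'' : V ≤ sg X k ⁻¹ᵁ (sg X g ⁻¹ᵁ U i) := h'
    change _ = res (M := L) (U := sg X k ⁻¹ᵁ (sg X g ⁻¹ᵁ U i)) h'' (papp (θ k) (papp (θ g) (m i)))
    rw [hθ, hθ, papp_res, hθ, res_res, res_res, res_res]
    exact mul g k i V _ _

/-- A `G`-linearized line bundle. -/
structure GLineBundle (X : Action Scheme.{u} G) where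
  L : X.V.Modules
  isLineBundle : IsLineBundle L
  lin : Linearization X L

/-- An isomorphism `e` of `G`-linearized line bundles satisfies `e ∘ φ_g = φ'_g ∘ g^* e`. -/
def GLineBundle.Equiv (A B : GLineBundle X) : Prop :=
  ∃ e : A.L ≅ B.L, ∀ g : G, (A.lin.φ g).hom ≫ e.hom =
    (Scheme.Modules.pullback (sg X g)).map e.hom ≫ (B.lin.φ g).hom

lemma map_pullSec {X Y : Scheme.{u}} (f : X ⟶ Y) {L M : Y.Modules} (e : L ⟶ M) {U : Y.Opens} (s : Γ(L, U)) :
    ((Scheme.Modules.pullback f).map e).app _ (pullSec f s) = pullSec f (e.app U s) := by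
  have : e ≫ pullUnit f M =
      pullUnit f L ≫ (Scheme.Modules.pushforward f).map ((Scheme.Modules.pullback f).map e) :=
    (Scheme.Modules.pullbackPushforwardAdjunction f).unit.naturality e
  have h := congr(($this).app U s)
  rw [Scheme.Modules.Hom.comp_app, Scheme.Modules.Hom.comp_app, ConcreteCategory.comp_apply,
    ConcreteCategory.comp_apply] at h
  exact h.symm

lemma equiv_iff {A B : GLineBundle X} : A.Equiv B ↔
    ∃ e : A.L ≅ B.L, ∀ (g : G) (U : X.V.Opens) (s : Γ(A.L, U)),
      e.hom.app _ (A.lin.act g s) = B.lin.act g (e.hom.app U s) := by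
  refine exists_congr fun e => forall_congr' fun g => ⟨fun h U s => ?_, fun h => pull_hom_ext fun U s => ?_⟩
  · have := congr(($h).app _ (pullSec (sg X g) s))
    rw [Scheme.Modules.Hom.comp_app, Scheme.Modules.Hom.comp_app, ConcreteCategory.comp_apply,
      ConcreteCategory.comp_apply, map_pullSec] at this
    exact this
  · rw [Scheme.Modules.Hom.comp_app, Scheme.Modules.Hom.comp_app, ConcreteCategory.comp_apply,
      ConcreteCategory.comp_apply, map_pullSec]
    exact h U s

lemma equiv_of_frames {A B : GLineBundle X} {ι : Type*} {U : ι → X.V.Opens}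
    (cover : ∀ x : X.V, ∃ i, x ∈ U i)
    {m : ∀ i, Γ(A.L, U i)} (hm : ∀ i, IsFrame A.L (U i) (m i))
    {p : ∀ i, Γ(B.L, U i)} (hp : ∀ i, IsFrame B.L (U i) (p i))
    (compat : ∀ i j (V : X.V.Opens) (hi : V ≤ U i) (hj : V ≤ U j) (a : Γ(X.V, V)),
      res hj (m j) = a • res hi (m i) → res hj (p j) = a • res hi (p i))
    (a : G → ι → ι) (hU : ∀ g i, sg X g ⁻¹ᵁ U i ≤ U (a g i))
    (hA : ∀ g i, A.lin.act g (m i) = res (hU g i) (m (a g i)))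
    (hB : ∀ g i, B.lin.act g (p i) = res (hU g i) (p (a g i))) : A.Equiv B := by
  obtain ⟨e, he⟩ := exists_iso cover hm hp compat
  refine ⟨e, fun g => ?_⟩
  refine hom_ext_frames (U := fun i => sg X g ⁻¹ᵁ U i) (fun x => cover (sg X g x))
    (fun i => (hm i).pullSec (sg X g)) fun i => ?_
  rw [Scheme.Modules.Hom.comp_app, Scheme.Modules.Hom.comp_app, ConcreteCategory.comp_apply,
      ConcreteCategory.comp_apply, map_pullSec, he]
  change e.hom.app _ (A.lin.act g (m i)) = B.lin.act g (p i)
  rw [hA, hB, ← res_app, he]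

instance GLineBundle.setoid (X : Action Scheme.{u} G) : Setoid (GLineBundle X) where
  r := GLineBundle.Equiv
  iseqv :=
    { refl := fun A => equiv_iff.2 ⟨Iso.refl _, fun _ _ _ => rfl⟩
      symm := fun {A B} h => by
        obtain ⟨e, he⟩ := h
        refine ⟨e.symm, fun g => ?_⟩
        rw [Iso.symm_hom, ← cancel_epi ((Scheme.Modules.pullback (sg X g)).map e.hom), ← Category.assoc,
          ← he, Category.assoc, e.hom_inv_id, Category.comp_id, ← Category.assoc, ← Functor.map_comp,
          e.hom_inv_id, CategoryTheory.Functor.map_id, Category.id_comp]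
      trans := fun {A B C} h h' => by
        obtain ⟨e, he⟩ := equiv_iff.1 h
        obtain ⟨e', he'⟩ := equiv_iff.1 h'
        refine equiv_iff.2 ⟨e ≪≫ e', fun g U s => ?_⟩
        change e'.hom.app _ (e.hom.app _ (A.lin.act g s)) = C.lin.act g (e'.hom.app _ (e.hom.app _ s))
        rw [he, he'] }

end Linearizations

section Operations

variable {G : Type u} [Group G] {X Y Z : Action Scheme.{u} G}

lemma act_rel {L : X.V.Modules} (Λ : Linearization X L) (g : G) {U U' V : X.V.Opens} {s : Γ(L, U)}
    {s' : Γ(L, U')} {hi : V ≤ U} {hj : V ≤ U'} {x : Γ(X.V, V)} (h : res hj s' = x • res hi s) :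
    res ((sg X g).preimage_mono hj) (Λ.act g s') =
      (sg X g).app V x • res ((sg X g).preimage_mono hi) (Λ.act g s) := by
  rw [← act_res _ _ hj, h, act_smul, act_res]

/-- The action of `g` on local frames. -/
def FrTwo.act {L L' : X.V.Modules} (Λ : Linearization X L) (Λ' : Linearization X L') (g : G)
    (i : FrTwo L L') : FrTwo L L' :=
  ⟨sg X g ⁻¹ᵁ i.U, Λ.act g i.s, act_frame Λ g i.hs, Λ'.act g i.t, act_frame Λ' g i.ht⟩

/-- The action of `g` on local frames. -/
def FrThree.act {L L' L'' : X.V.Modules} (Λ : Linearization X L) (Λ' : Linearization X L')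
    (Λ'' : Linearization X L'') (g : G) (i : FrThree L L' L'') : FrThree L L' L'' :=
  ⟨sg X g ⁻¹ᵁ i.U, Λ.act g i.s, act_frame Λ g i.hs, Λ'.act g i.t, act_frame Λ' g i.ht,
    Λ''.act g i.r, act_frame Λ'' g i.hr⟩

/-- The action of `g` on local frames. -/
def Fr.act {L : X.V.Modules} (Λ : Linearization X L) (g : G) (i : Fr L) : Fr L :=
  ⟨sg X g ⁻¹ᵁ i.U, Λ.act g i.s, act_frame Λ g i.hs⟩

lemma act_one_res {L : X.V.Modules} (Λ : Linearization X L) {U V : X.V.Opens} (s : Γ(L, U))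
    (h : V ≤ sg X 1 ⁻¹ᵁ U) (h' : V ≤ U) : res h (Λ.act 1 s) = res h' s := Λ.φ_one U s V h h'

lemma act_mul_res {L : X.V.Modules} (Λ : Linearization X L) (g k : G) {U V : X.V.Opens} (s : Γ(L, U))
    (h : V ≤ sg X (g * k) ⁻¹ᵁ U) (h' : V ≤ sg X k ⁻¹ᵁ (sg X g ⁻¹ᵁ U)) :
    res h (Λ.act (g * k) s) = res h' (Λ.act k (Λ.act g s)) := Λ.φ_mul g k U s V h h'

lemma exists_lin_tensor {L L' : X.V.Modules} (hL : IsLineBundle L) (hL' : IsLineBundle L')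
    (Λ : Linearization X L) (Λ' : Linearization X L') :
    ∃ Λ'' : Linearization X (tensor L L'), ∀ g (i : FrTwo L L'),
      Λ''.act g (tmul i.s i.t) = tmul (Λ.act g i.s) (Λ'.act g i.t) := by
  obtain ⟨Λ'', h⟩ := exists_lin (FrTwo.cover hL hL') (m := fun i => tmul i.s i.t)
    (fun i => i.hs.tmul i.ht) (FrTwo.act Λ Λ') (fun _ _ => rfl)
    (fun g i j V hi hj c hi' hj' h => by
      obtain ⟨x, hx⟩ := i.hs.exists_smul hi (res hj j.s)
      obtain ⟨y, hy⟩ := i.ht.exists_smul hi (res hj j.t)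
      rw [res_tmul, hx, hy, smul_tmul, ← res_tmul] at h
      rw [← (i.hs.tmul i.ht).smul_inj hi h, res_tmul, res_tmul, map_mul, ← smul_tmul]
      exact congrArg₂ tmul (act_rel Λ g hx) (act_rel Λ' g hy))
    (fun i V h h' => by
      rw [res_tmul, res_tmul]
      exact congrArg₂ tmul (act_one_res Λ _ _ _) (act_one_res Λ' _ _ _))
    (fun g k i V h h' => by
      rw [res_tmul, res_tmul]
      exact congrArg₂ tmul (act_mul_res Λ _ _ _ _ _) (act_mul_res Λ' _ _ _ _ _))
  exact ⟨Λ'', fun g i => (h g i).trans (res_self _)⟩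

lemma exists_lin_dual {L : X.V.Modules} (hL : IsLineBundle L) (Λ : Linearization X L) :
    ∃ Λ' : Linearization X (dual L), ∀ g (i : Fr L),
      Λ'.act g (dsec i.hs) = dsec (act_frame Λ g i.hs) := by
  obtain ⟨Λ', h⟩ := exists_lin hL.cover (m := fun i => dsec i.hs)
    (fun i => isFrame_dsec i.hs) (Fr.act Λ) (fun _ _ => rfl)
    (fun g i j V hi hj c hi' hj' h =>
      compat_dual_aux (Fr.act Λ g i) (Fr.act Λ g j) _ _ _ _ (act_rel Λ g (compat_dual i j V hi hj c h)))
    (fun i V h h' => by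
      rw [res_dsec, res_dsec]
      exact dsec_eq _ _ (act_one_res Λ _ _ _))
    (fun g k i V h h' => by
      rw [res_dsec, res_dsec]
      exact dsec_eq _ _ (act_mul_res Λ _ _ _ _ _))
  exact ⟨Λ', fun g i => (h g i).trans (res_self _)⟩

lemma exists_lin_unit : ∃ Λ : Linearization X (unitM X.V), ∀ g (U : X.V.Opens),
      Λ.act g (oneSec U) = oneSec (sg X g ⁻¹ᵁ U) := by
  obtain ⟨Λ, h⟩ := exists_lin (X := X) (L := unitM X.V) (U := fun W : X.V.Opens => W) (fun _ => ⟨⊤, trivial⟩) (m := oneSec)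
    isFrame_oneSec (fun g U => sg X g ⁻¹ᵁ U) (fun _ _ => rfl)
    (fun g i j V hi hj c hi' hj' h => by
      have h1 : 1 = c := by
        rw [res_oneSec, res_oneSec] at h
        have := (isFrame_oneSec V).smul_inj (a := 1) (b := c) le_rfl
        rw [res_oneSec, one_smul] at this
        exact this h
      rw [← h1, map_one, one_smul, res_oneSec, res_oneSec])
    (fun i V h h' => by rw [res_oneSec, res_oneSec])
    (fun g k i V h h' => by rw [res_oneSec, res_oneSec])
  exact ⟨Λ, fun g i => (h g i).trans (res_self _)⟩

lemma push_cast {X Y : Scheme.{u}} {f f' : X ⟶ Y} (hf : f = f') {L : Y.Modules} {M : X.Modules}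
    (θ : L ⟶ (Scheme.Modules.pushforward f).obj M) :
    ∃ θ' : L ⟶ (Scheme.Modules.pushforward f').obj M, ∀ (U : Y.Opens) (s : Γ(L, U)) (V : X.Opens)
      (h : V ≤ f ⁻¹ᵁ U) (h' : V ≤ f' ⁻¹ᵁ U), res h (papp θ s) = res h' (papp θ' s) := by
  subst hf
  exact ⟨θ, fun _ _ _ _ _ => rfl⟩

/-- The semilinear map `s ↦ φ_g (g^* s)`, as a morphism `L ⟶ g_* L`. -/
def actHom {L : X.V.Modules} (Λ : Linearization X L) (g : G) :
    L ⟶ (Scheme.Modules.pushforward (sg X g)).obj L :=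
  pullUnit (sg X g) L ≫ (Scheme.Modules.pushforward (sg X g)).map (Λ.φ g).hom

lemma papp_actHom {L : X.V.Modules} (Λ : Linearization X L) (g : G) {U : X.V.Opens} (s : Γ(L, U)) :
    papp (actHom Λ g) s = Λ.act g s := by
  unfold papp actHom
  rw [Scheme.Modules.Hom.comp_app, ConcreteCategory.comp_apply]; rfl

lemma pullSec_congr {X Y : Scheme.{u}} (f : X ⟶ Y) {L : Y.Modules} {U U' : Y.Opens} {s : Γ(L, U)}
    {t : Γ(L, U')} (H : ∀ (W : Y.Opens) (h : W ≤ U) (h' : W ≤ U'), res h s = res h' t) (V : X.Opens)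
    (h : V ≤ f ⁻¹ᵁ U) (h' : V ≤ f ⁻¹ᵁ U') : res h (pullSec f s) = res h' (pullSec f t) := by
  have hV : V ≤ f ⁻¹ᵁ (U ⊓ U') := fun x hx => ⟨h hx, h' hx⟩
  have := congr(res hV (pullSec f $(H (U ⊓ U') inf_le_left inf_le_right)))
  rwa [pullSec_res, pullSec_res, res_res, res_res] at this

/-- The linearization of `f^* L` with `φ_g (g^* f^* s) = f^* (φ_g (g^* s))`. -/
lemma exists_lin_pull (f : X ⟶ Y) {L : Y.V.Modules} (hL : IsLineBundle L) (Λ : Linearization Y L) :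
    ∃ Λ' : Linearization X (pull f.hom L), ∀ g (i : Fr L),
      ∃ h : sg X g ⁻¹ᵁ (f.hom ⁻¹ᵁ i.U) ≤ f.hom ⁻¹ᵁ (sg Y g ⁻¹ᵁ i.U),
        Λ'.act g (pullSec f.hom i.s) = res h (pullSec f.hom (Λ.act g i.s)) := by
  have hU : ∀ g (U : Y.V.Opens), sg X g ⁻¹ᵁ (f.hom ⁻¹ᵁ U) = f.hom ⁻¹ᵁ (sg Y g ⁻¹ᵁ U) := fun g U =>
    congr($(f.comm g) ⁻¹ᵁ U)
  obtain ⟨Λ', h⟩ := exists_lin (X := X) (L := pull f.hom L) (U := fun i : Fr L => f.hom ⁻¹ᵁ i.U)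
    (fun x => hL.cover (f.hom x)) (m := fun i => pullSec f.hom i.s)
    (fun i => i.hs.pullSec f.hom) (Fr.act Λ) (fun g i => hU g i.U)
    (fun g i j V hi hj c hi' hj' h => by
      obtain ⟨θ, hθ⟩ := push_cast (f.comm g).symm (pcomp (actHom Λ g) (pullUnit f.hom L))
      have hθ' : ∀ (U : Y.V.Opens) (s : Γ(L, U)) (V : X.V.Opens)
          (h : V ≤ f.hom ⁻¹ᵁ (sg Y g ⁻¹ᵁ U)) (h' : V ≤ (sg X g ≫ f.hom) ⁻¹ᵁ U),
          res h (pullSec f.hom (Λ.act g s)) = res h' (papp θ s) := fun U s V h h' => by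
        refine Eq.trans ?_ (hθ U s V h h')
        rw [← papp_actHom]; rfl
      obtain ⟨φ, hφ⟩ := pull_exists_hom (f := f.hom) (L := L)
        (N := (Scheme.Modules.pushforward (sg X g)).obj (pull f.hom L)) θ
      have h1 := congr(papp (f := sg X g) φ $h)
      rw [papp_smul, papp_res, papp_res] at h1
      refine (hθ' _ _ _ _ ((sg X g).preimage_mono hj)).trans (Eq.trans ?_
        (congrArg _ (hθ' _ _ _ _ ((sg X g).preimage_mono hi)).symm))
      have hφ' : ∀ (U : Y.V.Opens) (s : Γ(L, U)), papp (f := sg X g) φ (pullSec f.hom s) =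
        (show Γ(pull f.hom L, sg X g ⁻¹ᵁ (f.hom ⁻¹ᵁ U)) from papp θ s) := hφ
      rw [hφ', hφ'] at h1
      exact h1)
    (fun i V h h' => pullSec_congr f.hom (fun W h h' => act_one_res Λ _ _ _) V h h')
    (fun g k i V h h' => pullSec_congr f.hom (fun W h h' => act_mul_res Λ _ _ _ _ _) V h h')
  exact ⟨Λ', fun g i => ⟨_, h g i⟩⟩

namespace GLineBundle

/-- The tensor product, with `φ_g (g^* (s ⊗ t)) = φ_g (g^* s) ⊗ φ_g (g^* t)`. -/
def tensor (A B : GLineBundle X) : GLineBundle X where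
  L := EquivariantPicard.tensor A.L B.L
  isLineBundle := A.isLineBundle.tensor B.isLineBundle
  lin := (exists_lin_tensor A.isLineBundle B.isLineBundle A.lin B.lin).choose

lemma tensor_act (A B : GLineBundle X) (g : G) (i : FrTwo A.L B.L) :
    (tensor A B).lin.act g (tmul i.s i.t) = tmul (A.lin.act g i.s) (B.lin.act g i.t) :=
  (exists_lin_tensor A.isLineBundle B.isLineBundle A.lin B.lin).choose_spec g i

/-- The structure sheaf, with `φ_g (g^* 1) = 1`. -/
def one (X : Action Scheme.{u} G) : GLineBundle X where
  L := unitM X.V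
  isLineBundle := isLineBundle_unit
  lin := exists_lin_unit.choose

lemma one_act (g : G) (U : X.V.Opens) : (one X).lin.act g (oneSec U) = oneSec (sg X g ⁻¹ᵁ U) :=
  (exists_lin_unit (X := X)).choose_spec g U

/-- The dual, with `φ_g (g^* s^∨) = (φ_g (g^* s))^∨` for local frames `s`. -/
def dual (A : GLineBundle X) : GLineBundle X where
  L := EquivariantPicard.dual A.L
  isLineBundle := A.isLineBundle.dual
  lin := (exists_lin_dual A.isLineBundle A.lin).choose

lemma dual_act (A : GLineBundle X) (g : G) (i : Fr A.L) :
    (dual A).lin.act g (dsec i.hs) = dsec (act_frame A.lin g i.hs) :=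
  (exists_lin_dual A.isLineBundle A.lin).choose_spec g i

/-- The pullback along a `G`-morphism, with `φ_g (g^* f^* s) = f^* (φ_g (g^* s))`. -/
def pull (f : X ⟶ Y) (A : GLineBundle Y) : GLineBundle X where
  L := EquivariantPicard.pull f.hom A.L
  isLineBundle := A.isLineBundle.pull f.hom
  lin := (exists_lin_pull f A.isLineBundle A.lin).choose

lemma sg_pre (f : X ⟶ Y) (g : G) (U : Y.V.Opens) :
    sg X g ⁻¹ᵁ (f.hom ⁻¹ᵁ U) ≤ f.hom ⁻¹ᵁ (sg Y g ⁻¹ᵁ U) := le_of_eq congr($(f.comm g) ⁻¹ᵁ U)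

lemma pull_act (f : X ⟶ Y) (A : GLineBundle Y) (g : G) (i : Fr A.L) :
    (pull f A).lin.act g (pullSec f.hom i.s) = res (sg_pre f g i.U) (pullSec f.hom (A.lin.act g i.s)) :=
  ((exists_lin_pull f A.isLineBundle A.lin).choose_spec g i).choose_spec

end GLineBundle

end Operations

section Pic

variable {G : Type u} [Group G] {X Y Z : Action Scheme.{u} G}

lemma compat_dual_iso {X : Scheme.{u}} {L M : X.Modules} (e : L ≅ M) (i j : Fr L) (V : X.Opens)
    (hi : V ≤ i.U) (hj : V ≤ j.U) (a : Γ(X, V)) (h : res hj (dsec j.hs) = a • res hi (dsec i.hs)) :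
    res hj (dsec (j.hs.iso_app e)) = a • res hi (dsec (i.hs.iso_app e)) := by
  refine compat_dual_aux ⟨i.U, _, i.hs.iso_app e⟩ ⟨j.U, _, j.hs.iso_app e⟩ V hi hj a ?_
  have := compat_dual i j V hi hj a h
  rw [res_app, res_app, this, Scheme.Modules.Hom.app_smul]

namespace GLineBundle

variable {A B C A' B' : GLineBundle X}

lemma tensor_congr (h : A.Equiv A') (h' : B.Equiv B') : (tensor A B).Equiv (tensor A' B') := by
  obtain ⟨e, he⟩ := equiv_iff.1 h
  obtain ⟨e', he'⟩ := equiv_iff.1 h'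
  refine equiv_of_frames (A := tensor A B) (B := tensor A' B')
    (FrTwo.cover A.isLineBundle B.isLineBundle) (m := fun i => tmul i.s i.t)
    (fun i => i.hs.tmul i.ht) (p := fun i => tmul (e.hom.app _ i.s) (e'.hom.app _ i.t))
    (fun i => (i.hs.iso_app e).tmul (i.ht.iso_app e')) (compat_iso e e') (FrTwo.act A.lin B.lin)
    (fun g i => le_rfl) (fun g i => ?_) fun g i => ?_
  · exact (tensor_act A B g i).trans (res_self _).symm
  · refine Eq.trans ?_ (res_self _).symm
    refine (tensor_act A' B' g ⟨i.U, _, i.hs.iso_app e, _, i.ht.iso_app e'⟩).trans ?_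
    exact congrArg₂ tmul (he g _ _).symm (he' g _ _).symm

lemma tensor_comm (A B : GLineBundle X) : (tensor A B).Equiv (tensor B A) := by
  refine equiv_of_frames (A := tensor A B) (B := tensor B A)
    (FrTwo.cover A.isLineBundle B.isLineBundle) (m := fun i => tmul i.s i.t)
    (fun i => i.hs.tmul i.ht) (p := fun i => tmul i.t i.s)
    (fun i => i.ht.tmul i.hs) compat_comm (FrTwo.act A.lin B.lin)
    (fun g i => le_rfl) (fun g i => ?_) fun g i => ?_
  · exact (tensor_act A B g i).trans (res_self _).symm
  · refine Eq.trans ?_ (res_self _).symm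
    exact tensor_act B A g ⟨i.U, _, i.ht, _, i.hs⟩

lemma tensor_assoc (A B C : GLineBundle X) :
    (tensor (tensor A B) C).Equiv (tensor A (tensor B C)) := by
  refine equiv_of_frames (A := tensor (tensor A B) C) (B := tensor A (tensor B C))
    (FrThree.cover A.isLineBundle B.isLineBundle C.isLineBundle) (m := fun i => tmul (tmul i.s i.t) i.r)
    (fun i => (i.hs.tmul i.ht).tmul i.hr) (p := fun i => tmul i.s (tmul i.t i.r))
    (fun i => i.hs.tmul (i.ht.tmul i.hr)) compat_assoc (FrThree.act A.lin B.lin C.lin)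
    (fun g i => le_rfl) (fun g i => ?_) fun g i => ?_
  · refine Eq.trans ?_ (res_self _).symm
    refine (tensor_act (tensor A B) C g ⟨i.U, _, i.hs.tmul i.ht, _, i.hr⟩).trans ?_
    exact congrArg₂ tmul (tensor_act A B g ⟨i.U, _, i.hs, _, i.ht⟩) rfl
  · refine Eq.trans ?_ (res_self _).symm
    refine (tensor_act A (tensor B C) g ⟨i.U, _, i.hs, _, i.ht.tmul i.hr⟩).trans ?_
    exact congrArg₂ tmul rfl (tensor_act B C g ⟨i.U, _, i.ht, _, i.hr⟩)

lemma one_tensor (A : GLineBundle X) : (tensor (one X) A).Equiv A := by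
  refine equiv_of_frames (A := tensor (one X) A) (B := A)
    A.isLineBundle.cover (m := fun i => tmul (oneSec i.U) i.s)
    (fun i => (isFrame_oneSec _).tmul i.hs) (p := fun i => i.s)
    (fun i => i.hs) compat_one (Fr.act A.lin)
    (fun g i => le_rfl) (fun g i => ?_) fun g i => ?_
  · refine Eq.trans ?_ (res_self _).symm
    refine (tensor_act (one X) A g ⟨i.U, _, isFrame_oneSec _, _, i.hs⟩).trans ?_
    exact congrArg₂ tmul (one_act g i.U) rfl
  · exact (res_self _).symm

lemma dual_congr (h : A.Equiv A') : (dual A).Equiv (dual A') := by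
  obtain ⟨e, he⟩ := equiv_iff.1 h
  refine equiv_of_frames (A := dual A) (B := dual A')
    A.isLineBundle.cover (m := fun i => dsec i.hs)
    (fun i => isFrame_dsec i.hs) (p := fun i => dsec (i.hs.iso_app e))
    (fun i => isFrame_dsec _) (compat_dual_iso e) (Fr.act A.lin)
    (fun g i => le_rfl) (fun g i => ?_) fun g i => ?_
  · exact (dual_act A g i).trans (res_self _).symm
  · refine Eq.trans ?_ (res_self _).symm
    exact (dual_act A' g ⟨i.U, _, i.hs.iso_app e⟩).trans (dsec_eq _ _ (he g _ _).symm)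

lemma dual_tensor (A : GLineBundle X) : (tensor (dual A) A).Equiv (one X) := by
  refine equiv_of_frames (A := tensor (dual A) A) (B := one X)
    A.isLineBundle.cover (m := fun i => tmul (dsec i.hs) i.s)
    (fun i => (isFrame_dsec _).tmul i.hs) (p := fun i => oneSec i.U)
    (fun i => isFrame_oneSec _) compat_inv (Fr.act A.lin)
    (fun g i => le_rfl) (fun g i => ?_) fun g i => ?_
  · refine Eq.trans ?_ (res_self _).symm
    refine (tensor_act (dual A) A g ⟨i.U, _, isFrame_dsec _, _, i.hs⟩).trans ?_
    exact congrArg₂ tmul (dual_act A g i) rfl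
  · exact (one_act g i.U).trans (res_self _).symm

end GLineBundle

/-- If `s'` is a multiple of `s` after pullback, the same holds for their images under any
semilinear map. -/
lemma compat_pull {X Y : Scheme.{u}} {f : X ⟶ Y} {L : Y.Modules} {M : X.Modules}
    (θ : L ⟶ (Scheme.Modules.pushforward f).obj M) (i j : Fr L) (V : X.Opens) (hi : V ≤ f ⁻¹ᵁ i.U)
    (hj : V ≤ f ⁻¹ᵁ j.U) (a : Γ(X, V)) (h : res hj (pullSec f j.s) = a • res hi (pullSec f i.s)) :
    res hj (papp θ j.s) = a • res hi (papp θ i.s) := by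
  obtain ⟨φ, hφ⟩ := pull_exists_hom θ
  rw [← hφ, ← hφ, res_app, h, Scheme.Modules.Hom.app_smul, ← res_app]

lemma exists_pull_tensor {X Y : Scheme.{u}} (f : X ⟶ Y) {L L' : Y.Modules} (hL : IsLineBundle L)
    (hL' : IsLineBundle L') : ∃ θ : tensor L L' ⟶ (Scheme.Modules.pushforward f).obj
      (tensor (pull f L) (pull f L')), ∀ i : FrTwo L L',
      papp θ (tmul i.s i.t) = tmul (pullSec f i.s) (pullSec f i.t) :=
  exists_push (FrTwo.cover hL hL') (fun i => i.hs.tmul i.ht) fun i j V hi hj a h => by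
    obtain ⟨x, hx⟩ := i.hs.exists_smul hi (res hj j.s)
    obtain ⟨y, hy⟩ := i.ht.exists_smul hi (res hj j.t)
    rw [res_tmul, hx, hy, smul_tmul, ← res_tmul] at h
    rw [← (i.hs.tmul i.ht).smul_inj hi h, res_tmul, res_tmul, ← pullSec_res f hj, ← pullSec_res f hj,
      hx, hy, pullSec_smul, pullSec_smul, smul_tmul, map_mul, pullSec_res, pullSec_res]

lemma compat_pull_tensor {X Y : Scheme.{u}} (f : X ⟶ Y) {L L' : Y.Modules} (hL : IsLineBundle L)
    (hL' : IsLineBundle L') (i j : FrTwo L L') (V : X.Opens) (hi : V ≤ f ⁻¹ᵁ i.U)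
    (hj : V ≤ f ⁻¹ᵁ j.U) (a : Γ(X, V))
    (h : res hj (pullSec f (tmul j.s j.t)) = a • res hi (pullSec f (tmul i.s i.t))) :
    res hj (tmul (pullSec f j.s) (pullSec f j.t)) = a • res hi (tmul (pullSec f i.s) (pullSec f i.t)) := by
  obtain ⟨θ, hθ⟩ := exists_pull_tensor f hL hL'
  have := compat_pull θ ⟨i.U, _, i.hs.tmul i.ht⟩ ⟨j.U, _, j.hs.tmul j.ht⟩ V hi hj a h
  rwa [hθ, hθ] at this

namespace GLineBundle

lemma pull_congr (f : X ⟶ Y) {A B : GLineBundle Y} (h : A.Equiv B) : (pull f A).Equiv (pull f B) := by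
  obtain ⟨e, he⟩ := equiv_iff.1 h
  refine equiv_of_frames (A := pull f A) (B := pull f B) (U := fun i : Fr A.L => f.hom ⁻¹ᵁ i.U)
    (fun x => A.isLineBundle.cover (f.hom x)) (m := fun i => pullSec f.hom i.s)
    (fun i => i.hs.pullSec f.hom) (p := fun i => pullSec f.hom (e.hom.app _ i.s))
    (fun i => (i.hs.iso_app e).pullSec f.hom) (fun i j V hi hj a h => ?_) (Fr.act A.lin)
    (fun g i => sg_pre f g i.U) (fun g i => pull_act f A g i) fun g i => ?_
  · have := compat_pull (e.hom ≫ pullUnit f.hom B.L) i j V hi hj a h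
    unfold papp at this
    rw [Scheme.Modules.Hom.comp_app, Scheme.Modules.Hom.comp_app, ConcreteCategory.comp_apply,
      ConcreteCategory.comp_apply] at this
    exact this
  · refine (pull_act f B g ⟨i.U, _, i.hs.iso_app e⟩).trans ?_
    exact congrArg (res _) (congrArg (pullSec f.hom) (he g _ _).symm)

lemma pull_id (A : GLineBundle X) : (pull (𝟙 X) A).Equiv A := by
  refine equiv_of_frames (A := pull (𝟙 X) A) (B := A) (U := fun i : Fr A.L => i.U)
    A.isLineBundle.cover (m := fun i => pullSec (𝟙 X.V) i.s)
    (fun i => i.hs.pullSec (𝟙 X.V)) (p := fun i => i.s)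
    (fun i => i.hs) (fun i j V hi hj a h => ?_) (Fr.act A.lin)
    (fun g i => le_rfl) (fun g i => pull_act (𝟙 X) A g i) fun g i => ?_
  · exact compat_pull (pid A.L) i j V hi hj a h
  · exact (res_self _).symm

lemma pull_comp (f : X ⟶ Y) (f' : Y ⟶ Z) (A : GLineBundle Z) :
    (pull (f ≫ f') A).Equiv (pull f (pull f' A)) := by
  refine equiv_of_frames (A := pull (f ≫ f') A) (B := pull f (pull f' A))
    (U := fun i : Fr A.L => f.hom ⁻¹ᵁ (f'.hom ⁻¹ᵁ i.U))
    (fun x => A.isLineBundle.cover (f'.hom (f.hom x))) (m := fun i => pullSec (f.hom ≫ f'.hom) i.s)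
    (fun i => i.hs.pullSec (f.hom ≫ f'.hom)) (p := fun i => pullSec f.hom (pullSec f'.hom i.s))
    (fun i => (i.hs.pullSec f'.hom).pullSec f.hom) (fun i j V hi hj a h => ?_) (Fr.act A.lin)
    (fun g i => sg_pre (f ≫ f') g i.U) (fun g i => pull_act (f ≫ f') A g i) fun g i => ?_
  · exact compat_pull (pcomp (pullUnit f'.hom A.L) (pullUnit f.hom _)) i j V hi hj a h
  · refine (pull_act f (pull f' A) g ⟨_, _, i.hs.pullSec f'.hom⟩).trans ?_
    refine (congrArg (res _) (congrArg (pullSec f.hom) (pull_act f' A g i))).trans ?_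
    refine (congrArg (res _) (pullSec_res f.hom _ _)).trans ?_
    exact res_res _ _ _

lemma pull_tensor (f : X ⟶ Y) (A B : GLineBundle Y) :
    (pull f (tensor A B)).Equiv (tensor (pull f A) (pull f B)) := by
  refine equiv_of_frames (A := pull f (tensor A B)) (B := tensor (pull f A) (pull f B))
    (U := fun i : FrTwo A.L B.L => f.hom ⁻¹ᵁ i.U)
    (fun x => FrTwo.cover A.isLineBundle B.isLineBundle (f.hom x))
    (m := fun i => pullSec f.hom (tmul i.s i.t))
    (fun i => (i.hs.tmul i.ht).pullSec f.hom) (p := fun i => tmul (pullSec f.hom i.s) (pullSec f.hom i.t))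
    (fun i => (i.hs.pullSec f.hom).tmul (i.ht.pullSec f.hom))
    (compat_pull_tensor f.hom A.isLineBundle B.isLineBundle) (FrTwo.act A.lin B.lin)
    (fun g i => sg_pre f g i.U) (fun g i => ?_) fun g i => ?_
  · refine (pull_act f (tensor A B) g ⟨i.U, _, i.hs.tmul i.ht⟩).trans ?_
    exact congrArg (res _) (congrArg (pullSec f.hom) (tensor_act A B g i))
  · refine (tensor_act (pull f A) (pull f B) g
      ⟨_, _, i.hs.pullSec f.hom, _, i.ht.pullSec f.hom⟩).trans ?_
    refine Eq.trans ?_ (res_tmul _ _ _).symm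
    exact congrArg₂ tmul (pull_act f A g ⟨_, _, i.hs⟩) (pull_act f B g ⟨_, _, i.ht⟩)

end GLineBundle

/-- The equivariant Picard group: isomorphism classes of `G`-linearized line bundles. -/
def PicG (X : Action Scheme.{u} G) : Type (u + 1) := Quotient (GLineBundle.setoid X)

instance (X : Action Scheme.{u} G) : CommGroup (PicG X) where
  mul := Quotient.map₂ GLineBundle.tensor fun _ _ h _ _ h' => GLineBundle.tensor_congr h h'
  mul_assoc a b c := by
    induction a, b, c using Quotient.inductionOn₃
    exact Quotient.sound (GLineBundle.tensor_assoc _ _ _)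
  one := ⟦GLineBundle.one X⟧
  one_mul a := by
    induction a using Quotient.inductionOn
    exact Quotient.sound (GLineBundle.one_tensor _)
  mul_one a := by
    induction a using Quotient.inductionOn
    exact Quotient.sound (((GLineBundle.setoid X).trans (GLineBundle.tensor_comm _ _))
      (GLineBundle.one_tensor _))
  inv := Quotient.map GLineBundle.dual fun _ _ => GLineBundle.dual_congr
  inv_mul_cancel a := by
    induction a using Quotient.inductionOn
    exact Quotient.sound (GLineBundle.dual_tensor _)
  mul_comm a b := by
    induction a, b using Quotient.inductionOn₂
    exact Quotient.sound (GLineBundle.tensor_comm _ _)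

/-- Pullback `Pic^G(Y) → Pic^G(X)`. -/
def PicG.pull (f : X ⟶ Y) : PicG Y →* PicG X :=
  MonoidHom.mk' (Quotient.map (GLineBundle.pull f) fun _ _ => GLineBundle.pull_congr f) fun a b => by
    induction a, b using Quotient.inductionOn₂
    exact Quotient.sound (GLineBundle.pull_tensor f _ _)

lemma PicG.pull_id (X : Action Scheme.{u} G) : PicG.pull (𝟙 X) = MonoidHom.id _ := by
  ext a
  induction a using Quotient.inductionOn
  exact Quotient.sound (GLineBundle.pull_id _)

lemma PicG.pull_comp (f : X ⟶ Y) (g : Y ⟶ Z) : PicG.pull (f ≫ g) = (PicG.pull f).comp (PicG.pull g) := by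
  ext a
  induction a using Quotient.inductionOn
  exact Quotient.sound (GLineBundle.pull_comp _ _ _)

variable (G) in
/-- The functor `Pic^G` on `G`-schemes. -/
def picGFunctor : (Action Scheme.{u} G)ᵒᵖ ⥤ AddCommGrpCat.{u + 1} where
  obj X := .of (Additive (PicG X.unop))
  map f := AddCommGrpCat.ofHom (PicG.pull f.unop).toAdditive
  map_id X := congrArg (fun φ => AddCommGrpCat.ofHom (MonoidHom.toAdditive φ)) (PicG.pull_id X.unop)
  map_comp f g := congrArg (fun φ => AddCommGrpCat.ofHom (MonoidHom.toAdditive φ))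
    (PicG.pull_comp g.unop f.unop)

end Pic

section PicPlain

/-- A line bundle on a scheme. -/
structure LineBundle (X : Scheme.{u}) where
  L : X.Modules
  isLineBundle : IsLineBundle L

instance LineBundle.setoid (X : Scheme.{u}) : Setoid (LineBundle X) where
  r A B := Nonempty (A.L ≅ B.L)
  iseqv :=
    { refl := fun A => ⟨Iso.refl _⟩
      symm := fun ⟨e⟩ => ⟨e.symm⟩
      trans := fun ⟨e⟩ ⟨e'⟩ => ⟨e ≪≫ e'⟩ }

/-- The Picard group: isomorphism classes of line bundles. -/
def Pic (X : Scheme.{u}) : Type (u + 1) := Quotient (LineBundle.setoid X)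

namespace LineBundle

variable {A B C A' B' : LineBundle X} {Z : Scheme.{u}}

/-- The tensor product. -/
def tensor (A B : LineBundle X) : LineBundle X :=
  ⟨EquivariantPicard.tensor A.L B.L, A.isLineBundle.tensor B.isLineBundle⟩

/-- The dual. -/
def dual (A : LineBundle X) : LineBundle X := ⟨EquivariantPicard.dual A.L, A.isLineBundle.dual⟩

/-- The pullback. -/
def pull (f : X ⟶ Y) (A : LineBundle Y) : LineBundle X :=
  ⟨EquivariantPicard.pull f A.L, A.isLineBundle.pull f⟩

lemma tensor_congr (h : A ≈ A') (h' : B ≈ B') : tensor A B ≈ tensor A' B' := by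
  obtain ⟨e⟩ := h
  obtain ⟨e'⟩ := h'
  exact (exists_iso (FrTwo.cover A.isLineBundle B.isLineBundle) (m := fun i => tmul i.s i.t)
    (fun i => i.hs.tmul i.ht) (p := fun i => tmul (e.hom.app _ i.s) (e'.hom.app _ i.t))
    (fun i => (i.hs.iso_app e).tmul (i.ht.iso_app e')) (compat_iso e e')).nonempty

lemma tensor_comm (A B : LineBundle X) : tensor A B ≈ tensor B A :=
  (exists_iso (FrTwo.cover A.isLineBundle B.isLineBundle) (m := fun i => tmul i.s i.t)
    (fun i => i.hs.tmul i.ht) (p := fun i => tmul i.t i.s)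
    (fun i => i.ht.tmul i.hs) compat_comm).nonempty

lemma tensor_assoc (A B C : LineBundle X) : tensor (tensor A B) C ≈ tensor A (tensor B C) :=
  (exists_iso (FrThree.cover A.isLineBundle B.isLineBundle C.isLineBundle)
    (m := fun i => tmul (tmul i.s i.t) i.r)
    (fun i => (i.hs.tmul i.ht).tmul i.hr) (p := fun i => tmul i.s (tmul i.t i.r))
    (fun i => i.hs.tmul (i.ht.tmul i.hr)) compat_assoc).nonempty

lemma one_tensor (A : LineBundle X) : tensor ⟨unitM X, isLineBundle_unit⟩ A ≈ A :=
  (exists_iso A.isLineBundle.cover (m := fun i => tmul (oneSec i.U) i.s)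
    (fun i => (isFrame_oneSec _).tmul i.hs) (p := fun i => i.s)
    (fun i => i.hs) compat_one).nonempty

lemma dual_congr (h : A ≈ A') : dual A ≈ dual A' := by
  obtain ⟨e⟩ := h
  exact (exists_iso A.isLineBundle.cover (m := fun i => dsec i.hs)
    (fun i => isFrame_dsec i.hs) (p := fun i => dsec (i.hs.iso_app e))
    (fun i => isFrame_dsec _) (compat_dual_iso e)).nonempty

lemma dual_tensor (A : LineBundle X) : tensor (dual A) A ≈ ⟨unitM X, isLineBundle_unit⟩ :=
  (exists_iso A.isLineBundle.cover (m := fun i => tmul (dsec i.hs) i.s)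
    (fun i => (isFrame_dsec _).tmul i.hs) (p := fun i => oneSec i.U)
    (fun i => isFrame_oneSec _) compat_inv).nonempty

lemma pull_congr (f : X ⟶ Y) {A B : LineBundle Y} (h : A ≈ B) : pull f A ≈ pull f B := by
  obtain ⟨e⟩ := h
  exact ⟨(Scheme.Modules.pullback f).mapIso e⟩

lemma pull_id (A : LineBundle X) : pull (𝟙 X) A ≈ A :=
  ⟨(Scheme.Modules.pullbackId X).app A.L⟩

lemma pull_comp (f : X ⟶ Y) (f' : Y ⟶ Z) (A : LineBundle Z) : pull (f ≫ f') A ≈ pull f (pull f' A) :=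
  ⟨((Scheme.Modules.pullbackComp f f').app A.L).symm⟩

lemma pull_tensor (f : X ⟶ Y) (A B : LineBundle Y) :
    pull f (tensor A B) ≈ tensor (pull f A) (pull f B) :=
  (exists_iso (U := fun i : FrTwo A.L B.L => f ⁻¹ᵁ i.U)
    (fun x => FrTwo.cover A.isLineBundle B.isLineBundle (f x))
    (m := fun i => pullSec f (tmul i.s i.t))
    (fun i => (i.hs.tmul i.ht).pullSec f) (p := fun i => tmul (pullSec f i.s) (pullSec f i.t))
    (fun i => (i.hs.pullSec f).tmul (i.ht.pullSec f))
    (compat_pull_tensor f A.isLineBundle B.isLineBundle)).nonempty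

end LineBundle

instance (X : Scheme.{u}) : CommGroup (Pic X) where
  mul := Quotient.map₂ LineBundle.tensor fun _ _ h _ _ h' => LineBundle.tensor_congr h h'
  mul_assoc a b c := by
    induction a, b, c using Quotient.inductionOn₃
    exact Quotient.sound (LineBundle.tensor_assoc _ _ _)
  one := ⟦⟨unitM X, isLineBundle_unit⟩⟧
  one_mul a := by
    induction a using Quotient.inductionOn
    exact Quotient.sound (LineBundle.one_tensor _)
  mul_one a := by
    induction a using Quotient.inductionOn
    exact Quotient.sound (((LineBundle.setoid X).trans (LineBundle.tensor_comm _ _))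
      (LineBundle.one_tensor _))
  inv := Quotient.map LineBundle.dual fun _ _ => LineBundle.dual_congr
  inv_mul_cancel a := by
    induction a using Quotient.inductionOn
    exact Quotient.sound (LineBundle.dual_tensor _)
  mul_comm a b := by
    induction a, b using Quotient.inductionOn₂
    exact Quotient.sound (LineBundle.tensor_comm _ _)

/-- Pullback `Pic(Y) → Pic(X)`. -/
def Pic.pull (f : X ⟶ Y) : Pic Y →* Pic X :=
  MonoidHom.mk' (Quotient.map (LineBundle.pull f) fun _ _ => LineBundle.pull_congr f) fun a b => by
    induction a, b using Quotient.inductionOn₂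
    exact Quotient.sound (LineBundle.pull_tensor f _ _)

lemma Pic.pull_id (X : Scheme.{u}) : Pic.pull (𝟙 X) = MonoidHom.id _ := by
  ext a
  induction a using Quotient.inductionOn
  exact Quotient.sound (LineBundle.pull_id _)

lemma Pic.pull_comp {Z : Scheme.{u}} (f : X ⟶ Y) (g : Y ⟶ Z) : Pic.pull (f ≫ g) = (Pic.pull f).comp (Pic.pull g) := by
  ext a
  induction a using Quotient.inductionOn
  exact Quotient.sound (LineBundle.pull_comp _ _ _)

/-- The functor `Pic` on schemes. -/
def picFunctor : Scheme.{u}ᵒᵖ ⥤ AddCommGrpCat.{u + 1} where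
  obj X := .of (Additive (Pic X.unop))
  map f := AddCommGrpCat.ofHom (Pic.pull f.unop).toAdditive
  map_id X := congrArg (fun φ => AddCommGrpCat.ofHom (MonoidHom.toAdditive φ)) (Pic.pull_id X.unop)
  map_comp f g := congrArg (fun φ => AddCommGrpCat.ofHom (MonoidHom.toAdditive φ))
    (Pic.pull_comp g.unop f.unop)

variable (G : Type u) [Group G]

/-- The homomorphism `Pic^G(X) → Pic(X)` that forgets the linearization. -/
def forgetLin {G : Type u} [Group G] (X : Action Scheme.{u} G) : PicG X →* Pic X.V :=
  MonoidHom.mk' (Quotient.map (fun A => ⟨A.L, A.isLineBundle⟩) fun _ _ ⟨e, _⟩ => ⟨e⟩) fun a b => by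
    induction a, b using Quotient.inductionOn₂
    rfl

/-- The forgetful natural transformation `η : Pic^G ⟶ Pic`. -/
def forgetEta : picGFunctor G ⟶ (Action.forget Scheme.{u} G).op ⋙ picFunctor where
  app X := AddCommGrpCat.ofHom (forgetLin X.unop).toAdditive
  naturality X Y f := by
    ext a
    induction a using Quotient.inductionOn
    rfl

end PicPlain

section Schemes

variable (k : Type u) [Field k]

/-- The `k`-schemes that are separated and of finite type over `k`. -/
def schProp : ObjectProperty (Over (Spec (.of k))) := fun X =>
  IsSeparated X.hom ∧ LocallyOfFiniteType X.hom ∧ QuasiCompact X.hom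

/-- The category of separated schemes of finite type over `k`. -/
abbrev Sch := (schProp k).FullSubcategory

/-- The underlying scheme. -/
abbrev Sch.toScheme : Sch k ⥤ Scheme.{u} := (schProp k).ι ⋙ CategoryTheory.Over.forget _

variable (G : Type u) [Group G]

/-- The category of separated `k`-schemes of finite type with a left action of `G`, and `G`-morphisms. -/
abbrev GSch := Action (Sch k) G

variable {k}

section BaseChange

variable (R S : Type u) [CommRing R] [CommRing S] [Algebra k R] [Algebra k S]

/-- The structure morphism of `Spec R`. -/
abbrev specMap : Spec (.of R) ⟶ Spec (.of k) := Spec.map (CommRingCat.ofHom (algebraMap k R))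

/-- `X ×_k Spec R`, as a scheme over `k`. -/
abbrev prodSpecObj (X : Over (Spec (.of k))) : Over (Spec (.of k)) :=
  CategoryTheory.Over.mk (pullback.fst X.hom (specMap (k := k) R) ≫ X.hom)

lemma prodSpec_prop [Algebra.FiniteType k R] (X : Sch k) : schProp k (prodSpecObj R X.obj) := by
  obtain ⟨h1, h2, h3⟩ := X.property
  have h4 : LocallyOfFiniteType (specMap (k := k) R) := by
    rw [HasRingHomProperty.Spec_iff (P := @LocallyOfFiniteType)]
    exact RingHom.finiteType_algebraMap.2 inferInstance
  exact ⟨inferInstanceAs (IsSeparated (pullback.fst X.obj.hom (specMap (k := k) R) ≫ X.obj.hom)),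
    inferInstanceAs (LocallyOfFiniteType (pullback.fst X.obj.hom (specMap (k := k) R) ≫ X.obj.hom)),
    inferInstanceAs (QuasiCompact (pullback.fst X.obj.hom (specMap (k := k) R) ≫ X.obj.hom))⟩

variable {R S}

/-- The morphism `f × Spec(φ) : A ×_k Spec S ⟶ B ×_k Spec R`. -/
def prodOverMap {A B : Over (Spec (.of k))} (f : A ⟶ B) (φ : R →ₐ[k] S) :
    prodSpecObj S A ⟶ prodSpecObj R B :=
  CategoryTheory.Over.homMk (pullback.lift (pullback.fst A.hom (specMap (k := k) S) ≫ f.left)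
    (pullback.snd A.hom (specMap (k := k) S) ≫ Spec.map (CommRingCat.ofHom φ.toRingHom)) (by
      rw [Category.assoc, CategoryTheory.Over.w, pullback.condition, Category.assoc, ← Spec.map_comp,
        ← CommRingCat.ofHom_comp]
      exact congrArg (fun q => pullback.snd A.hom (specMap (k := k) S) ≫ Spec.map (CommRingCat.ofHom q))
        φ.comp_algebraMap.symm))
    (by
      change pullback.lift _ _ _ ≫ pullback.fst _ _ ≫ B.hom = pullback.fst _ _ ≫ A.hom
      rw [pullback.lift_fst_assoc, Category.assoc, CategoryTheory.Over.w])

lemma prodOverMap_fst {A B : Over (Spec (.of k))} (f : A ⟶ B) (φ : R →ₐ[k] S) :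
    (prodOverMap f φ).left ≫ pullback.fst B.hom (specMap (k := k) R) =
      pullback.fst A.hom (specMap (k := k) S) ≫ f.left := pullback.lift_fst _ _ _

lemma prodOverMap_snd {A B : Over (Spec (.of k))} (f : A ⟶ B) (φ : R →ₐ[k] S) :
    (prodOverMap f φ).left ≫ pullback.snd B.hom (specMap (k := k) R) =
      pullback.snd A.hom (specMap (k := k) S) ≫ Spec.map (CommRingCat.ofHom φ.toRingHom) :=
  pullback.lift_snd _ _ _

lemma prodOverMap_comp {Q : Type u} [CommRing Q] [Algebra k Q] {A B C : Over (Spec (.of k))} (f : A ⟶ B)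
    (g : B ⟶ C) (φ : R →ₐ[k] S) (ψ : Q →ₐ[k] R) :
    prodOverMap f φ ≫ prodOverMap g ψ = prodOverMap (f ≫ g) (φ.comp ψ) := by
  refine CategoryTheory.Over.OverMorphism.ext (pullback.hom_ext ?_ ?_)
  · rw [prodOverMap_fst, CategoryTheory.Over.comp_left, Category.assoc, prodOverMap_fst,
      reassoc_of% (prodOverMap_fst f φ), CategoryTheory.Over.comp_left]
  · rw [prodOverMap_snd, CategoryTheory.Over.comp_left, Category.assoc, prodOverMap_snd,
      reassoc_of% (prodOverMap_snd f φ), ← Spec.map_comp, ← CommRingCat.ofHom_comp]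
    rfl

lemma prodOverMap_id (A : Over (Spec (.of k))) :
    prodOverMap (𝟙 A) (AlgHom.id k R) = 𝟙 (prodSpecObj R A) := by
  refine CategoryTheory.Over.OverMorphism.ext (pullback.hom_ext ?_ ?_)
  · rw [prodOverMap_fst]
    simp
  · rw [prodOverMap_snd]
    change _ ≫ Spec.map (𝟙 _) = 𝟙 _ ≫ _
    rw [Spec.map_id, Category.comp_id, Category.id_comp]

variable (R) in
/-- The functor `X ↦ X ×_k Spec R`. -/
def prodSpec [Algebra.FiniteType k R] : Sch k ⥤ Sch k where
  obj X := ⟨prodSpecObj R X.obj, prodSpec_prop R X⟩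
  map f := ObjectProperty.homMk (prodOverMap f.hom (AlgHom.id k R))
  map_id X := by
    ext1
    exact prodOverMap_id X.obj
  map_comp f g := by
    ext1
    exact (prodOverMap_comp f.hom g.hom (AlgHom.id k R) (AlgHom.id k R)).symm

variable (R) in
/-- The projection `X ×_k Spec R ⟶ X`. -/
def prodFst [Algebra.FiniteType k R] : prodSpec (k := k) R ⟶ 𝟭 (Sch k) where
  app X := ObjectProperty.homMk (CategoryTheory.Over.homMk (pullback.fst X.obj.hom (specMap (k := k) R)))
  naturality X Y f := by
    ext1
    exact CategoryTheory.Over.OverMorphism.ext (prodOverMap_fst f.hom (AlgHom.id k R))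

/-- The morphism `X ×_k Spec S ⟶ X ×_k Spec R` induced by `R →ₐ[k] S`. -/
def prodMap [Algebra.FiniteType k R] [Algebra.FiniteType k S] (φ : R →ₐ[k] S) :
    prodSpec (k := k) S ⟶ prodSpec (k := k) R where
  app X := ObjectProperty.homMk (prodOverMap (𝟙 X.obj) φ)
  naturality X Y f := by
    ext1
    refine (prodOverMap_comp f.hom (𝟙 Y.obj) (AlgHom.id k S) φ).trans ?_
    refine Eq.trans ?_ (prodOverMap_comp (𝟙 X.obj) f.hom φ (AlgHom.id k R)).symm
    rw [Category.comp_id, Category.id_comp, AlgHom.comp_id, AlgHom.id_comp]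

end BaseChange

variable (k)

open scoped LaurentPolynomial Polynomial

/-- `X ↦ X[t] = X ×_k Spec k[t]`, the group acting trivially on `t`. The same functor is used for
`X[t⁻¹]`, with the coordinate now called `t⁻¹`. -/
abbrev affLine : GSch k G ⥤ GSch k G := (prodSpec k[X]).mapAction G

/-- `X ↦ X[t, t⁻¹] = X ×_k Spec k[t, t⁻¹]`, the group acting trivially on `t`. -/
abbrev puncLine : GSch k G ⥤ GSch k G := (prodSpec k[T;T⁻¹]).mapAction G

/-- The projection `X[t] ⟶ X`. -/
def affProj : affLine k G ⟶ 𝟭 (GSch k G) where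
  app X := ⟨(prodFst k[X]).app X.V, fun g => (prodFst k[X]).naturality (X.ρ g)⟩
  naturality X Y f := Action.Hom.ext ((prodFst k[X]).naturality f.hom)

/-- The morphism `X[t, t⁻¹] ⟶ X[t]`, where the coordinate of the target is sent to `t ^ n`; `n = 1`
gives `X[t, t⁻¹] ⟶ X[t]` and `n = -1` gives `X[t, t⁻¹] ⟶ X[t⁻¹]`. -/
def puncMap (n : ℤ) : puncLine k G ⟶ affLine k G where
  app X := ⟨(prodMap (Polynomial.aeval (R := k) (LaurentPolynomial.T n : k[T;T⁻¹]))).app X.V,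
    fun g => (prodMap (Polynomial.aeval (R := k) (LaurentPolynomial.T n : k[T;T⁻¹]))).naturality (X.ρ g)⟩
  naturality X Y f := Action.Hom.ext
    ((prodMap (Polynomial.aeval (R := k) (LaurentPolynomial.T n : k[T;T⁻¹]))).naturality f.hom)

end Schemes

section Contraction

variable {k : Type u} [Field k] {G : Type u} [Group G] (F : (GSch k G)ᵒᵖ ⥤ AddCommGrpCat.{u + 1})
  (X : GSch k G)

/-- The map `F(X) → F(X[t]) × F(X[t⁻¹])`, `x ↦ (x, -x)`. -/
def plusMinus : F.obj (op X) →+ F.obj (op ((affLine k G).obj X)) × F.obj (op ((affLine k G).obj X)) :=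
  AddMonoidHom.prod (F.map ((affProj k G).app X).op).hom (-(F.map ((affProj k G).app X).op).hom)

/-- The map `F(X[t]) × F(X[t⁻¹]) → F(X[t, t⁻¹])`, `(a, b) ↦ a + b`. -/
def addMap : F.obj (op ((affLine k G).obj X)) × F.obj (op ((affLine k G).obj X)) →+
    F.obj (op ((puncLine k G).obj X)) :=
  AddMonoidHom.coprod (F.map ((puncMap k G 1).app X).op).hom (F.map ((puncMap k G (-1)).app X).op).hom

lemma addMap_natural {X Y : GSch k G} (f : X ⟶ Y) :
    (addMap F Y).range ≤ (addMap F X).range.comap (F.map ((puncLine k G).map f).op).hom := by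
  rintro _ ⟨⟨a, b⟩, rfl⟩
  have h : ∀ n a, F.map ((puncLine k G).map f).op (F.map ((puncMap k G n).app Y).op a) =
      F.map ((puncMap k G n).app X).op (F.map ((affLine k G).map f).op a) := by
    intro n a
    rw [← ConcreteCategory.comp_apply, ← ConcreteCategory.comp_apply, ← F.map_comp, ← F.map_comp,
      ← op_comp, ← op_comp, (puncMap k G n).naturality]
  refine ⟨⟨F.map ((affLine k G).map f).op a, F.map ((affLine k G).map f).op b⟩, ?_⟩
  change F.map ((puncMap k G 1).app X).op _ + F.map ((puncMap k G (-1)).app X).op _ =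
    F.map ((puncLine k G).map f).op
      (F.map ((puncMap k G 1).app Y).op a + F.map ((puncMap k G (-1)).app Y).op b)
  rw [map_add, h, h]
  rfl

/-- The functor `X ↦ F(X[t, t⁻¹])`. -/
abbrev laurentF : (GSch k G)ᵒᵖ ⥤ AddCommGrpCat.{u + 1} := (puncLine k G).op ⋙ F

/-- The contraction `LF`: the cokernel of `F(X[t]) × F(X[t⁻¹]) → F(X[t, t⁻¹])`. -/
def contraction : (GSch k G)ᵒᵖ ⥤ AddCommGrpCat.{u + 1} where
  obj X := .of (F.obj (op ((puncLine k G).obj X.unop)) ⧸ (addMap F X.unop).range)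
  map f := AddCommGrpCat.ofHom (QuotientAddGroup.map _ _ ((laurentF F).map f).hom
    (addMap_natural F f.unop))
  map_id X := by
    ext a
    exact congrArg (QuotientAddGroup.mk' (addMap F X.unop).range) congr($((laurentF F).map_id X) a)
  map_comp {X Y Z} f g := by
    ext a
    exact congrArg (QuotientAddGroup.mk' (addMap F Z.unop).range) congr($((laurentF F).map_comp f g) a)

/-- The projection `F(X[t, t⁻¹]) → LF(X)`. -/
def toContraction : laurentF F ⟶ contraction F where
  app X := AddCommGrpCat.ofHom (QuotientAddGroup.mk' (addMap F X.unop).range)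
  naturality X Y f := rfl

/-- A functor `F` is contracted if for all `X` the sequence
`0 → F(X) → F(X[t]) × F(X[t⁻¹]) → F(X[t, t⁻¹]) → LF(X) → 0`
is exact and the projection `F(X[t, t⁻¹]) → LF(X)` has a section that is natural in `X`.
Exactness at `F(X[t, t⁻¹])` and at `LF(X)` holds by the definition of `LF`. -/
structure IsContracted : Prop where
  injective : ∀ X, Function.Injective (plusMinus F X)
  exact_mid : ∀ X, Function.Exact (plusMinus F X) (addMap F X)
  splitting : ∃ s : contraction F ⟶ laurentF F, s ≫ toContraction F = 𝟙 (contraction F)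

end Contraction

section Cohomology

variable {k : Type u} [Field k] (G : Type u) [Group G]

/-- The kernel of a natural transformation between functors to abelian groups. -/
def kerFunctor {C : Type*} [Category C] {F F' : C ⥤ AddCommGrpCat.{u + 1}} (α : F ⟶ F') :
    C ⥤ AddCommGrpCat.{u + 1} where
  obj X := .of (α.app X).hom.ker
  map {X Y} f := AddCommGrpCat.ofHom (((F.map f).hom.comp (α.app X).hom.ker.subtype).codRestrict
    (α.app Y).hom.ker fun a => by
      change α.app Y (F.map f a.1) = 0
      rw [← ConcreteCategory.comp_apply, α.naturality, ConcreteCategory.comp_apply]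
      rw [show α.app X a.1 = 0 from a.2, map_zero])
  map_id X := by
    ext a
    change F.map (𝟙 X) a.1 = a.1
    rw [F.map_id]; rfl
  map_comp f g := by
    ext a
    change F.map (f ≫ g) a.1 = F.map g (F.map f a.1)
    rw [F.map_comp]; rfl

variable {G} in
/-- The action of `G` on `M(X)`, for a functor `M` and a `G`-scheme `X`: the element `g` acts by
pullback along the automorphism `g⁻¹` of `X`. -/
def moduleRho (M : (Sch k)ᵒᵖ ⥤ AddCommGrpCat.{u + 1}) (X : GSch k G) :
    Representation (ULift.{u + 1} ℤ) (ULift.{u + 1} G) (M.obj (op X.V)) where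
  toFun g :=
    { toFun := M.map (Quiver.Hom.op (X.ρ g.down⁻¹ : X.V ⟶ X.V))
      map_add' := map_add (M.map (Quiver.Hom.op (X.ρ g.down⁻¹ : X.V ⟶ X.V))).hom
      map_smul' := fun n => map_zsmul (M.map (Quiver.Hom.op (X.ρ g.down⁻¹ : X.V ⟶ X.V))).hom n.down }
  map_one' := by
    ext a
    change M.map (Quiver.Hom.op (X.ρ (1 : G)⁻¹ : X.V ⟶ X.V)) a = a
    rw [inv_one, map_one]
    exact congr($(M.map_id (op X.V)) a)
  map_mul' g h := by
    ext a
    change M.map (Quiver.Hom.op (X.ρ (g.down * h.down)⁻¹ : X.V ⟶ X.V)) a =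
      M.map (Quiver.Hom.op (X.ρ g.down⁻¹ : X.V ⟶ X.V)) (M.map (Quiver.Hom.op (X.ρ h.down⁻¹ : X.V ⟶ X.V)) a)
    rw [mul_inv_rev, map_mul, ← ConcreteCategory.comp_apply, ← M.map_comp]
    rfl

/-- The functor `X ↦ M(X)` from `G`-schemes to `G`-modules. -/
def moduleFunctor (M : (Sch k)ᵒᵖ ⥤ AddCommGrpCat.{u + 1}) :
    (GSch k G)ᵒᵖ ⥤ Rep.{u + 1} (ULift.{u + 1} ℤ) (ULift.{u + 1} G) where
  obj X := Rep.of (moduleRho M X.unop)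
  map {X Y} f := Rep.ofHom
    { toFun := M.map f.unop.hom.op
      map_add' := map_add (M.map f.unop.hom.op).hom
      map_smul' := fun n => map_zsmul (M.map f.unop.hom.op).hom n.down
      isIntertwining' := fun g => by
        ext a
        change M.map f.unop.hom.op (M.map (Quiver.Hom.op (X.unop.ρ g.down⁻¹ : X.unop.V ⟶ X.unop.V)) a) =
          M.map (Quiver.Hom.op (Y.unop.ρ g.down⁻¹ : Y.unop.V ⟶ Y.unop.V)) (M.map f.unop.hom.op a)
        rw [← ConcreteCategory.comp_apply, ← ConcreteCategory.comp_apply, ← M.map_comp, ← M.map_comp,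
          ← op_comp, ← op_comp, f.unop.comm] }
  map_id X := by
    ext a
    exact congr($(M.map_id (op X.unop.V)) a)
  map_comp f g := by
    ext a
    exact congr($(M.map_comp f.unop.hom.op g.unop.hom.op) a)

/-- The functor `X ↦ H^1(G, M(X))` on `G`-schemes. -/
def groupHOne (M : (Sch k)ᵒᵖ ⥤ AddCommGrpCat.{u + 1}) : (GSch k G)ᵒᵖ ⥤ AddCommGrpCat.{u + 1} :=
  moduleFunctor G M ⋙ groupCohomology.functor (ULift.{u + 1} ℤ) (ULift.{u + 1} G) 1 ⋙
    forget₂ (ModuleCat (ULift.{u + 1} ℤ)) AddCommGrpCat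

variable (k)

/-- The functor `X ↦ H^0(X, 𝒪_X^×)`. -/
def unitsFunctor : (Sch k)ᵒᵖ ⥤ AddCommGrpCat.{u + 1} where
  obj X := .of (ULift.{u + 1} (Additive Γ(((Sch.toScheme k).obj X.unop), ⊤)ˣ))
  map f := AddCommGrpCat.ofHom (AddEquiv.ulift.symm.toAddMonoidHom.comp
    ((Units.map (((Sch.toScheme k).map f.unop).appTop.hom : _ →* _)).toAdditive.comp
      AddEquiv.ulift.toAddMonoidHom))
  map_id X := by
    ext a
    exact congr($(Scheme.Hom.id_app (X := (Sch.toScheme k).obj X.unop) ⊤) (Additive.toMul a.down).val)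
  map_comp f g := by
    ext a
    exact congr($(Scheme.Hom.comp_app ((Sch.toScheme k).map g.unop) ((Sch.toScheme k).map f.unop) ⊤)
      (Additive.toMul a.down).val)

/-- The functor `X ↦ H^0_ét(X, ℤ)`: sections over `X` of the sheaf on the étale site associated to
the constant presheaf `ℤ`. The restriction of this sheaf to the small étale site of `X` is the
constant sheaf `ℤ` there. -/
def etaleHZero : (Sch k)ᵒᵖ ⥤ AddCommGrpCat.{u + 1} :=
  (Sch.toScheme k).op ⋙
    ((constantSheaf Scheme.etaleTopology.{u} AddCommGrpCat.{u + 1}).obj (.of (ULift.{u + 1} ℤ))).obj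

/-- The functor `Pic^G` on `Sch^G/k`. -/
def picGOver : (GSch k G)ᵒᵖ ⥤ AddCommGrpCat.{u + 1} :=
  ((Sch.toScheme k).mapAction G).op ⋙ picGFunctor G

/-- The functor `Pic` on `Sch^G/k`. -/
def picOver : (GSch k G)ᵒᵖ ⥤ AddCommGrpCat.{u + 1} :=
  ((Sch.toScheme k).mapAction G).op ⋙ (Action.forget Scheme.{u} G).op ⋙ picFunctor

/-- The forgetful transformation `η : Pic^G ⟶ Pic` on `Sch^G/k`. -/
def eta : picGOver k G ⟶ picOver k G :=
  Functor.whiskerLeft ((Sch.toScheme k).mapAction G).op (forgetEta G)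

end Cohomology

end

end EquivariantPicard

/-! A linearized line bundle in the kernel of `η` has a global frame `s`, and its linearization is
recorded by the units `c_g` with `φ_g (g^* s) = c_g s`. The condition on `φ_{gh}` is the cocycle
identity, a change of frame alters `c` by a coboundary, every cocycle linearizes `𝒪_X`, and two
bundles with frames having the same `c` are equivariantly isomorphic. Tensor products and pullbacks
of frames give products and pullbacks of cocycles. Hence `ker(η)` is naturally `H^1(G, 𝒪(X)^×)`
(`nonempty_kerEtaIso`), and what remains is a statement about units.

Flat base change identifies the functions on `X[t]` and `X[t, t⁻¹]` with `A[t]` and `A[t, t⁻¹]`,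
where `A = Γ(X, 𝒪_X)`. For every commutative ring `A`, reduced or not, a unit of `A[t, t⁻¹]` is a
unit of `A[t]` times a unit of `A[t⁻¹]` times a locally constant power of `t`
(`exists_unit_factorization`). So the sequence of units is exact with last term `C(X, ℤ)`, and it is
split naturally in `X` by the zero section and by `c ↦ t ^ c`.

Group cohomology does not preserve exactness, but it is an additive functor. The splitting is
therefore recast as a contracting homotopy, that is, as identities between natural homomorphisms
(`exists_isContraction`); these identities pass through `H^1(G, -)` (`IsContraction.map`) and give
back contractedness and the value of the contraction (`isContracted_of_contraction`). No separate
check of equivariance is needed: each `g` acts by a morphism of schemes, so naturality in the scheme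
includes it. Finally `C(-, ℤ)` is an étale sheaf locally isomorphic to the constant presheaf, hence
equal to `H^0_ét(-, ℤ)` (`etaleHZeroIso`). -/

namespace EquivariantPicard

/-! ### Units of Laurent polynomial rings over an arbitrary commutative ring. -/

section LaurentUnits

open _root_.Polynomial hiding C
open LaurentPolynomial (C T)
open scoped LaurentPolynomial

variable {A B : Type*} [CommRing A] [CommRing B]

/-- The ring homomorphism `A[X] → A[T, T⁻¹]` that is the identity on `A` and sends `X` to `T ^ n`. -/
noncomputable def powMap (n : ℤ) : A[X] →+* A[T;T⁻¹] := eval₂RingHom C (T n)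

lemma powMap_C (n : ℤ) (a : A) : powMap n (Polynomial.C a) = C a := eval₂_C _ _

lemma powMap_X (n : ℤ) : powMap n (X : A[X]) = T n := eval₂_X _ _

lemma powMap_monomial (n : ℤ) (m : ℕ) (a : A) : powMap n (monomial m a) = C a * T (m * n) := by
  rw [← C_mul_X_pow_eq_monomial, map_mul, map_pow, powMap_C, powMap_X, LaurentPolynomial.T_pow]

lemma coeff_C_mul_T (a : A) (i n : ℤ) : (C a * T i : A[T;T⁻¹]).coeff n = if i = n then a else 0 := by
  rw [← LaurentPolynomial.single_eq_C_mul_T, AddMonoidAlgebra.coeff_single, Finsupp.single_apply]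

lemma coeff_C_mul_T_mul (a : A) (i n : ℤ) (v : A[T;T⁻¹]) :
    (C a * T i * v).coeff n = a * v.coeff (n - i) := by
  rw [← LaurentPolynomial.single_eq_C_mul_T]
  exact AddMonoidAlgebra.coeff_single_mul_eq_mul_coeff _ fun m _ => by omega

lemma sum_coeff (v : A[T;T⁻¹]) : ∑ i ∈ v.coeff.support, C (v.coeff i) * T i = v := by
  conv_rhs => rw [← AddMonoidAlgebra.sum_coeff_single v]
  exact Finset.sum_congr rfl fun i _ => (LaurentPolynomial.single_eq_C_mul_T _ _).symm

lemma coeff_powMap {n : ℤ} (hn : n ≠ 0) (p : A[X]) (m : ℕ) :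
    (powMap n p).coeff (m * n) = p.coeff m := by
  induction p using Polynomial.induction_on' with
  | add p q hp hq => simp [hp, hq]
  | monomial k a =>
    rw [powMap_monomial, coeff_C_mul_T, coeff_monomial]
    simp [hn]

lemma coeff_powMap_of_ne {n : ℤ} (p : A[X]) (j : ℤ) (hj : ∀ m : ℕ, m * n ≠ j) :
    (powMap n p).coeff j = 0 := by
  induction p using Polynomial.induction_on' with
  | add p q hp hq => simp [hp, hq]
  | monomial k a =>
    rw [powMap_monomial, coeff_C_mul_T, if_neg (hj k)]

lemma powMap_injective {n : ℤ} (hn : n ≠ 0) : Function.Injective (powMap (A := A) n) := by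
  intro p q h
  ext m
  rw [← coeff_powMap hn, h, coeff_powMap hn]

/-- The exponents on the two sides are the multiples of `n` by nonnegative and by nonpositive
integers, which meet only in `0`. -/
lemma eq_C_of_powMap_eq {p q : A[X]} {n : ℤ} (hn : n ≠ 0) (h : powMap n p = powMap (-n) q) :
    p = Polynomial.C (p.coeff 0) := by
  ext m
  rw [coeff_C]
  split_ifs with hm
  · rw [hm]
  · rw [← coeff_powMap hn, h, coeff_powMap_of_ne]
    intro k hk
    -- An exponent `k * (-n)` equal to `m * n` forces `k + m = 0`, against `m ≠ 0`.
    have : ((k : ℤ) + m) * n = 0 := by linarith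
    rcases mul_eq_zero.1 this with h | h <;> omega

/-- Polynomials in `T` and in `T⁻¹` that agree are constant. -/
lemma exists_C_of_powMap_eq {p q : A[X]} (h : powMap 1 p = powMap (-1) q) :
    ∃ c, p = Polynomial.C c ∧ q = Polynomial.C c := by
  have hp := eq_C_of_powMap_eq one_ne_zero h
  refine ⟨p.coeff 0, hp, powMap_injective (neg_ne_zero.2 one_ne_zero) ?_⟩
  rw [← h, powMap_C]
  conv_lhs => rw [hp, powMap_C]

/-- Clearing denominators in `u v = 1` gives polynomials with `f g = X ^ (n + m)`. Since `X` is
prime, `f` is a power of `X` up to a unit of `A[X]`, and over a domain that unit is constant. -/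
lemma exists_eq_C_mul_T [IsDomain A] {u : A[T;T⁻¹]} (hu : IsUnit u) : ∃ (c : A) (n : ℤ), u = C c * T n := by
  obtain ⟨v, huv⟩ := hu.exists_right_inv
  obtain ⟨n, f, hf⟩ := u.exists_T_pow
  obtain ⟨m, g, hg⟩ := v.exists_T_pow
  have hfg : f * g = X ^ (n + m) := by
    apply toLaurent_injective
    rw [map_mul, hf, hg, toLaurent_X_pow, mul_mul_mul_comm, huv, one_mul, ← LaurentPolynomial.T_add]
    push_cast; rfl
  obtain ⟨i, -, hi⟩ := (dvd_prime_pow prime_X _).1 (Dvd.intro _ hfg)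
  obtain ⟨w, hw⟩ := hi.symm
  obtain ⟨c, -, hc⟩ := isUnit_iff.1 w.isUnit
  refine ⟨c, i - n, ?_⟩
  rw [← hw, ← hc, map_mul, toLaurent_X_pow, toLaurent_C] at hf
  rw [LaurentPolynomial.T_sub, ← mul_assoc, mul_comm (C c), hf, LaurentPolynomial.mul_T_assoc, add_neg_cancel,
    LaurentPolynomial.T_zero, mul_one]

/-- The base change of Laurent polynomials. -/
noncomputable abbrev lmap (f : A →+* B) : A[T;T⁻¹] →+* B[T;T⁻¹] := AddMonoidAlgebra.mapRingHom ℤ f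

lemma lmap_C_mul_T (f : A →+* B) (a : A) (n : ℤ) : lmap f (C a * T n) = C (f a) * T n := by
  rw [← LaurentPolynomial.single_eq_C_mul_T, ← LaurentPolynomial.single_eq_C_mul_T]
  exact AddMonoidAlgebra.mapRingHom_single _ _ _

lemma lmap_powMap (f : A →+* B) (n : ℤ) (p : A[X]) : lmap f (powMap n p) = powMap n (p.map f) := by
  induction p using Polynomial.induction_on' with
  | add p q hp hq => rw [map_add, map_add, hp, hq, Polynomial.map_add, map_add]
  | monomial k a => rw [powMap_monomial, lmap_C_mul_T, Polynomial.map_monomial, powMap_monomial]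

lemma lmap_T (f : A →+* B) (n : ℤ) : lmap f (T n) = T n := by
  simpa using lmap_C_mul_T f 1 n

/-- Modulo each prime the unit becomes a monomial, so one of the two coefficients lies in that
prime. -/
lemma isNilpotent_coeff_mul_coeff {u : A[T;T⁻¹]} (hu : IsUnit u) {i j : ℤ} (hij : i ≠ j) :
    IsNilpotent (u.coeff i * u.coeff j) := by
  rw [← mem_nilradical, nilradical_eq_sInf]
  refine Submodule.mem_sInf.2 fun (p : Ideal A) (_ : p.IsPrime) => ?_
  obtain ⟨c, n, h⟩ := exists_eq_C_mul_T (hu.map (lmap (Ideal.Quotient.mk p)))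
  have hc : ∀ m, Ideal.Quotient.mk p (u.coeff m) = if n = m then c else 0 := by
    intro m
    rw [← coeff_C_mul_T, ← h]
    exact (AddMonoidAlgebra.coeff_mapRingHom _ _ _).symm
  rw [← Ideal.Quotient.eq_zero_iff_mem, map_mul, hc, hc]
  by_cases h1 : n = i
  · rw [if_neg (fun h2 => hij (h1.symm.trans h2)), mul_zero]
  · rw [if_neg h1, zero_mul]

lemma coeff_mem_of_mem_map {J : Ideal A} {y : A[T;T⁻¹]} (hy : y ∈ J.map C) (i : ℤ) : y.coeff i ∈ J := by
  have h : J.map C ≤ RingHom.ker (lmap (Ideal.Quotient.mk J)) := Ideal.map_le_iff_le_comap.2 fun j hj => by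
    change lmap _ (C j) = 0
    rw [← mul_one (C j), ← LaurentPolynomial.T_zero, lmap_C_mul_T, Ideal.Quotient.eq_zero_iff_mem.2 hj,
      map_zero, zero_mul]
  rw [← Ideal.Quotient.eq_zero_iff_mem, ← AddMonoidAlgebra.coeff_mapRingHom, show lmap _ y = 0 from h hy]
  rfl

lemma mem_map_of_coeff_mem {J : Ideal A} {y : A[T;T⁻¹]} (hy : ∀ i, y.coeff i ∈ J) : y ∈ J.map C := by
  rw [← sum_coeff y]
  exact sum_mem fun i _ => Ideal.mul_mem_right _ _ (Ideal.mem_map_of_mem _ (hy i))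

lemma powMap_mem {J : Ideal A} {p : A[X]} (hp : p ∈ J.map Polynomial.C) (n : ℤ) : powMap n p ∈ J.map C := by
  have := Ideal.mem_map_of_mem (powMap n) hp
  rwa [Ideal.map_map, show (powMap n).comp Polynomial.C = (C : A →+* _) from RingHom.ext (powMap_C n)] at this

/-- Every element of `J A[T, T⁻¹]` is the sum of a polynomial in `T` and a polynomial in `T⁻¹`,
both with coefficients in `J`. -/
lemma exists_powMap_add {J : Ideal A} {y : A[T;T⁻¹]} (hy : y ∈ J.map C) :
    ∃ p ∈ J.map Polynomial.C, ∃ q ∈ J.map Polynomial.C, y = powMap 1 p + powMap (-1) q := by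
  rw [← sum_coeff y]
  refine Finset.sum_induction _ (fun y => ∃ p ∈ J.map Polynomial.C, ∃ q ∈ J.map Polynomial.C,
    y = powMap 1 p + powMap (-1) q) ?_ ⟨0, zero_mem _, 0, zero_mem _, by simp⟩ fun n _ => ?_
  · rintro _ _ ⟨p, hp, q, hq, rfl⟩ ⟨p', hp', q', hq', rfl⟩
    exact ⟨p + p', add_mem hp hp', q + q', add_mem hq hq', by rw [map_add, map_add]; ring⟩
  · have hm : ∀ m : ℕ, monomial m (y.coeff n) ∈ J.map Polynomial.C := fun m => by
      rw [← C_mul_X_pow_eq_monomial]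
      exact Ideal.mul_mem_right _ _ (Ideal.mem_map_of_mem _ (coeff_mem_of_mem_map hy n))
    rcases Int.eq_nat_or_neg n with ⟨m, h⟩
    rcases h with h | h
    · refine ⟨monomial m (y.coeff n), hm m, 0, zero_mem _, ?_⟩
      rw [powMap_monomial, map_zero, add_zero, mul_one, ← h]
    · refine ⟨0, zero_mem _, monomial m (y.coeff n), hm m, ?_⟩
      rw [powMap_monomial, map_zero, zero_add, mul_neg, mul_one, ← h]

lemma isNilpotent_of_mem_map {R : Type*} [CommRing R] (f : A →+* R) {J : Ideal A} {n : ℕ} (hJ : J ^ n = ⊥)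
    {y : R} (hy : y ∈ J.map f) : IsNilpotent y := by
  refine ⟨n, ?_⟩
  have := Ideal.pow_mem_pow hy n
  rwa [← Ideal.map_pow, hJ, Ideal.map_bot, Ideal.mem_bot] at this

/-- Successive approximation: splitting off the obvious factors leaves an error in `J ^ 2`, so the
order of nilpotency halves at each step. This is why the exponent is a power of `2`. -/
lemma exists_powMap_mul_of_pow (m : ℕ) : ∀ (J : Ideal A) (_ : J ^ 2 ^ m = ⊥) (y : A[T;T⁻¹]) (_ : y ∈ J.map C),
    ∃ a b : A[X]ˣ, 1 + y = powMap 1 a.val * powMap (-1) b.val := by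
  induction m with
  | zero =>
    intro J hJ y hy
    rw [pow_zero, pow_one] at hJ
    rw [hJ, Ideal.map_bot, Ideal.mem_bot] at hy
    exact ⟨1, 1, by simp [hy]⟩
  | succ m ih =>
    intro J hJ y hy
    obtain ⟨p, hp, q, hq, rfl⟩ := exists_powMap_add hy
    obtain ⟨a, ha⟩ := (isNilpotent_of_mem_map _ hJ hp).isUnit_one_add
    obtain ⟨b, hb⟩ := (isNilpotent_of_mem_map _ hJ hq).isUnit_one_add
    have ha' : powMap 1 a.val * powMap 1 a.inv = 1 := by rw [← map_mul, a.val_inv, map_one]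
    have hb' : powMap (-1) b.val * powMap (-1) b.inv = 1 := by rw [← map_mul, b.val_inv, map_one]
    -- With `y = p + q`, `a = 1 + p` and `b = 1 + q` one has `1 + y = a b - p q`. Dividing by `a b`
    -- leaves `1 - a⁻¹ b⁻¹ p q`, and `p q` has coefficients in `J ^ 2`.
    obtain ⟨a', b', h⟩ := ih (J ^ 2) (by rw [← pow_mul, ← pow_succ', hJ])
      (-(powMap 1 a.inv * powMap (-1) b.inv * (powMap 1 p * powMap (-1) q)))
      (neg_mem (Ideal.mul_mem_left _ _ (by
        rw [sq, Ideal.map_mul]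
        exact Ideal.mul_mem_mul (powMap_mem hp _) (powMap_mem hq _))))
    refine ⟨a * a', b * b', ?_⟩
    rw [Units.val_mul, Units.val_mul, map_mul, map_mul, mul_mul_mul_comm, ← h]
    have h1 : powMap 1 a.val = 1 + powMap 1 p := by rw [ha, map_add, map_one]
    have h2 : powMap (-1) b.val = 1 + powMap (-1) q := by rw [hb, map_add, map_one]
    linear_combination (powMap 1 a.val * powMap 1 a.inv * (powMap 1 p * powMap (-1) q)) * hb'
      + (powMap 1 p * powMap (-1) q) * ha' - (1 + powMap (-1) q) * h1 - powMap 1 a.val * h2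

/-- The finitely many coefficients of `y` generate a nilpotent ideal; from `J ^ n = 0` follows `J ^
2 ^ n = 0`. -/
lemma exists_powMap_mul {y : A[T;T⁻¹]} (hy : ∀ i, IsNilpotent (y.coeff i)) :
    ∃ a b : A[X]ˣ, 1 + y = powMap 1 a.val * powMap (-1) b.val := by
  classical
  let J : Ideal A := Ideal.span (y.coeff '' y.coeff.support)
  have hfg : J.FG := ⟨y.coeff.support.image y.coeff, by rw [Finset.coe_image]⟩
  have hJ : J ≤ nilradical A := Ideal.span_le.2 (by
    rintro _ ⟨i, -, rfl⟩
    exact hy i)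
  obtain ⟨n, hn⟩ := (Ideal.FG.isNilpotent_iff_le_nilradical hfg).2 hJ
  refine exists_powMap_mul_of_pow n J ?_ y (mem_map_of_coeff_mem fun i => ?_)
  · exact le_bot_iff.1 ((Ideal.pow_le_pow_right Nat.lt_two_pow_self.le).trans hn.le)
  · by_cases hi : i ∈ y.coeff.support
    · exact Ideal.subset_span ⟨i, hi, rfl⟩
    · rw [Finsupp.notMem_support_iff.1 hi]
      exact zero_mem _

/-- A Laurent polynomial is a unit up to nilpotents only if it is a constant unit up to nilpotents. -/
lemma exists_powMap_mul_of_isUnit {w : A[T;T⁻¹]} (hw : IsUnit w) (h : ∀ i ≠ 0, IsNilpotent (w.coeff i)) :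
    ∃ a b : A[X]ˣ, w = powMap 1 a.val * powMap (-1) b.val := by
  let π := Ideal.Quotient.mk (nilradical A)
  have hπ : lmap π w = C (π (w.coeff 0)) := by
    ext i
    rw [← mul_one (C _), ← LaurentPolynomial.T_zero, coeff_C_mul_T, AddMonoidAlgebra.coeff_mapRingHom]
    split_ifs with h0
    · rw [h0]
    · exact Ideal.Quotient.eq_zero_iff_mem.2 (h i (Ne.symm h0))
  have hu : IsUnit (π (w.coeff 0)) := by
    -- Evaluation at `T = 1` carries the unit `lmap π w`, which is a constant, to that constant.
    have := (hw.map (lmap π)).map (LaurentPolynomial.eval₂ (RingHom.id _) (1 : (A ⧸ nilradical A)ˣ))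
    rwa [hπ, LaurentPolynomial.eval₂_C] at this
  obtain ⟨v, hv⟩ := hu.exists_right_inv
  obtain ⟨v, rfl⟩ := Ideal.Quotient.mk_surjective v
  have hn : IsNilpotent (w.coeff 0 * v - 1) := by
    rw [← mem_nilradical, ← Ideal.Quotient.eq_zero_iff_mem, map_sub, map_mul, map_one]
    exact sub_eq_zero.2 hv
  -- Being invertible modulo nilpotents, `w.coeff 0` is invertible: its product with `v` is `1` plus
  -- a nilpotent.
  have hu : IsUnit (w.coeff 0) := isUnit_of_mul_isUnit_left (y := v) (by
    simpa using hn.isUnit_one_add)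
  obtain ⟨c, hc⟩ := hu
  -- After division by the constant coefficient `c`, all coefficients of the difference from `1` are
  -- nilpotent; the factor `c` is put back into the unit of `A[T]`.
  obtain ⟨a, b, hab⟩ := exists_powMap_mul (y := C c.inv * w - 1) fun i => by
    have : (C c.inv * w - 1).coeff i = c.inv * w.coeff i - (1 : A[T;T⁻¹]).coeff i := by
      have := coeff_C_mul_T_mul c.inv 0 i w
      rw [LaurentPolynomial.T_zero, mul_one, sub_zero] at this
      rw [← this]
      rfl
    rw [this]
    by_cases hi : i = 0
    · subst hi
      rw [← hc, c.inv_val, ← LaurentPolynomial.T_zero, LaurentPolynomial.T_apply, if_pos rfl, sub_self]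
      exact IsNilpotent.zero
    · rw [← LaurentPolynomial.T_zero, LaurentPolynomial.T_apply, if_neg (Ne.symm hi), sub_zero]
      exact (Commute.all _ _).isNilpotent_mul_left (h i hi)
  refine ⟨Units.map Polynomial.C.toMonoidHom c * a, b, ?_⟩
  have hc' : C c.val * C c.inv = (1 : A[T;T⁻¹]) := by rw [← map_mul, c.val_inv, map_one]
  have : powMap 1 (Units.map Polynomial.C.toMonoidHom c).val = C c.val := powMap_C _ _
  rw [Units.val_mul, map_mul, this, mul_assoc, ← hab, add_sub_cancel, ← mul_assoc, hc', one_mul]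

/-- The Laurent polynomial `∑ eᵢ T ^ i`. -/
noncomputable def idemSum {s : Finset ℤ} (e : s → A) : A[T;T⁻¹] := ∑ i, C (e i) * T i.1

/-- Units of `A[T, T⁻¹]` are products of units of `A[T]`, units of `A[T⁻¹]`, and locally constant powers
of `T`. -/
theorem exists_unit_factorization {u : A[T;T⁻¹]} (hu : IsUnit u) :
    ∃ (s : Finset ℤ) (e : s → A) (a b : A[X]ˣ), CompleteOrthogonalIdempotents e ∧
      u = powMap 1 a.val * powMap (-1) b.val * idemSum e := by
  classical
  obtain ⟨v, huv⟩ := hu.exists_right_inv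
  let π := Ideal.Quotient.mk (nilradical A)
  let s := u.coeff.support
  have hker : ∀ x ∈ RingHom.ker π, IsNilpotent x := fun x hx => by
    rwa [Ideal.mk_ker] at hx
  have hmul : ∀ i j, i ≠ j → π (u.coeff i) * π (u.coeff j) = 0 := fun i j hij => by
    rw [← map_mul]
    exact Ideal.Quotient.eq_zero_iff_mem.2 (isNilpotent_coeff_mul_coeff hu hij)
  -- These products sum to the coefficient of `T ^ 0` in `u v = 1`, and they are orthogonal modulo
  -- the nilradical because products of distinct coefficients of `u` are nilpotent. Orthogonality
  -- and sum `1` already imply idempotence.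
  have hcomp : CompleteOrthogonalIdempotents fun i : s => π (u.coeff i * v.coeff (-i)) := by
    refine CompleteOrthogonalIdempotents.iff_ortho_complete.2 ⟨fun i j hij => ?_, ?_⟩
    · change π _ * π _ = 0
      rw [map_mul, map_mul, mul_mul_mul_comm, hmul _ _ (fun h => hij (Subtype.ext h)), zero_mul]
    · rw [← map_sum, ← map_one π]
      congr 1
      rw [Finset.sum_coe_sort s fun i => u.coeff i * v.coeff (-i)]
      have h1 : (u * v).coeff 0 = 1 := by
        rw [huv, ← LaurentPolynomial.T_zero, LaurentPolynomial.T_apply, if_pos rfl]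
      rw [← h1]
      conv_rhs => rw [← sum_coeff u, Finset.sum_mul, AddMonoidAlgebra.coeff_sum, Finsupp.finsetSum_apply]
      exact Finset.sum_congr rfl fun i _ => by rw [coeff_C_mul_T_mul, zero_sub]
  -- Complete orthogonal families of idempotents lift along the nil ideal, so `e` lives in `A`
  -- itself.
  obtain ⟨e, he, hπe⟩ := CompleteOrthogonalIdempotents.lift_of_isNilpotent_ker π hker hcomp fun i => ⟨_, rfl⟩
  -- By orthogonality only the diagonal terms `e i * T (-i) * T i` of the product survive.
  have hE : (∑ i, C (e i) * T (-i.1)) * idemSum e = 1 := by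
    rw [idemSum, Finset.sum_mul_sum, Finset.sum_congr rfl fun i _ => Finset.sum_eq_single i (fun j _ hj => ?_)
      (fun h => absurd (Finset.mem_univ _) h)]
    · rw [← map_one C, ← he.complete, map_sum]
      refine Finset.sum_congr rfl fun i _ => ?_
      rw [mul_mul_mul_comm, ← map_mul, he.idem i, ← LaurentPolynomial.T_add, neg_add_cancel,
        LaurentPolynomial.T_zero, mul_one]
    · rw [mul_mul_mul_comm, ← map_mul, he.ortho (Ne.symm hj), map_zero, zero_mul]
  -- The coefficient of `T ^ n` here is `∑ e i * u.coeff (n + i)`. Modulo nilpotents `e i` is a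
  -- multiple of `u.coeff i`, so each term is nilpotent for `n ≠ 0`.
  obtain ⟨a, b, hab⟩ := exists_powMap_mul_of_isUnit (w := (∑ i, C (e i) * T (-i.1)) * u)
    ((IsUnit.of_mul_eq_one _ hE).mul hu) fun n hn => by
      rw [← mem_nilradical, ← Ideal.Quotient.eq_zero_iff_mem]
      rw [Finset.sum_mul, AddMonoidAlgebra.coeff_sum, Finsupp.finsetSum_apply, map_sum]
      refine Finset.sum_eq_zero fun i _ => ?_
      rw [coeff_C_mul_T_mul, map_mul, show Ideal.Quotient.mk (nilradical A) (e i) = _ from congrFun hπe i,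
        map_mul, mul_right_comm, hmul, zero_mul]
      omega
  refine ⟨s, e, a, b, he, ?_⟩
  rw [← hab, mul_right_comm, hE, one_mul]

/-- Over a field, a power of `T` that is the product of a unit of `K[T]` and a unit of `K[T⁻¹]` is trivial. -/
lemma eq_zero_of_T_eq {K : Type*} [Field K] {n : ℤ} (a b : K[X]ˣ)
    (h : T n = powMap 1 a.val * powMap (-1) b.val) : n = 0 := by
  obtain ⟨c, -, hc⟩ := isUnit_iff.1 a.isUnit
  obtain ⟨d, -, hd⟩ := isUnit_iff.1 b.isUnit
  rw [← hc, ← hd, powMap_C, powMap_C, ← map_mul] at h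
  by_contra hn
  have h1 := congr(($h).coeff n)
  rw [LaurentPolynomial.T_apply, if_pos rfl, LaurentPolynomial.C_apply, if_neg hn] at h1
  exact one_ne_zero h1

end LaurentUnits

/-! ### Functions on `X[t]` and `X[t, t⁻¹]` as polynomials and Laurent polynomials. -/

section ProductSections

open _root_.Polynomial hiding C
open LaurentPolynomial (C T)
open scoped LaurentPolynomial

variable {k : Type u} [Field k] (R : Type u) [CommRing R] [Algebra k R]

/-- The functions on `X`. -/
noncomputable abbrev glob (X : Over (Spec (.of k))) : CommRingCat.{u} := Γ(X.left, ⊤)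

/-- Pullback of functions along the projection `X ×_k Spec R ⟶ X`. -/
noncomputable def baseHom (X : Over (Spec (.of k))) : glob X ⟶ glob (prodSpecObj R X) :=
  (pullback.fst X.hom (specMap (k := k) R)).appTop

/-- Pullback of functions along the projection `X ×_k Spec R ⟶ Spec R`. -/
noncomputable def coordHom (X : Over (Spec (.of k))) : CommRingCat.of R ⟶ glob (prodSpecObj R X) :=
  (Scheme.ΓSpecIso (.of R)).inv ≫ (pullback.snd X.hom (specMap (k := k) R)).appTop

/-- The structure homomorphism `k → Γ(X, 𝒪_X)`. -/
noncomputable def structHom (X : Over (Spec (.of k))) : CommRingCat.of k ⟶ glob X :=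
  (Scheme.ΓSpecIso (.of k)).inv ≫ X.hom.appTop

/-- Pullback of functions. -/
noncomputable abbrev globMap {X Y : Over (Spec (.of k))} (f : X ⟶ Y) : glob Y ⟶ glob X := f.left.appTop

variable {R} in
lemma baseHom_map {S : Type u} [CommRing S] [Algebra k S] {A B : Over (Spec (.of k))} (f : A ⟶ B)
    (φ : R →ₐ[k] S) : baseHom R B ≫ globMap (prodOverMap f φ) = globMap f ≫ baseHom S A := by
  have := congr(Scheme.Hom.appTop $(prodOverMap_fst f φ))
  rw [Scheme.Hom.comp_appTop, Scheme.Hom.comp_appTop] at this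
  exact this

variable {R} in
lemma coordHom_map {S : Type u} [CommRing S] [Algebra k S] {A B : Over (Spec (.of k))} (f : A ⟶ B)
    (φ : R →ₐ[k] S) : coordHom R B ≫ globMap (prodOverMap f φ) =
      CommRingCat.ofHom φ.toRingHom ≫ coordHom S A := by
  have := congr(Scheme.Hom.appTop $(prodOverMap_snd f φ))
  rw [Scheme.Hom.comp_appTop, Scheme.Hom.comp_appTop] at this
  rw [coordHom, coordHom, Category.assoc, this, ← Category.assoc, ← Category.assoc]
  congr 1
  exact (Scheme.ΓSpecIso_inv_naturality _).symm

/-- The functions on `X ×_k Spec R` are `Γ(X, 𝒪_X) ⊗_k R`. -/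
lemma isPushout_glob (X : Over (Spec (.of k))) [CompactSpace X.left] [QuasiSeparatedSpace X.left] :
    IsPushout (structHom X) (CommRingCat.ofHom (algebraMap k R)) (baseHom R X) (coordHom R X) := by
  have hf : Flat (specMap (k := k) R) := by
    rw [HasRingHomProperty.Spec_iff (P := @Flat)]
    exact (RingHom.flat_algebraMap_iff).2 inferInstance
  -- Flat base change for global functions on a quasi-compact quasi-separated scheme; flatness of `k
  -- → R` is automatic over a field.
  have h := (isIso_pushoutSection_iff (IsPullback.of_hasPullback X.hom (specMap (k := k) R))
    (US := ⊤) (UT := ⊤) (UX := ⊤) (UY := ⊤) le_top le_top (by simp)).1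
    (isIso_pushoutSection_of_isQuasiSeparated_of_flat_right _ _ _ _ (isAffineOpen_top _) (isAffineOpen_top _)
      isCompact_univ (by simpa using isQuasiSeparated_univ))
  have e : ∀ {Y Z : Scheme.{u}} (f : Y ⟶ Z) (h : (⊤ : Y.Opens) ≤ f ⁻¹ᵁ ⊤), f.appLE ⊤ ⊤ h = f.appTop :=
    fun f _ => f.appLE_eq_app
  have h' : IsPushout (Scheme.Hom.appTop (X := X.left) (Y := Spec (.of k)) X.hom) (specMap (k := k) R).appTop
      (pullback.fst X.hom (specMap (k := k) R)).appTop (pullback.snd X.hom (specMap (k := k) R)).appTop := by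
    rw [← e, ← e, ← e, ← e]
    exact h
  refine h'.of_iso (Scheme.ΓSpecIso _) (Iso.refl _) (Scheme.ΓSpecIso _) (Iso.refl _) ?_ ?_ ?_ ?_
  · simp [structHom]
  · exact Scheme.ΓSpecIso_naturality _
  · simp [baseHom]
  · simp [coordHom]

variable {R} in
/-- A model of `A ⊗_k R` maps isomorphically to the functions on `X ×_k Spec R`, `A` being the functions
on `X`. -/
lemma bijective_of_isPushout {X : Over (Spec (.of k))} [CompactSpace X.left] [QuasiSeparatedSpace X.left]
    {P : CommRingCat.{u}} {i : glob X ⟶ P} {j : CommRingCat.of R ⟶ P}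
    (h : IsPushout (structHom X) (CommRingCat.ofHom (algebraMap k R)) i j) (φ : P ⟶ glob (prodSpecObj R X))
    (hi : i ≫ φ = baseHom R X) (hj : j ≫ φ = coordHom R X) : Function.Bijective φ := by
  have : φ = (h.isoIsPushout _ _ (isPushout_glob R X)).hom := h.hom_ext (by simp [hi]) (by simp [hj])
  rw [this]
  exact ConcreteCategory.bijective_of_isIso _

attribute [local instance] _root_.Polynomial.algebra in
-- This is `A ⊗_k k[t] = A[t]` for `A = Γ(X, 𝒪_X)`; the local instance makes `A[t]` a `k[t]`-algebra
-- by mapping coefficients.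
lemma isPushout_polynomial (X : Over (Spec (.of k))) :
    IsPushout (structHom X) (CommRingCat.ofHom (algebraMap k k[X])) (CommRingCat.ofHom Polynomial.C)
      (CommRingCat.ofHom (mapRingHom (structHom X).hom) : _ ⟶ CommRingCat.of (glob X)[X]) := by
  let _ : Algebra k (glob X) := (structHom X).hom.toAlgebra
  exact CommRingCat.isPushout_of_isPushout k (glob X) k[X] (glob X)[X]

open scoped AlgebraMonoidAlgebra in
lemma isPushout_laurent (X : Over (Spec (.of k))) :
    IsPushout (structHom X) (CommRingCat.ofHom (algebraMap k k[T;T⁻¹])) (CommRingCat.ofHom C)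
      (CommRingCat.ofHom (lmap (structHom X).hom) : _ ⟶ CommRingCat.of (glob X)[T;T⁻¹]) := by
  let _ : Algebra k (glob X) := (structHom X).hom.toAlgebra
  exact CommRingCat.isPushout_of_isPushout k (glob X) k[T;T⁻¹] (glob X)[T;T⁻¹]

variable (X : Over (Spec (.of k)))

/-- The homomorphism `Γ(X, 𝒪_X)[t] → Γ(X[t], 𝒪)`. -/
noncomputable def polyGlob : (glob X)[X] →+* glob (prodSpecObj k[X] X) :=
  eval₂RingHom (baseHom k[X] X).hom (coordHom k[X] X Polynomial.X)

lemma polyGlob_C (a : glob X) : polyGlob X (Polynomial.C a) = baseHom k[X] X a := eval₂_C _ _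

lemma polyGlob_X : polyGlob X Polynomial.X = coordHom k[X] X Polynomial.X := eval₂_X _ _

/-- The homomorphism `Γ(X, 𝒪_X)[t, t⁻¹] → Γ(X[t, t⁻¹], 𝒪)`. -/
noncomputable def laurGlob : (glob X)[T;T⁻¹] →+* glob (prodSpecObj k[T;T⁻¹] X) :=
  AddMonoidAlgebra.liftNCRingHom (baseHom k[T;T⁻¹] X).hom
    ((coordHom k[T;T⁻¹] X).hom.toMonoidHom.comp (AddMonoidAlgebra.of k ℤ)) fun _ _ => Commute.all _ _

lemma laurGlob_C_mul_T (a : glob X) (n : ℤ) :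
    laurGlob X (C a * T n) = baseHom k[T;T⁻¹] X a * coordHom k[T;T⁻¹] X (T n) := by
  rw [← LaurentPolynomial.single_eq_C_mul_T]
  exact AddMonoidAlgebra.liftNC_single _ _ _ _

lemma laurGlob_C (a : glob X) : laurGlob X (C a) = baseHom k[T;T⁻¹] X a := by
  have := laurGlob_C_mul_T X a 0
  rwa [LaurentPolynomial.T_zero, LaurentPolynomial.T_zero, map_one, mul_one, mul_one] at this

lemma laurGlob_T (n : ℤ) : laurGlob X (T n) = coordHom k[T;T⁻¹] X (T n) := by
  have := laurGlob_C_mul_T X 1 n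
  rwa [map_one, map_one, one_mul, one_mul] at this

lemma laurent_ringHom_ext {A B : Type*} [CommRing A] [CommRing B] {f g : A[T;T⁻¹] →+* B}
    (hC : ∀ a, f (C a) = g (C a)) (hT : ∀ n, f (T n) = g (T n)) : f = g :=
  AddMonoidAlgebra.ringHom_ext hC hT

/-- Commutativity of the fibre product square, read on global functions. -/
lemma baseHom_structHom (R : Type u) [CommRing R] [Algebra k R] (a : k) :
    baseHom R X (structHom X a) = coordHom R X (algebraMap k R a) := by
  have h : structHom X ≫ baseHom R X = CommRingCat.ofHom (algebraMap k R) ≫ coordHom R X := by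
    rw [structHom, baseHom, coordHom, Category.assoc, ← Scheme.Hom.comp_appTop, pullback.condition,
      Scheme.Hom.comp_appTop, ← Category.assoc, ← Category.assoc]
    congr 1
    exact (Scheme.ΓSpecIso_inv_naturality _).symm
  exact congr($h a)

/-- Source and target are both pushouts of `Γ(X, 𝒪_X)` and `k[t]` over `k`, so it suffices that the
explicit map respects the two legs. -/
lemma bijective_polyGlob [CompactSpace X.left] [QuasiSeparatedSpace X.left] :
    Function.Bijective (polyGlob X) := by
  refine bijective_of_isPushout (isPushout_polynomial X) (CommRingCat.ofHom (polyGlob X)) ?_ ?_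
  · ext a
    exact polyGlob_C X a
  · refine CommRingCat.hom_ext (Polynomial.ringHom_ext (fun a => ?_) ?_)
    · change polyGlob X (Polynomial.map _ (Polynomial.C a)) = _
      rw [Polynomial.map_C, polyGlob_C]
      exact baseHom_structHom X k[X] a
    · change polyGlob X (Polynomial.map _ Polynomial.X) = _
      rw [Polynomial.map_X, polyGlob_X]

lemma bijective_laurGlob [CompactSpace X.left] [QuasiSeparatedSpace X.left] :
    Function.Bijective (laurGlob X) := by
  refine bijective_of_isPushout (isPushout_laurent X) (CommRingCat.ofHom (laurGlob X)) ?_ ?_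
  · ext a
    exact laurGlob_C X a
  · refine CommRingCat.hom_ext (laurent_ringHom_ext (fun a => ?_) fun n => ?_)
    · change laurGlob X (lmap _ (C a)) = _
      have := lmap_C_mul_T (structHom X).hom a 0
      rw [LaurentPolynomial.T_zero, LaurentPolynomial.T_zero, mul_one, mul_one] at this
      rw [this, laurGlob_C]
      exact baseHom_structHom X k[T;T⁻¹] a
    · change laurGlob X (lmap _ (T n)) = _
      rw [lmap_T, laurGlob_T]

/-- The morphism `X[t, t⁻¹] ⟶ X[t]` that sends the coordinate to `t ^ n`. -/
noncomputable abbrev powOverMap (n : ℤ) : prodSpecObj k[T;T⁻¹] X ⟶ prodSpecObj k[X] X :=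
  prodOverMap (𝟙 X) (Polynomial.aeval (R := k) (T n : k[T;T⁻¹]))

/-- Translates restriction from `X[t]` or `X[t⁻¹]` to `X[t, t⁻¹]` into the ring homomorphism
`powMap`, where the algebra of units applies. -/
lemma globMap_polyGlob (n : ℤ) (p : (glob X)[X]) :
    globMap (powOverMap X n) (polyGlob X p) = laurGlob X (powMap n p) := by
  refine congr($(show (globMap (powOverMap X n)).hom.comp (polyGlob X) = (laurGlob X).comp (powMap n) from
    Polynomial.ringHom_ext (fun a => ?_) ?_) p)
  · change globMap (powOverMap X n) (polyGlob X (Polynomial.C a)) = laurGlob X (powMap n (Polynomial.C a))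
    rw [powMap_C, polyGlob_C, laurGlob_C]
    exact congr($(baseHom_map (𝟙 X) (Polynomial.aeval (R := k) (T n : k[T;T⁻¹]))) a)
  · change globMap (powOverMap X n) (polyGlob X Polynomial.X) = laurGlob X (powMap n Polynomial.X)
    rw [powMap_X, polyGlob_X, laurGlob_T]
    refine (congr($(coordHom_map (𝟙 X) (Polynomial.aeval (R := k) (T n : k[T;T⁻¹]))) Polynomial.X)).trans ?_
    exact congrArg (coordHom k[T;T⁻¹] X) (Polynomial.aeval_X _)

/-- Naturality in the scheme, used to show that `c ↦ t ^ c` commutes with pullback. -/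
lemma globMap_laurGlob {X Y : Over (Spec (.of k))} (f : X ⟶ Y) (p : (glob Y)[T;T⁻¹]) :
    globMap (prodOverMap f (AlgHom.id k k[T;T⁻¹])) (laurGlob Y p) = laurGlob X (lmap (globMap f).hom p) := by
  refine congr($(show (globMap (prodOverMap f (AlgHom.id k k[T;T⁻¹]))).hom.comp (laurGlob Y) =
    (laurGlob X).comp (lmap (globMap f).hom) from laurent_ringHom_ext (fun a => ?_) fun n => ?_) p)
  · change globMap (prodOverMap f (AlgHom.id k k[T;T⁻¹])) (laurGlob Y (C a)) = laurGlob X (lmap _ (C a))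
    have := lmap_C_mul_T (globMap f).hom a 0
    rw [LaurentPolynomial.T_zero, LaurentPolynomial.T_zero, mul_one, mul_one] at this
    rw [this, laurGlob_C, laurGlob_C]
    exact congr($(baseHom_map f (AlgHom.id k k[T;T⁻¹])) a)
  · change globMap (prodOverMap f (AlgHom.id k k[T;T⁻¹])) (laurGlob Y (T n)) = laurGlob X (lmap _ (T n))
    rw [lmap_T, laurGlob_T, laurGlob_T]
    exact congr($(coordHom_map f (AlgHom.id k k[T;T⁻¹])) (T n))

end ProductSections

/-! ### Locally constant powers of `t`. -/

section Degrees

open _root_.Polynomial hiding C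
open LaurentPolynomial (C T)
open scoped LaurentPolynomial

variable {Y Z : Scheme.{u}}

/-- The germ of a global function. -/
noncomputable abbrev germTop (x : Y) : Γ(Y, ⊤) ⟶ Y.presheaf.stalk x := Y.presheaf.germ ⊤ x trivial

lemma eq_of_germTop {a b : Γ(Y, ⊤)} (h : ∀ x : Y, germTop x a = germTop x b) : a = b :=
  TopCat.Presheaf.section_ext Y.sheaf ⊤ a b fun x _ => h x

/-- A function `u` on `Y[t, t⁻¹]` equals `t ^ f(x)` locally at every point `x` of `Y`. -/
def IsDegree (f : Y → ℤ) (u : Γ(Y, ⊤)[T;T⁻¹]) : Prop := ∀ x, lmap (germTop x).hom u = T (f x)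

/-- A function is determined by its germs, so the degree determines every coefficient. Identities
between powers `t ^ c` can thus be checked on degrees. -/
lemma IsDegree.ext {f : Y → ℤ} {u v : Γ(Y, ⊤)[T;T⁻¹]} (hu : IsDegree f u) (hv : IsDegree f v) : u = v := by
  ext n
  refine eq_of_germTop fun x => ?_
  have := congr(($((hu x).trans (hv x).symm)).coeff n)
  rwa [AddMonoidAlgebra.coeff_mapRingHom, AddMonoidAlgebra.coeff_mapRingHom] at this

lemma IsDegree.mul {f g : Y → ℤ} {u v : Γ(Y, ⊤)[T;T⁻¹]} (hu : IsDegree f u) (hv : IsDegree g v) :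
    IsDegree (f + g) (u * v) := fun x => by
  rw [map_mul, hu, hv, ← LaurentPolynomial.T_add]; rfl

lemma isDegree_one : IsDegree (0 : Y → ℤ) 1 := fun x => by
  rw [map_one, Pi.zero_apply, LaurentPolynomial.T_zero]

lemma IsDegree.comap {f : Y → ℤ} {u : Γ(Y, ⊤)[T;T⁻¹]} (hu : IsDegree f u) (h : Z ⟶ Y) :
    IsDegree (fun x => f (h x)) (lmap h.appTop.hom u) := fun x => by
  have h1 := congr(lmap (h.stalkMap x).hom $(hu (h x)))
  rw [lmap_T] at h1
  rw [← h1, ← RingHom.comp_apply, ← RingHom.comp_apply, lmap, lmap, lmap, lmap,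
    ← AddMonoidAlgebra.mapRingHom_comp, ← AddMonoidAlgebra.mapRingHom_comp,
    ← CommRingCat.hom_comp, ← CommRingCat.hom_comp]
  exact congr(AddMonoidAlgebra.mapRingHom ℤ (CommRingCat.Hom.hom
    $(show _ = germTop (h x) ≫ h.stalkMap x from (Scheme.Hom.germ_stalkMap h ⊤ x trivial).symm)) u)

/-- The fibres of `f` are open since `ℤ` is discrete; the idempotent is glued from `1` on the fibre
over `n` and `0` on the others. -/
lemma exists_char {f : Y → ℤ} (hf : Continuous f) (n : ℤ) :
    ∃ a : Γ(Y, ⊤), ∀ x, germTop x a = if f x = n then 1 else 0 := by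
  obtain ⟨a, ha, -⟩ := Y.sheaf.existsUnique_gluing' (fun m : ℤ => ⟨f ⁻¹' {m}, (isOpen_discrete _).preimage hf⟩) ⊤
    (fun m => homOfLE le_top) (fun x _ => Opens.mem_iSup.2 ⟨f x, rfl⟩)
    -- Distinct fibres are disjoint, so their sections agree vacuously on the overlap.
    (fun m => if m = n then 1 else 0) (fun m m' => by
      by_cases h : m = m'
      · subst h; rfl
      · refine TopCat.Presheaf.section_ext Y.sheaf _ _ _ fun x hx => absurd ?_ h
        exact hx.1.symm.trans hx.2)
  refine ⟨a, fun x => ?_⟩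
  have h1 := congr(Y.presheaf.germ _ x (show x ∈ (⟨f ⁻¹' {f x}, (isOpen_discrete _).preimage hf⟩ : Y.Opens) from rfl)
    $(ha (f x)))
  refine (TopCat.Presheaf.germ_res_apply Y.presheaf _ _ _ _).symm.trans (h1.trans ?_)
  split_ifs
  · exact map_one _
  · exact map_zero _

/-- Compactness makes the range of `f` finite, so that `∑ 1_{f = n} T ^ n` is a Laurent polynomial.
-/
lemma exists_isDegree [CompactSpace Y] {f : Y → ℤ} (hf : Continuous f) : ∃ u, IsDegree f u := by
  choose a ha using exists_char hf
  have hfin : (Set.range f).Finite := (isCompact_range hf).finite_of_discrete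
  refine ⟨∑ n ∈ hfin.toFinset, C (a n) * T n, fun x => ?_⟩
  rw [map_sum, Finset.sum_eq_single (f x)]
  · rw [lmap_C_mul_T]
    rw [show (germTop x).hom _ = _ from ha _ x, if_pos rfl, map_one, one_mul]
  · intro n _ hn
    rw [lmap_C_mul_T]
    rw [show (germTop x).hom _ = _ from ha _ x, if_neg (Ne.symm hn), map_zero, zero_mul]
  · intro h
    exact absurd (hfin.mem_toFinset.2 ⟨x, rfl⟩) h

lemma lmap_idemSum_of_eq_one {A B : Type*} [CommRing A] [CommRing B] {s : Finset ℤ} {e : s → A}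
    (he : CompleteOrthogonalIdempotents e) (φ : A →+* B) (i : s) (hi : φ (e i) = 1) :
    lmap φ (idemSum e) = T i.1 := by
  rw [idemSum, map_sum, Finset.sum_eq_single i]
  · rw [lmap_C_mul_T, hi, map_one, one_mul]
  · intro j _ hj
    have : φ (e j) * φ (e i) = 0 := by rw [← map_mul, he.ortho hj, map_zero]
    rw [hi, mul_one] at this
    rw [lmap_C_mul_T, this, map_zero, zero_mul]
  · exact fun h => absurd (Finset.mem_univ _) h

/-- In a local ring an invertible idempotent is `1`, and a sum of nonunits cannot be `1`. Hence at
each point some `e i` has germ `1`, the others vanish there, and `i` is the degree at that point. -/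
lemma exists_isDegree_idemSum {s : Finset ℤ} {e : s → Γ(Y, ⊤)} (he : CompleteOrthogonalIdempotents e) :
    ∃ f : Y → ℤ, Continuous f ∧ IsDegree f (idemSum e) := by
  have h01 : ∀ (x : Y) i, IsUnit (germTop x (e i)) → germTop x (e i) = 1 := fun x i h =>
    h.mul_left_cancel (by rw [mul_one, ← map_mul, he.idem i])
  have hex : ∀ x : Y, ∃ i, IsUnit (germTop x (e i)) := by
    intro x
    by_contra! h
    have h1 : ∑ i, germTop x (e i) ∈ IsLocalRing.maximalIdeal (Y.presheaf.stalk x) :=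
      sum_mem fun i _ => h i
    rw [← map_sum, he.complete, map_one] at h1
    exact (Ideal.ne_top_iff_one _).1 (IsLocalRing.maximalIdeal.isMaximal _).ne_top h1
  choose i hi using hex
  have hd : ∀ (x : Y) j, IsUnit (germTop x (e j)) → lmap (germTop x).hom (idemSum e) = T j.1 := fun x j h =>
    lmap_idemSum_of_eq_one he _ j (h01 x j h)
  have hinj : ∀ (x : Y) (m n : ℤ), (T m : (Y.presheaf.stalk x)[T;T⁻¹]) = T n → m = n := by
    intro x m n h
    by_contra hne
    have := congr(($h).coeff m)
    rw [LaurentPolynomial.T_apply, LaurentPolynomial.T_apply, if_pos rfl, if_neg (Ne.symm hne)] at this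
    exact one_ne_zero this
  refine ⟨fun x => (i x).1, ?_, fun x => hd x _ (hi x)⟩
  -- The index chosen at `x` remains correct on the locus where `e (i x)` is invertible, and
  -- exponents are unique over a nonzero ring.
  refine ((IsLocallyConstant.iff_exists_open _).2 fun x => ?_).continuous
  refine ⟨Y.basicOpen (e (i x)), (Y.basicOpen (e (i x))).2, (Scheme.mem_basicOpen_top _ _ _).2 (hi x), fun y hy => ?_⟩
  exact hinj y _ _ ((hd y _ (hi y)).symm.trans (hd y _ ((Scheme.mem_basicOpen_top _ _ _).1 hy)))

/-- Degrees survive passage to the residue field at each point, and over a field `eq_zero_of_T_eq`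
applies. -/
lemma IsDegree.eq_zero {f : Y → ℤ} {a b : Γ(Y, ⊤)[X]ˣ}
    (h : IsDegree f (powMap 1 a.val * powMap (-1) b.val)) : f = 0 := by
  ext x
  have h1 := congr(lmap (IsLocalRing.residue (Y.presheaf.stalk x)) $(h x))
  rw [lmap_T, map_mul, map_mul, lmap_powMap, lmap_powMap, lmap_powMap, lmap_powMap] at h1
  exact eq_zero_of_T_eq
    (Units.map (mapRingHom (IsLocalRing.residue (Y.presheaf.stalk x))).toMonoidHom
      (Units.map (mapRingHom (germTop x).hom).toMonoidHom a))
    (Units.map (mapRingHom (IsLocalRing.residue (Y.presheaf.stalk x))).toMonoidHom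
      (Units.map (mapRingHom (germTop x).hom).toMonoidHom b)) h1.symm

end Degrees

/-! ### Naturally split sequences as contracting homotopies. -/

section Decomposition

universe w
variable {𝒞 : Type*} [Category 𝒞] {U₀ U₁ U₂ D : 𝒞 ⥤ AddCommGrpCat.{w}}

/-- Natural homomorphisms `σ₁`, `σ₂`, `π` that contract the complex
`0 → U₀ → U₁ × U₁ → U₂ → D → 0` with maps `x ↦ (p x, -p x)` and `(a, b) ↦ j a + j' b`, together with
`r : U₁ → U₀` and `s : D → U₂`. -/
structure IsContraction (p : U₀ ⟶ U₁) (r : U₁ ⟶ U₀) (j j' : U₁ ⟶ U₂) (s : D ⟶ U₂)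
    (σ₁ σ₂ : U₂ ⟶ U₁) (π : U₂ ⟶ D) : Prop where
  p_r : p ≫ r = 𝟙 _
  j_σ₁ : r ≫ p + j ≫ σ₁ = 𝟙 _
  j'_σ₁ : j' ≫ σ₁ = 0
  j_σ₂ : j ≫ σ₂ = r ≫ p
  j'_σ₂ : j' ≫ σ₂ = 𝟙 _
  sum : σ₁ ≫ j + σ₂ ≫ j' + π ≫ s = 𝟙 _
  s_π : s ≫ π = 𝟙 _
  j_π : j ≫ π = 0
  j'_π : j' ≫ π = 0

/-- Every `u` can be written `j a + j' b + s c`, and this becomes unique under the normalization `r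
a = 0`. Uniqueness makes the components additive and natural, so they define `σ₁`, `σ₂` and `π`.
Pointwise facts are thereby converted into identities that additive functors preserve. -/
theorem exists_isContraction {p : U₀ ⟶ U₁} {r : U₁ ⟶ U₀} {j j' : U₁ ⟶ U₂} {s : D ⟶ U₂}
    (hr : p ≫ r = 𝟙 _) (hp : p ≫ j = p ≫ j')
    (hker : ∀ X (a b : U₁.obj X), j.app X a + j'.app X b = 0 → ∃ x, a = p.app X x ∧ b = -p.app X x)
    (hsurj : ∀ X (u : U₂.obj X), ∃ a b c, u = j.app X a + j'.app X b + s.app X c)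
    (hinj : ∀ X (a b : U₁.obj X) c, j.app X a + j'.app X b = s.app X c → c = 0) :
    ∃ σ₁ σ₂ π, IsContraction p r j j' s σ₁ σ₂ π := by
  have hr' : ∀ X x, r.app X (p.app X x) = x := fun X x => congr(($hr).app X x)
  have hp' : ∀ X x, j.app X (p.app X x) = j'.app X (p.app X x) := fun X x => congr(($hp).app X x)
  have hex : ∀ X (u : U₂.obj X), ∃ d : U₁.obj X × U₁.obj X × D.obj X,
      r.app X d.1 = 0 ∧ u = j.app X d.1 + j'.app X d.2.1 + s.app X d.2.2 := by
    intro X u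
    obtain ⟨a, b, c, rfl⟩ := hsurj X u
    -- Since `j` and `j'` agree on the image of `p`, the part `p (r a)` can be moved from the first
    -- component to the second.
    refine ⟨(a - p.app X (r.app X a), b + p.app X (r.app X a), c), ?_, ?_⟩
    · rw [map_sub, hr', sub_self]
    · dsimp only
      rw [map_sub, map_add, hp']
      abel
  choose d hd0 hd using hex
  have huniq : ∀ X (u : U₂.obj X) (d' : U₁.obj X × U₁.obj X × D.obj X), r.app X d'.1 = 0 →
      u = j.app X d'.1 + j'.app X d'.2.1 + s.app X d'.2.2 → d X u = d' := by
    intro X u d' h0 h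
    -- For the difference of two decompositions, `hinj` kills the component in `D`, and `hker`
    -- writes the other two as `p x` and `-p x`.
    have h1 : j.app X (d'.1 - (d X u).1) + j'.app X (d'.2.1 - (d X u).2.1) =
        s.app X ((d X u).2.2 - d'.2.2) := by
      have := h.symm.trans (hd X u)
      rw [map_sub, map_sub, map_sub]
      rw [← sub_eq_zero] at this ⊢
      rw [← this]
      abel
    have h2 := hinj X _ _ _ h1
    rw [h2, map_zero] at h1
    obtain ⟨x, hx, hx'⟩ := hker X _ _ h1
    -- Both first components are killed by `r`, and `r` recovers `x` from `p x`.
    have h3 : x = 0 := by rw [← hr' X x, ← hx, map_sub, h0, hd0, sub_zero]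
    rw [h3, map_zero] at hx hx'
    rw [neg_zero] at hx'
    exact Prod.ext (sub_eq_zero.1 hx).symm (Prod.ext (sub_eq_zero.1 hx').symm (sub_eq_zero.1 h2))
  have hadd : ∀ X u v, d X (u + v) = d X u + d X v := fun X u v => huniq X _ _
    (by rw [Prod.fst_add, map_add, hd0, hd0, add_zero]) (by
      rw [Prod.fst_add, Prod.snd_add, Prod.fst_add, Prod.snd_add, map_add, map_add, map_add]
      conv_lhs => rw [hd X u, hd X v]
      abel)
  have hnat : ∀ {X Y} (f : X ⟶ Y) u, d Y (U₂.map f u) =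
      (U₁.map f (d X u).1, U₁.map f (d X u).2.1, D.map f (d X u).2.2) := fun {X Y} f u => huniq Y _ _
    (by
      have := congr($(r.naturality f) (d X u).1)
      rw [ConcreteCategory.comp_apply, ConcreteCategory.comp_apply, hd0, map_zero] at this
      exact this) (by
      have h1 := congr($(j.naturality f) (d X u).1)
      have h2 := congr($(j'.naturality f) (d X u).2.1)
      have h3 := congr($(s.naturality f) (d X u).2.2)
      rw [ConcreteCategory.comp_apply, ConcreteCategory.comp_apply] at h1 h2 h3
      dsimp only
      rw [h1, h2, h3, ← map_add, ← map_add, ← hd])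
  refine ⟨⟨fun X => AddCommGrpCat.ofHom (AddMonoidHom.mk' (fun u => (d X u).1) fun u v => congr(($(hadd X u v)).1)),
      fun X Y f => by ext u; exact congr(($(hnat f u)).1)⟩,
    ⟨fun X => AddCommGrpCat.ofHom (AddMonoidHom.mk' (fun u => (d X u).2.1) fun u v => congr(($(hadd X u v)).2.1)),
      fun X Y f => by ext u; exact congr(($(hnat f u)).2.1)⟩,
    ⟨fun X => AddCommGrpCat.ofHom (AddMonoidHom.mk' (fun u => (d X u).2.2) fun u v => congr(($(hadd X u v)).2.2)),
      fun X Y f => by ext u; exact congr(($(hnat f u)).2.2)⟩, ?_⟩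
  have hj : ∀ X a, d X (j.app X a) = (a - p.app X (r.app X a), p.app X (r.app X a), 0) := fun X a =>
    huniq X _ _ (by rw [map_sub, hr', sub_self]) (by
      dsimp only
      rw [map_sub, map_zero, hp']
      abel)
  have hj' : ∀ X b, d X (j'.app X b) = (0, b, 0) := fun X b =>
    huniq X _ _ (map_zero _) (by simp)
  have hs : ∀ X c, d X (s.app X c) = (0, 0, c) := fun X b =>
    huniq X _ _ (map_zero _) (by simp)
  constructor
  · exact hr
  · ext X a
    refine (congrArg (p.app X (r.app X a) + ·) congr(($(hj X a)).1)).trans ?_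
    exact add_sub_cancel _ _
  · ext X b
    exact congr(($(hj' X b)).1)
  · ext X a
    exact congr(($(hj X a)).2.1)
  · ext X b
    exact congr(($(hj' X b)).2.1)
  · ext X u
    exact (hd X u).symm
  · ext X c
    exact congr(($(hs X c)).2.2)
  · ext X c
    exact congr(($(hj X c)).2.2)
  · ext X c
    exact congr(($(hj' X c)).2.2)

/-- A contraction consists of identities in composites, sums, zeros and identity maps only. This is
how split exactness reaches `H^1`. -/
lemma IsContraction.map {𝒟 : Type*} [Category 𝒟] {p : U₀ ⟶ U₁} {r : U₁ ⟶ U₀} {j j' : U₁ ⟶ U₂} {s : D ⟶ U₂}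
    {σ₁ σ₂ : U₂ ⟶ U₁} {π : U₂ ⟶ D} (h : IsContraction p r j j' s σ₁ σ₂ π)
    (H : (𝒞 ⥤ AddCommGrpCat.{w}) ⥤ 𝒟 ⥤ AddCommGrpCat.{w}) [H.Additive] :
    IsContraction (H.map p) (H.map r) (H.map j) (H.map j') (H.map s) (H.map σ₁) (H.map σ₂) (H.map π) := by
  constructor <;> simp only [← H.map_comp, ← H.map_add, ← H.map_id, ← H.map_zero, h.p_r, h.j_σ₁, h.j'_σ₁, h.j_σ₂,
    h.j'_σ₂, h.sum, h.s_π, h.j_π, h.j'_π]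

end Decomposition

/-! ### Additivity of group cohomology in the coefficient functor. -/

section CohomologyFunctor

/-- Forming inhomogeneous cochains and taking homology are both additive. -/
instance {R G : Type u} [CommRing R] [Group G] (n : ℕ) : (groupCohomology.functor R G n).Additive where
  map_add {A B} f g := by
    have h : (groupCohomology.cochainsFunctor R G).map (f + g) =
      (groupCohomology.cochainsFunctor R G).map f + (groupCohomology.cochainsFunctor R G).map g :=
      Functor.map_add _
    exact (congrArg (fun φ => HomologicalComplex.homologyMap φ n) h).trans
      (HomologicalComplex.homologyMap_add _ _ n)

variable {k : Type u} [Field k] (G : Type u) [Group G]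

/-- The morphisms of `G`-modules `M(X) → M'(X)` given by a natural transformation `M ⟶ M'`. -/
noncomputable def moduleMap {M M' : (Sch k)ᵒᵖ ⥤ AddCommGrpCat.{u + 1}} (α : M ⟶ M') :
    moduleFunctor G M ⟶ moduleFunctor G M' where
  app X := Rep.ofHom
    { toFun := α.app (op X.unop.V)
      map_add' := map_add (α.app (op X.unop.V)).hom
      map_smul' := fun n => map_zsmul (α.app (op X.unop.V)).hom n.down
      isIntertwining' := fun g => by
        ext a
        exact congr($(α.naturality (Quiver.Hom.op (X.unop.ρ g.down⁻¹ : X.unop.V ⟶ X.unop.V))) a) }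
  naturality X Y f := by
    ext a
    exact congr($(α.naturality f.unop.hom.op) a)

/-- The functor `M ↦ H^1(G, M(-))`. -/
noncomputable def groupHOneFunctor :
    ((Sch k)ᵒᵖ ⥤ AddCommGrpCat.{u + 1}) ⥤ (GSch k G)ᵒᵖ ⥤ AddCommGrpCat.{u + 1} where
  obj M := groupHOne G M
  map α := Functor.whiskerRight (moduleMap G α) (groupCohomology.functor (ULift.{u + 1} ℤ) (ULift.{u + 1} G) 1 ⋙
    forget₂ (ModuleCat (ULift.{u + 1} ℤ)) AddCommGrpCat)
  map_id M := by
    rw [show moduleMap G (𝟙 M) = 𝟙 (moduleFunctor G M) by ext X a; rfl, Functor.whiskerRight_id']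
    rfl
  map_comp α β := by
    rw [show moduleMap G (α ≫ β) = moduleMap G α ≫ moduleMap G β by ext X a; rfl]
    exact Functor.whiskerRight_comp _ _ _

/-- Checked at each `G`-scheme, where it is the additivity of `H^1` on `G`-modules; it is the
hypothesis of `IsContraction.map`. -/
instance : (groupHOneFunctor (k := k) G).Additive where
  map_add {M M'} α β := by
    ext1; funext X
    have h : (moduleMap G (α + β)).app X = (moduleMap G α).app X + (moduleMap G β).app X := by
      ext a; rfl
    exact (congrArg (groupCohomology.functor (ULift.{u + 1} ℤ) (ULift.{u + 1} G) 1 ⋙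
      forget₂ (ModuleCat (ULift.{u + 1} ℤ)) AddCommGrpCat).map h).trans (Functor.map_add _)

end CohomologyFunctor

/-! ### Criteria for a functor to be contracted. -/

section Contracted

open scoped LaurentPolynomial Polynomial

variable {k : Type u} [Field k] {G : Type u} [Group G]

/-- Changing the coordinate `t` does not affect the projection to `X`. Hence the two restrictions of
a class pulled back from `X` cancel in `addMap_plusMinus`. -/
lemma puncMap_affProj (n : ℤ) (X : GSch k G) :
    (puncMap k G n).app X ≫ (affProj k G).app X = (puncMap k G 1).app X ≫ (affProj k G).app X := by
  ext
  refine (prodOverMap_fst _ _).trans (prodOverMap_fst _ _).symm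

lemma addMap_plusMinus (F : (GSch k G)ᵒᵖ ⥤ AddCommGrpCat.{u + 1}) (X : GSch k G) (x : F.obj (op X)) :
    addMap F X (plusMinus F X x) = 0 := by
  have h := congr(F.map (Quiver.Hom.op $(puncMap_affProj (-1) X)) x)
  rw [op_comp, op_comp, F.map_comp, F.map_comp, ConcreteCategory.comp_apply, ConcreteCategory.comp_apply] at h
  change F.map ((puncMap k G 1).app X).op (F.map ((affProj k G).app X).op x) +
    F.map ((puncMap k G (-1)).app X).op (-F.map ((affProj k G).app X).op x) = 0
  rw [map_neg, h, add_neg_cancel]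

/-- A contraction of the sequence in the definition of `IsContracted`, with a functor `D` in place of `LF`. -/
theorem isContracted_of_contraction {F D : (GSch k G)ᵒᵖ ⥤ AddCommGrpCat.{u + 1}}
    {p : F ⟶ (affLine k G).op ⋙ F} {j j' : (affLine k G).op ⋙ F ⟶ laurentF F}
    (hp : ∀ X, p.app X = F.map ((affProj k G).app X.unop).op)
    (hj : ∀ X, j.app X = F.map ((puncMap k G 1).app X.unop).op)
    (hj' : ∀ X, j'.app X = F.map ((puncMap k G (-1)).app X.unop).op)
    {r : (affLine k G).op ⋙ F ⟶ F} {s : D ⟶ laurentF F} {σ₁ σ₂ : laurentF F ⟶ (affLine k G).op ⋙ F}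
    {π : laurentF F ⟶ D} (h : IsContraction p r j j' s σ₁ σ₂ π) :
    IsContracted F ∧ Nonempty (contraction F ≅ D) := by
  have hpm : ∀ X x, plusMinus F X x = (p.app (op X) x, -p.app (op X) x) := fun X x => by rw [hp]; rfl
  have ham : ∀ X a b, addMap F X (a, b) = j.app (op X) a + j'.app (op X) b := fun X a b => by
    rw [hj, hj']; rfl
  have h_r : ∀ X x, r.app X (p.app X x) = x := fun X x => congr(($h.p_r).app X x)
  have h1 : ∀ X a, p.app X (r.app X a) + σ₁.app X (j.app X a) = a := fun X a => congr(($h.j_σ₁).app X a)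
  have h2 : ∀ X b, σ₁.app X (j'.app X b) = 0 := fun X a => congr(($h.j'_σ₁).app X a)
  have h3 : ∀ X a, σ₂.app X (j.app X a) = p.app X (r.app X a) := fun X a => congr(($h.j_σ₂).app X a)
  have h4 : ∀ X b, σ₂.app X (j'.app X b) = b := fun X a => congr(($h.j'_σ₂).app X a)
  have h5 : ∀ X (u : (laurentF F).obj X), (j.app X (σ₁.app X u) : (laurentF F).obj X) + j'.app X (σ₂.app X u) +
      s.app X (π.app X u) = u :=
    fun X u => congr(($h.sum).app X u)
  have h6 : ∀ X c, π.app X (s.app X c) = c := fun X a => congr(($h.s_π).app X a)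
  have h7 : ∀ X a, π.app X (j.app X a) = 0 := fun X a => congr(($h.j_π).app X a)
  have h8 : ∀ X a, π.app X (j'.app X a) = 0 := fun X a => congr(($h.j'_π).app X a)
  have hker : ∀ X, (addMap F X).range ≤ (π.app (op X)).hom.ker := by
    rintro X _ ⟨⟨a, b⟩, rfl⟩
    change π.app (op X) (addMap F X (a, b)) = 0
    rw [ham, map_add, h7, h8, add_zero]
  let π' : contraction F ⟶ D :=
    { app := fun X => AddCommGrpCat.ofHom (QuotientAddGroup.lift _ (π.app X).hom (hker X.unop))
      naturality := fun X Y f => by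
        ext u
        obtain ⟨u, rfl⟩ := QuotientAddGroup.mk_surjective u
        exact congr($(π.naturality f) u) }
  have hπ' : toContraction F ≫ π' = π := rfl
  have hs1 : (s ≫ toContraction F) ≫ π' = 𝟙 _ := by rw [Category.assoc, hπ', h.s_π]
  -- The identity `sum` exhibits `u - s (π u)` as the image of `(σ₁ u, σ₂ u)`, so `u` and `s (π u)`
  -- have the same class.
  have hs2 : π' ≫ s ≫ toContraction F = 𝟙 _ := by
    ext X u
    obtain ⟨u, rfl⟩ := QuotientAddGroup.mk_surjective u
    refine (QuotientAddGroup.eq (s := (addMap F X.unop).range)).2 ⟨(σ₁.app X u, σ₂.app X u), ?_⟩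
    rw [ham]
    have h := h5 X u
    rw [add_comm] at h
    exact eq_neg_add_of_add_eq h
  refine ⟨⟨fun X x y hxy => ?_, fun X => ?_, π' ≫ s, by rw [Category.assoc, hs2]⟩,
    ⟨⟨π', s ≫ toContraction F, hs2, hs1⟩⟩⟩
  · rw [hpm, hpm] at hxy
    exact (h_r _ x).symm.trans ((congrArg (r.app _) (congrArg Prod.fst hxy)).trans (h_r _ y))
  · rintro ⟨a, b⟩
    constructor
    · intro hab
      rw [ham] at hab
      -- Applying `σ₁` to `j a + j' b = 0` gives `σ₁ (j a) = 0`, hence `a = p (r a)`; applying `σ₂`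
      -- gives `b = -p (r a)`. So `r a` is the required element.
      have e1 := congr(σ₁.app (op X) $hab)
      have e2 := congr(σ₂.app (op X) $hab)
      rw [map_add, h2, map_zero, add_zero] at e1
      rw [map_add, h3, h4, map_zero] at e2
      have e3 := h1 _ a
      rw [e1, add_zero] at e3
      refine ⟨r.app (op X) a, ?_⟩
      rw [hpm]
      exact Prod.ext e3 (eq_neg_of_add_eq_zero_right e2).symm
    · rintro ⟨x, hx⟩
      rw [← hx]
      exact addMap_plusMinus F X x

lemma addMap_map {F F' : (GSch k G)ᵒᵖ ⥤ AddCommGrpCat.{u + 1}} (e : F ⟶ F') {X : GSch k G}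
    (a b : F.obj (op ((affLine k G).obj X))) :
    addMap F' X (e.app _ a, e.app _ b) = e.app _ (addMap F X (a, b)) := by
  refine Eq.trans ?_ (map_add (e.app (op ((puncLine k G).obj X))).hom _ _).symm
  have h1 := congr($(e.naturality ((puncMap k G 1).app X).op) a)
  have h2 := congr($(e.naturality ((puncMap k G (-1)).app X).op) b)
  exact congrArg₂ (· + ·) h1.symm h2.symm

lemma plusMinus_map {F F' : (GSch k G)ᵒᵖ ⥤ AddCommGrpCat.{u + 1}} (e : F ⟶ F') {X : GSch k G}
    (x : F.obj (op X)) : (plusMinus F' X (e.app _ x)).1 = e.app _ (plusMinus F X x).1 ∧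
      (plusMinus F' X (e.app _ x)).2 = e.app _ (plusMinus F X x).2 := by
  have h := congr($(e.naturality ((affProj k G).app X).op) x).symm
  refine ⟨h, ?_⟩
  exact (congrArg Neg.neg h).trans (map_neg (e.app (op ((affLine k G).obj X))).hom _).symm

/-- The map of contractions induced by a natural transformation. -/
noncomputable def contractionMap {F F' : (GSch k G)ᵒᵖ ⥤ AddCommGrpCat.{u + 1}} (e : F ⟶ F') :
    contraction F ⟶ contraction F' where
  app X := AddCommGrpCat.ofHom (QuotientAddGroup.map _ _ (e.app (op ((puncLine k G).obj X.unop))).hom (by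
    rintro _ ⟨⟨a, b⟩, rfl⟩
    exact ⟨_, addMap_map e a b⟩))
  naturality X Y f := by
    ext u
    obtain ⟨u, rfl⟩ := QuotientAddGroup.mk_surjective u
    exact congrArg (QuotientAddGroup.mk' (addMap F' Y.unop).range)
      congr($(e.naturality ((puncLine k G).map f.unop).op) u)

lemma contractionMap_inv_hom {F F' : (GSch k G)ᵒᵖ ⥤ AddCommGrpCat.{u + 1}} (e : F ≅ F') :
    contractionMap e.hom ≫ contractionMap e.inv = 𝟙 _ := by
  ext X u
  obtain ⟨u, rfl⟩ := QuotientAddGroup.mk_surjective u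
  exact congrArg (QuotientAddGroup.mk' (addMap F X.unop).range) congr(($e.hom_inv_id).app _ u)

/-- The property of being contracted and the contraction are invariant under isomorphism. -/
theorem isContracted_of_iso {F F' D : (GSch k G)ᵒᵖ ⥤ AddCommGrpCat.{u + 1}} (e : F ≅ F')
    (h : IsContracted F') (h' : Nonempty (contraction F' ≅ D)) :
    IsContracted F ∧ Nonempty (contraction F ≅ D) := by
  have hl : ∀ X x, e.inv.app X (e.hom.app X x) = x := fun X x => congr(($e.hom_inv_id).app X x)
  obtain ⟨s, hs⟩ := h.splitting
  refine ⟨⟨fun X x y hxy => ?_, fun X => ?_,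
    contractionMap e.hom ≫ s ≫ Functor.whiskerLeft _ e.inv, ?_⟩, ?_⟩
  · have hx : e.hom.app _ x = e.hom.app _ y := by
      refine h.injective X (Prod.ext ?_ ?_)
      · exact ((plusMinus_map e.hom x).1.trans (congrArg (e.hom.app _) congr(($hxy).1))).trans (plusMinus_map e.hom y).1.symm
      · exact ((plusMinus_map e.hom x).2.trans (congrArg (e.hom.app _) congr(($hxy).2))).trans (plusMinus_map e.hom y).2.symm
    rw [← hl _ x, hx, hl]
  · rintro ⟨a, b⟩
    constructor
    · intro hab
      obtain ⟨x, hx⟩ := (h.exact_mid X _).1 ((addMap_map e.hom a b).trans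
        ((congrArg (e.hom.app _) hab).trans (map_zero (e.hom.app (op ((puncLine k G).obj X))).hom)))
      refine ⟨e.inv.app _ x, Prod.ext ?_ ?_⟩
      · exact (plusMinus_map e.inv x).1.trans ((congrArg (e.inv.app _) congr(($hx).1)).trans (hl _ _))
      · exact (plusMinus_map e.inv x).2.trans ((congrArg (e.inv.app _) congr(($hx).2)).trans (hl _ _))
    · rintro ⟨x, hx⟩
      rw [← hx]
      exact addMap_plusMinus F X x
  · rw [Category.assoc, Category.assoc, show Functor.whiskerLeft (puncLine k G).op e.inv ≫ toContraction F =
      toContraction F' ≫ contractionMap e.inv from rfl, reassoc_of% hs, contractionMap_inv_hom]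
  · exact ⟨⟨contractionMap e.hom, contractionMap e.inv, contractionMap_inv_hom e,
      contractionMap_inv_hom e.symm⟩ ≪≫ h'.some⟩

end Contracted

/-! ### The sequence of units and its cohomology. -/

section Units

open _root_.Polynomial hiding C
open LaurentPolynomial (C T)
open scoped LaurentPolynomial

variable {k : Type u} [Field k]

/-- Compactness, and the quasi-separatedness deduced next from separatedness, are what flat base
change in `isPushout_glob` requires. -/
instance (X : Sch k) : CompactSpace X.obj.left := by
  have := X.property.2.2
  exact QuasiCompact.compactSpace_of_compactSpace X.obj.hom

instance (X : Sch k) : QuasiSeparatedSpace X.obj.left := by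
  have := X.property.1
  exact quasiSeparatedSpace_of_quasiSeparated X.obj.hom

/-- The function underlying a global unit. -/
noncomputable def unitVal {X : (Sch k)ᵒᵖ} (x : (unitsFunctor k).obj X) : glob X.unop.obj :=
  (Additive.toMul (ULift.down x)).val

lemma unitVal_injective {X : (Sch k)ᵒᵖ} {x y : (unitsFunctor k).obj X} (h : unitVal x = unitVal y) : x = y :=
  ULift.ext _ _ (Units.ext h)

lemma unitVal_add {X : (Sch k)ᵒᵖ} (x y : (unitsFunctor k).obj X) :
    unitVal (x + y) = unitVal x * unitVal y := rfl

lemma isUnit_unitVal {X : (Sch k)ᵒᵖ} (x : (unitsFunctor k).obj X) : IsUnit (unitVal x) :=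
  (Additive.toMul (ULift.down x)).isUnit

lemma exists_unitVal {X : (Sch k)ᵒᵖ} {a : glob X.unop.obj} (ha : IsUnit a) :
    ∃ x : (unitsFunctor k).obj X, unitVal x = a :=
  ⟨ULift.up (Additive.ofMul ha.unit), rfl⟩

/-- The zero section `X ⟶ X[t]`. -/
noncomputable def zeroSection (X : Over (Spec (.of k))) : X ⟶ prodSpecObj k[X] X :=
  CategoryTheory.Over.homMk (pullback.lift (𝟙 X.left)
    (X.hom ≫ Spec.map (CommRingCat.ofHom (evalRingHom (0 : k)))) (by
      rw [Category.id_comp, Category.assoc, ← Spec.map_comp, ← CommRingCat.ofHom_comp]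
      rw [show (evalRingHom (0 : k)).comp (algebraMap k k[X]) = RingHom.id k by ext; simp]
      change _ = X.hom ≫ Spec.map (𝟙 _)
      rw [Spec.map_id]
      exact (Category.comp_id _).symm)) (pullback.lift_fst_assoc _ _ _ _ |>.trans (Category.id_comp _))

lemma zeroSection_fst (X : Over (Spec (.of k))) :
    (zeroSection X).left ≫ pullback.fst X.hom (specMap (k := k) k[X]) = 𝟙 X.left := pullback.lift_fst _ _ _

lemma zeroSection_snd (X : Over (Spec (.of k))) :
    (zeroSection X).left ≫ pullback.snd X.hom (specMap (k := k) k[X]) =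
      X.hom ≫ Spec.map (CommRingCat.ofHom (evalRingHom (0 : k))) := pullback.lift_snd _ _ _

lemma zeroSection_natural {X Y : Over (Spec (.of k))} (f : X ⟶ Y) :
    f ≫ zeroSection Y = zeroSection X ≫ prodOverMap f (AlgHom.id k k[X]) := by
  refine CategoryTheory.Over.OverMorphism.ext (pullback.hom_ext ?_ ?_)
  · rw [CategoryTheory.Over.comp_left, CategoryTheory.Over.comp_left, Category.assoc, Category.assoc,
      prodOverMap_fst, zeroSection_fst, reassoc_of% (zeroSection_fst X)]
    exact Category.comp_id _
  · rw [CategoryTheory.Over.comp_left, CategoryTheory.Over.comp_left, Category.assoc, Category.assoc,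
      prodOverMap_snd, zeroSection_snd, reassoc_of% (zeroSection_snd X), CategoryTheory.Over.w_assoc]
    change _ = _ ≫ _ ≫ Spec.map (𝟙 _)
    rw [Spec.map_id]
    exact congrArg (X.hom ≫ ·) (Category.comp_id _).symm

variable (k)

/-- Pullback of units along `X[t] ⟶ X`. -/
noncomputable def unitsProj : unitsFunctor k ⟶ (prodSpec k[X]).op ⋙ unitsFunctor k where
  app X := (unitsFunctor k).map ((prodFst k[X]).app X.unop).op
  naturality X Y f := by
    rw [Functor.comp_map, ← Functor.map_comp, ← Functor.map_comp]
    exact congr((unitsFunctor k).map (Quiver.Hom.op $((prodFst k[X]).naturality f.unop))).symm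

/-- Pullback of units along `X[t, t⁻¹] ⟶ X[t]`, `t ↦ t ^ n`. -/
noncomputable def unitsPow (n : ℤ) :
    (prodSpec k[X]).op ⋙ unitsFunctor k ⟶ (prodSpec k[T;T⁻¹]).op ⋙ unitsFunctor k :=
  Functor.whiskerRight (NatTrans.op (prodMap (Polynomial.aeval (R := k) (T n : k[T;T⁻¹])))) (unitsFunctor k)

/-- Pullback of units along the zero section. -/
noncomputable def unitsZero : (prodSpec k[X]).op ⋙ unitsFunctor k ⟶ unitsFunctor k where
  app X := (unitsFunctor k).map (Quiver.Hom.op (Y := (prodSpec k[X]).obj X.unop)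
    (ObjectProperty.homMk (zeroSection X.unop.obj)))
  naturality X Y f := by
    rw [Functor.comp_map, ← Functor.map_comp, ← Functor.map_comp]
    refine congrArg (unitsFunctor k).map (congrArg Quiver.Hom.op ?_)
    ext1
    exact (zeroSection_natural f.unop.hom).symm

/-- The functor `X ↦ C(X, ℤ)`. -/
noncomputable def intFunctor : (Sch k)ᵒᵖ ⥤ AddCommGrpCat.{u + 1} :=
  (Sch.toScheme k).op ⋙ continuousMapPresheafAb (ULift.{u + 1} ℤ)

lemma unitsProj_zero : unitsProj k ≫ unitsZero k = 𝟙 _ := by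
  ext X x
  refine unitVal_injective ?_
  exact congr(Scheme.Hom.appTop $(zeroSection_fst X.unop.obj) (unitVal x)).trans
    congr($(Scheme.Hom.id_app (X := X.unop.obj.left) ⊤) (unitVal x))

lemma unitsProj_pow : unitsProj k ≫ unitsPow k 1 = unitsProj k ≫ unitsPow k (-1) := by
  ext X x
  refine unitVal_injective ?_
  exact congr(Scheme.Hom.appTop $((prodOverMap_fst _ _).trans (prodOverMap_fst _ _).symm) (unitVal x))

variable {k}

/-- The degree of an integer valued function. -/
noncomputable def degFun {X : (Sch k)ᵒᵖ} (c : (intFunctor k).obj X) : X.unop.obj.left → ℤ :=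
  fun x => ((show C(X.unop.obj.left, ULift.{u + 1} ℤ) from c) x).down

lemma continuous_degFun {X : (Sch k)ᵒᵖ} (c : (intFunctor k).obj X) : Continuous (degFun c) :=
  continuous_uliftDown.comp (show C(X.unop.obj.left, ULift.{u + 1} ℤ) from c).continuous

lemma degFun_injective {X : (Sch k)ᵒᵖ} {c d : (intFunctor k).obj X} (h : degFun c = degFun d) : c = d :=
  ContinuousMap.ext fun x => ULift.ext _ _ (congrFun h x)

lemma degFun_add {X : (Sch k)ᵒᵖ} (c d : (intFunctor k).obj X) : degFun (c + d) = degFun c + degFun d := rfl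

/-- The functions of degree `c` and `-c` are inverse to each other: their product has degree `0`, as
`1` does. -/
lemma exists_unit_isDegree {X : (Sch k)ᵒᵖ} (c : (intFunctor k).obj X) :
    ∃ x : (unitsFunctor k).obj (op ((prodSpec k[T;T⁻¹]).obj X.unop)), ∃ w, IsDegree (degFun c) w ∧
      unitVal x = laurGlob X.unop.obj w := by
  obtain ⟨v, hv⟩ := exists_isDegree (continuous_degFun c)
  obtain ⟨w, hw⟩ := exists_isDegree (continuous_degFun (-c))
  have h : v * w = 1 := IsDegree.ext (f := 0) (by
    have := hv.mul hw
    rwa [← degFun_add, add_neg_cancel] at this) isDegree_one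
  obtain ⟨x, hx⟩ := exists_unitVal (X := op ((prodSpec k[T;T⁻¹]).obj X.unop))
    ((IsUnit.of_mul_eq_one _ h).map (laurGlob X.unop.obj))
  exact ⟨x, v, hv, hx⟩

/-- The unit `t ^ c` on `X[t, t⁻¹]`, for a locally constant function `c`. -/
noncomputable def tPow {X : (Sch k)ᵒᵖ} (c : (intFunctor k).obj X) :
    (unitsFunctor k).obj (op ((prodSpec k[T;T⁻¹]).obj X.unop)) := (exists_unit_isDegree c).choose

lemma unitVal_tPow {X : (Sch k)ᵒᵖ} (c : (intFunctor k).obj X) :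
    ∃ w, IsDegree (degFun c) w ∧ unitVal (tPow c) = laurGlob X.unop.obj w := (exists_unit_isDegree c).choose_spec

/-- `tPow` is defined by choice; this uniqueness makes it additive and natural. -/
lemma eq_tPow {X : (Sch k)ᵒᵖ} {c : (intFunctor k).obj X}
    {x : (unitsFunctor k).obj (op ((prodSpec k[T;T⁻¹]).obj X.unop))} {w} (hw : IsDegree (degFun c) w)
    (hx : unitVal x = laurGlob X.unop.obj w) : x = tPow c := by
  obtain ⟨w', hw', h⟩ := unitVal_tPow c
  exact unitVal_injective (by rw [h, hx, hw.ext hw'])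

variable (k)

/-- The natural transformation `c ↦ t ^ c`. -/
noncomputable def unitsTPow : intFunctor k ⟶ (prodSpec k[T;T⁻¹]).op ⋙ unitsFunctor k where
  app X := AddCommGrpCat.ofHom (AddMonoidHom.mk' (fun c => tPow c) fun c d => by
    obtain ⟨v, hv, hc⟩ := unitVal_tPow c
    obtain ⟨w, hw, hd⟩ := unitVal_tPow d
    refine (eq_tPow (c := c + d) (w := v * w) (hv.mul hw) ?_).symm
    exact (congrArg₂ (· * ·) hc hd).trans (map_mul (laurGlob X.unop.obj) v w).symm)
  naturality X Y f := by
    ext c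
    obtain ⟨w, hw, hc⟩ := unitVal_tPow c
    refine (eq_tPow (hw.comap f.unop.hom.left) ?_).symm
    exact (congrArg _ hc).trans (globMap_laurGlob f.unop.hom w)

/-- A polynomial in `t` that equals a polynomial in `t⁻¹` is constant, so `a` and `-b` come from one
function on `X`. -/
lemma units_hker (X : (Sch k)ᵒᵖ) (a b : ((prodSpec k[X]).op ⋙ unitsFunctor k).obj X)
    (h : (unitsPow k 1).app X a + (unitsPow k (-1)).app X b = 0) :
    ∃ x, a = (unitsProj k).app X x ∧ b = -(unitsProj k).app X x := by
  have h' : (unitsPow k 1).app X a = (unitsPow k (-1)).app X (-b) := by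
    rw [map_neg]; exact eq_neg_of_add_eq_zero_left h
  obtain ⟨p, hp⟩ := (bijective_polyGlob X.unop.obj).2 (unitVal a)
  obtain ⟨q, hq⟩ := (bijective_polyGlob X.unop.obj).2 (unitVal (-b))
  have h1 : globMap (powOverMap X.unop.obj 1) (unitVal a) = globMap (powOverMap X.unop.obj (-1)) (unitVal (-b)) :=
    congrArg unitVal h'
  rw [← hp, ← hq, globMap_polyGlob, globMap_polyGlob] at h1
  obtain ⟨c, rfl, rfl⟩ := exists_C_of_powMap_eq ((bijective_laurGlob X.unop.obj).1 h1)
  -- The constant is a unit of `Γ(X, 𝒪_X)` and not only of the functions on `X[t]`, since a constant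
  -- polynomial is invertible only if its coefficient is.
  have hc : IsUnit c := by
    have := isUnit_unitVal a
    rw [← hp] at this
    exact Polynomial.isUnit_C.1 ((MulEquiv.isUnit_map (RingEquiv.ofBijective _ (bijective_polyGlob X.unop.obj))).1 this)
  obtain ⟨x, hx⟩ := exists_unitVal (X := X) hc
  have hpx : unitVal ((unitsProj k).app X x) = polyGlob X.unop.obj (Polynomial.C c) := by
    rw [polyGlob_C, ← hx]; rfl
  refine ⟨x, unitVal_injective (hp.symm.trans hpx.symm), ?_⟩
  rw [← unitVal_injective (hq.symm.trans hpx.symm), neg_neg]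

lemma exists_units_polyGlob {X : (Sch k)ᵒᵖ} (a : ((prodSpec k[X]).op ⋙ unitsFunctor k).obj X) :
    ∃ p : (glob X.unop.obj)[X]ˣ, polyGlob X.unop.obj p.val = unitVal a := by
  obtain ⟨p, hp⟩ := (bijective_polyGlob X.unop.obj).2 (unitVal a)
  have := isUnit_unitVal a
  rw [← hp] at this
  exact ⟨((MulEquiv.isUnit_map (RingEquiv.ofBijective _ (bijective_polyGlob X.unop.obj))).1 this).unit, hp⟩

/-- The algebraic factorization of units, with the idempotent sum identified as `t ^ c` for the
locally constant function `c` given by its degree. -/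
lemma units_hsurj (X : (Sch k)ᵒᵖ) (u : ((prodSpec k[T;T⁻¹]).op ⋙ unitsFunctor k).obj X) :
    ∃ a b c, u = (unitsPow k 1).app X a + (unitsPow k (-1)).app X b + (unitsTPow k).app X c := by
  obtain ⟨w, hw⟩ := (bijective_laurGlob X.unop.obj).2 (unitVal u)
  have hu := isUnit_unitVal u
  rw [← hw] at hu
  obtain ⟨s, e, a, b, he, rfl⟩ := exists_unit_factorization
    ((MulEquiv.isUnit_map (RingEquiv.ofBijective _ (bijective_laurGlob X.unop.obj))).1 hu)
  obtain ⟨f, hf, hfe⟩ := exists_isDegree_idemSum he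
  obtain ⟨x, hx⟩ := exists_unitVal (X := op ((prodSpec k[X]).obj X.unop)) (a.isUnit.map (polyGlob X.unop.obj))
  obtain ⟨y, hy⟩ := exists_unitVal (X := op ((prodSpec k[X]).obj X.unop)) (b.isUnit.map (polyGlob X.unop.obj))
  let c : (intFunctor k).obj X := (⟨fun x => ULift.up (f x), continuous_uliftUp.comp hf⟩ :
    C(X.unop.obj.left, ULift.{u + 1} ℤ))
  obtain ⟨w, hw', hc⟩ := unitVal_tPow c
  refine ⟨x, y, c, unitVal_injective ?_⟩
  change _ = (globMap (powOverMap X.unop.obj 1) (unitVal x) : glob (prodSpecObj k[T;T⁻¹] X.unop.obj)) *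
    globMap (powOverMap X.unop.obj (-1)) (unitVal y) *
    (show glob (prodSpecObj k[T;T⁻¹] X.unop.obj) from unitVal (tPow c))
  rw [← hw, hx, hy, hc, globMap_polyGlob, globMap_polyGlob, ← map_mul, ← map_mul, hfe.ext hw']

/-- A product of a unit in `t` and a unit in `t⁻¹` that is a locally constant power of `t` has
degree `0`. -/
lemma units_hinj (X : (Sch k)ᵒᵖ) (a b : ((prodSpec k[X]).op ⋙ unitsFunctor k).obj X) (c)
    (h : (unitsPow k 1).app X a + (unitsPow k (-1)).app X b = (unitsTPow k).app X c) : c = 0 := by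
  obtain ⟨p, hp⟩ := exists_units_polyGlob k a
  obtain ⟨q, hq⟩ := exists_units_polyGlob k b
  obtain ⟨w, hw, hc⟩ := unitVal_tPow c
  have h1 : (globMap (powOverMap X.unop.obj 1) (unitVal a) : glob (prodSpecObj k[T;T⁻¹] X.unop.obj)) *
    globMap (powOverMap X.unop.obj (-1)) (unitVal b) =
    (show glob (prodSpecObj k[T;T⁻¹] X.unop.obj) from unitVal (tPow c)) := congrArg unitVal h
  rw [← hp, ← hq, hc, globMap_polyGlob, globMap_polyGlob, ← map_mul] at h1
  rw [← (bijective_laurGlob X.unop.obj).1 h1] at hw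
  exact degFun_injective hw.eq_zero

theorem exists_isContraction_units : ∃ σ₁ σ₂ π,
    IsContraction (unitsProj k) (unitsZero k) (unitsPow k 1) (unitsPow k (-1)) (unitsTPow k) σ₁ σ₂ π :=
  exists_isContraction (unitsProj_zero k) (unitsProj_pow k) (units_hker k) (units_hsurj k) (units_hinj k)

variable (G : Type u) [Group G]

variable {k}

/-- A contraction of a sequence of functors on schemes induces one on cohomology. -/
theorem exists_isContraction_groupHOne {M D : (Sch k)ᵒᵖ ⥤ AddCommGrpCat.{u + 1}} {P Q : Sch k ⥤ Sch k}
    (ε : P ⟶ 𝟭 _) (φ φ' : Q ⟶ P) {p : M ⟶ P.op ⋙ M} {j j' : P.op ⋙ M ⟶ Q.op ⋙ M}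
    (hp : ∀ X, p.app X = M.map (ε.app X.unop).op) (hj : ∀ X, j.app X = M.map (φ.app X.unop).op)
    (hj' : ∀ X, j'.app X = M.map (φ'.app X.unop).op)
    {r s σ₁ σ₂} {π : _ ⟶ D} (h : IsContraction p r j j' s σ₁ σ₂ π) :
    ∃ (p' : groupHOne G M ⟶ (P.mapAction G).op ⋙ groupHOne G M)
      (j₁ j₁' : (P.mapAction G).op ⋙ groupHOne G M ⟶ (Q.mapAction G).op ⋙ groupHOne G M)
      (r' : _) (s' : groupHOne G D ⟶ (Q.mapAction G).op ⋙ groupHOne G M) (τ₁ τ₂ : _) (π' : _),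
      (∀ X, p'.app X = (groupHOne G M).map (Quiver.Hom.op (X := (P.mapAction G).obj X.unop) (Y := X.unop)
        ⟨ε.app X.unop.V, fun g => ε.naturality (X.unop.ρ g)⟩)) ∧
      (∀ X, j₁.app X = (groupHOne G M).map (Quiver.Hom.op (X := (Q.mapAction G).obj X.unop)
        (Y := (P.mapAction G).obj X.unop) ⟨φ.app X.unop.V, fun g => φ.naturality (X.unop.ρ g)⟩)) ∧
      (∀ X, j₁'.app X = (groupHOne G M).map (Quiver.Hom.op (X := (Q.mapAction G).obj X.unop)
        (Y := (P.mapAction G).obj X.unop) ⟨φ'.app X.unop.V, fun g => φ'.naturality (X.unop.ρ g)⟩)) ∧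
      IsContraction p' r' j₁ j₁' s' τ₁ τ₂ π' := by
  -- By definition, `H^1(G, (M ∘ P)(X))` is `H^1(G, M)` evaluated at the `G`-scheme `P X`, so the
  -- images under the functor have the required types.
  refine ⟨_, _, _, _, _, _, _, _, fun X => ?_, fun X => ?_, fun X => ?_, h.map (groupHOneFunctor G)⟩
  all_goals refine congrArg (groupCohomology.functor (ULift.{u + 1} ℤ) (ULift.{u + 1} G) 1 ⋙
    forget₂ (ModuleCat (ULift.{u + 1} ℤ)) AddCommGrpCat).map ?_
  all_goals ext a
  · exact congr($(hp (op X.unop.V)) a)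
  · exact congr($(hj (op X.unop.V)) a)
  · exact congr($(hj' (op X.unop.V)) a)

variable (k)

/-- `H^1(G, H^0(-, 𝒪^×))` is contracted, with contraction `H^1(G, C(-, ℤ))`. -/
theorem isContracted_groupHOne_units : IsContracted (groupHOne G (unitsFunctor k)) ∧
    Nonempty (contraction (groupHOne G (unitsFunctor k)) ≅ groupHOne G (intFunctor k)) := by
  obtain ⟨σ₁, σ₂, π, h⟩ := exists_isContraction_units k
  obtain ⟨p, j, j', r, s, τ₁, τ₂, π', hp, hj, hj', h'⟩ := exists_isContraction_groupHOne G (prodFst k[X])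
    (prodMap (Polynomial.aeval (R := k) (T 1 : k[T;T⁻¹]))) (prodMap (Polynomial.aeval (R := k) (T (-1) : k[T;T⁻¹])))
    (fun X => rfl) (fun X => rfl) (fun X => rfl) h
  exact isContracted_of_contraction hp hj hj' h'

end Units

/-! ### The constant étale sheaf `ℤ` as the sheaf of continuous functions. -/

section Etale

/-- Zariski covers are étale covers, so local properties may be checked near each point of `X`. -/
lemma mem_etaleTopology_of_opens {X : Scheme.{u}} (S : Sieve X) (U : X → X.Opens) (hU : ∀ x, x ∈ U x)
    (h : ∀ x, S (U x).ι) : S ∈ Scheme.etaleTopology X := by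
  refine Scheme.zariskiTopology_le_etaleTopology X ?_
  refine (Scheme.zariskiTopology).superset_covering ?_
    (Scheme.Cover.mem_grothendieckTopology (X.openCoverOfIsOpenCover U
      (TopologicalSpace.IsOpenCover.mk (by rw [eq_top_iff]; exact fun x _ => Opens.mem_iSup.2 ⟨x, hU x⟩))))
  rw [Sieve.generate_le_iff]
  rintro _ _ ⟨x⟩
  exact h x

/-- The map from constant functions to continuous functions. -/
noncomputable def constToCont : (Functor.const Scheme.{u}ᵒᵖ).obj (AddCommGrpCat.of (ULift.{u + 1} ℤ)) ⟶
    continuousMapPresheafAb (ULift.{u + 1} ℤ) where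
  app _ := AddCommGrpCat.ofHom (AddMonoidHom.mk' (fun n => ContinuousMap.const _ n) fun _ _ => rfl)
  naturality _ _ _ := rfl

/-- Equal constant functions have equal values as soon as there is a point. The cover is indexed by
points, so nothing is required for the empty scheme, where injectivity itself fails. -/
instance : Presheaf.IsLocallyInjective Scheme.etaleTopology.{u} constToCont.{u} where
  equalizerSieve_mem {X} a b hab := by
    refine mem_etaleTopology_of_opens _ (fun _ => ⊤) (fun _ => trivial) fun x => ?_
    exact congr($(show ContinuousMap.const X.unop (show ULift.{u + 1} ℤ from a) = ContinuousMap.const X.unop (show ULift.{u + 1} ℤ from b) from hab) x)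

/-- A continuous function to a discrete space is constant on its fibres, which form an open cover.
-/
instance : Presheaf.IsLocallySurjective Scheme.etaleTopology.{u} constToCont.{u} where
  imageSieve_mem {X} f := by
    let f' : C(X, ULift.{u + 1} ℤ) := f
    refine mem_etaleTopology_of_opens _ (fun x => ⟨f' ⁻¹' {f' x}, (isOpen_discrete _).preimage f'.continuous⟩)
      (fun x => rfl) fun x => ?_
    refine ⟨f' x, ContinuousMap.ext fun y => ?_⟩
    exact y.2.symm

/-- The étale sheaf of continuous functions to `ℤ`. -/
noncomputable def contSheaf : Sheaf Scheme.etaleTopology.{u} AddCommGrpCat.{u + 1} :=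
  -- Continuous functions satisfy fpqc descent, and the étale topology is coarser.
  ⟨continuousMapPresheafAb (ULift.{u + 1} ℤ), .of_le
    (Scheme.etaleTopology_le_proetaleTopology.trans Scheme.proetaleTopology_le_fpqcTopology)
    (isSheaf_fpqcTopology_continuousMapPresheafAb _)⟩

/-- Sheafification inverts locally bijective maps of presheaves. -/
instance : IsIso ((presheafToSheaf Scheme.etaleTopology.{u} AddCommGrpCat.{u + 1}).map constToCont.{u}) :=
  (GrothendieckTopology.W_iff _ _).1 ((GrothendieckTopology.W_iff_isLocallyBijective _ _).2
    ⟨inferInstance, inferInstance⟩)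

/-- The constant étale sheaf `ℤ` is the sheaf of continuous functions to `ℤ`. -/
noncomputable def constantSheafIso :
    (constantSheaf Scheme.etaleTopology.{u} AddCommGrpCat.{u + 1}).obj (.of (ULift.{u + 1} ℤ)) ≅ contSheaf :=
  let e₁ := asIso ((presheafToSheaf Scheme.etaleTopology.{u} AddCommGrpCat.{u + 1}).map constToCont.{u})
  let e₂ := asIso ((sheafificationAdjunction Scheme.etaleTopology.{u} AddCommGrpCat.{u + 1}).counit.app contSheaf)
  e₁.trans e₂

variable (k : Type u) [Field k]

/-- `H^0_ét(X, ℤ)` is the group of continuous functions `X → ℤ`. -/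
noncomputable def etaleHZeroIso : etaleHZero k ≅ intFunctor k :=
  Functor.isoWhiskerLeft (Sch.toScheme k).op ((sheafToPresheaf _ _).mapIso constantSheafIso)

end Etale

/-! ### Linearized bundles with a global frame and their cocycles. -/

section TrivialBundles

variable {G : Type u} [Group G] {X Y : Action Scheme.{u} G}

/-- The action on global functions by pullback along `g`. -/
noncomputable abbrev pg (X : Action Scheme.{u} G) (g : G) : Γ(X.V, ⊤) →+* Γ(X.V, ⊤) := (sg X g).appTop.hom

/-- The semilinear map `s ↦ φ_g (g^* s)` on global sections. -/
noncomputable def Linearization.actTop {L : X.V.Modules} (Λ : Linearization X L) (g : G) (s : Γ(L, ⊤)) : Γ(L, ⊤) :=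
  Λ.act g s

lemma actTop_smul {L : X.V.Modules} (Λ : Linearization X L) (g : G) (a : Γ(X.V, ⊤)) (s : Γ(L, ⊤)) :
    Λ.actTop g (a • s) = pg X g a • Λ.actTop g s := act_smul Λ g a s

/-- The condition `φ_{gh} = φ_h ∘ h^*(φ_g)` applies `g` before `h`, so sections carry a right action
of `G`. -/
lemma actTop_mul {L : X.V.Modules} (Λ : Linearization X L) (g h : G) (s : Γ(L, ⊤)) :
    Λ.actTop (g * h) s = Λ.actTop h (Λ.actTop g s) := by
  exact (res_self _).symm.trans ((act_mul_res Λ g h (U := ⊤) (V := ⊤) s le_rfl le_rfl).trans (res_self _))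

lemma pg_mul (g h : G) (a : Γ(X.V, ⊤)) : pg X (g * h) a = pg X h (pg X g a) :=
  (congr(Scheme.Hom.appTop $(sg_mul X g h) a)).trans (congr($(Scheme.Hom.comp_appTop (sg X h) (sg X g)) a))

lemma pg_one (a : Γ(X.V, ⊤)) : pg X 1 a = a :=
  (congr(Scheme.Hom.appTop $(sg_one X) a)).trans (congr($(Scheme.Hom.id_app (X := X.V) ⊤) a))

/-- The linearized line bundle `A` has a global frame `s` with `φ_g (g^* s) = c_g s`. -/
def GLineBundle.IsTrivializedBy (A : GLineBundle X) (c : G → Γ(X.V, ⊤)) : Prop :=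
  ∃ s : Γ(A.L, ⊤), IsFrame A.L ⊤ s ∧ ∀ g, A.lin.actTop g s = c g • s

lemma IsFrame.smul_inj_top {X : Scheme.{u}} {L : X.Modules} {s : Γ(L, ⊤)} (hs : IsFrame L ⊤ s) {a b : Γ(X, ⊤)}
    (h : a • s = b • s) : a = b := by
  refine hs.smul_inj le_rfl ?_
  rwa [res_self]

lemma IsFrame.exists_smul_top {X : Scheme.{u}} {L : X.Modules} {s : Γ(L, ⊤)} (hs : IsFrame L ⊤ s) (t : Γ(L, ⊤)) :
    ∃ a : Γ(X, ⊤), t = a • s := by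
  obtain ⟨a, ha⟩ := hs.exists_smul le_rfl t
  exact ⟨a, by rwa [res_self] at ha⟩

/-- Two global frames differ by a unit. -/
lemma IsFrame.exists_unit {X : Scheme.{u}} {L : X.Modules} {s t : Γ(L, ⊤)} (hs : IsFrame L ⊤ s)
    (ht : IsFrame L ⊤ t) : ∃ a : Γ(X, ⊤)ˣ, t = a.val • s := by
  obtain ⟨a, ha⟩ := hs.exists_smul_top t
  obtain ⟨b, hb⟩ := ht.exists_smul_top s
  have h : a * b = 1 := ht.smul_inj_top (by rw [mul_smul, ← hb, ← ha, one_smul])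
  exact ⟨⟨a, b, h, by rw [mul_comm, h]⟩, ha⟩

lemma IsFrame.units_smul {X : Scheme.{u}} {L : X.Modules} {s : Γ(L, ⊤)} (hs : IsFrame L ⊤ s) (a : Γ(X, ⊤)ˣ) :
    IsFrame L ⊤ (a.val • s) := by
  intro V hV
  have h : (fun b : Γ(X, V) => b • res hV (a.val • s)) =
      (fun b : Γ(X, V) => b • res hV s) ∘ fun b => b * fres hV a.val := by
    funext b
    rw [res_smul, smul_smul]; rfl
  rw [h]
  exact (hs V hV).comp ((a.isUnit.map (X.presheaf.map (homOfLE hV).op).hom).unit.mulRight_bijective)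

/-- The cochain `c` is a cocycle. -/
def IsMulCocycle (c : G → Γ(X.V, ⊤)) : Prop := ∀ g h, c (g * h) = pg X h (c g) * c h

namespace GLineBundle

variable {A B : GLineBundle X} {c d : G → Γ(X.V, ⊤)}

lemma IsTrivializedBy.isUnit (h : A.IsTrivializedBy c) (g : G) : IsUnit (c g) := by
  obtain ⟨s, hs, hc⟩ := h
  obtain ⟨a, ha⟩ := hs.exists_unit (act_frame A.lin g hs)
  rw [hs.smul_inj_top ((hc g).symm.trans ha)]
  exact a.isUnit

/-- Computing the action of `gh` on the frame directly, and as that of `g` followed by that of `h`,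
gives the two sides. -/
lemma IsTrivializedBy.isMulCocycle (h : A.IsTrivializedBy c) : IsMulCocycle c := by
  obtain ⟨s, hs, hc⟩ := h
  intro g h
  refine hs.smul_inj_top ?_
  rw [← hc, actTop_mul, hc, actTop_smul, hc, mul_smul]

lemma IsTrivializedBy.congr (h : A.IsTrivializedBy c) (e : A.Equiv B) : B.IsTrivializedBy c := by
  obtain ⟨s, hs, hc⟩ := h
  obtain ⟨e, he⟩ := equiv_iff.1 e
  refine ⟨e.hom.app ⊤ s, hs.iso_app e, fun g => (he g ⊤ s).symm.trans ?_⟩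
  exact (congrArg (e.hom.app ⊤) (hc g)).trans (Scheme.Modules.Hom.app_smul _ _ _)

/-- Changing the frame by a unit. -/
lemma IsTrivializedBy.smul (h : A.IsTrivializedBy c) (a : Γ(X.V, ⊤)ˣ) :
    A.IsTrivializedBy fun g => pg X g a * c g * a⁻¹.val := by
  obtain ⟨s, hs, hc⟩ := h
  refine ⟨_, hs.units_smul a, fun g => ?_⟩
  rw [actTop_smul, hc, smul_smul, smul_smul, mul_assoc (pg X g a * c g), Units.inv_mul, mul_one]

/-- Two frames of the same bundle differ by a unit, so their cochains differ by its coboundary. -/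
lemma IsTrivializedBy.exists_unit (h : A.IsTrivializedBy c) (h' : A.IsTrivializedBy d) :
    ∃ a : Γ(X.V, ⊤)ˣ, ∀ g, d g * a = pg X g a * c g := by
  obtain ⟨s, hs, hc⟩ := h
  obtain ⟨t, ht, hd⟩ := h'
  obtain ⟨a, rfl⟩ := hs.exists_unit ht
  refine ⟨a, fun g => hs.smul_inj_top ?_⟩
  rw [mul_smul, mul_smul, ← hd, actTop_smul, hc]

/-- The isomorphism sends `s` to `t`. Since `equiv_of_frames` needs a family of frames stable under
`G`, all unit multiples `a • s` are used, and `g` acts on the index by `a ↦ g^*(a) c_g`. -/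
lemma IsTrivializedBy.equiv (h : A.IsTrivializedBy c) (h' : B.IsTrivializedBy c) : A.Equiv B := by
  have hu := h.isUnit
  obtain ⟨s, hs, hc⟩ := h
  obtain ⟨t, ht, hd⟩ := h'
  have key : ∀ {D : GLineBundle X} {r : Γ(D.L, ⊤)} (_ : ∀ g, D.lin.actTop g r = c g • r) (g : G) (a : Γ(X.V, ⊤)ˣ),
      D.lin.act g (a.val • r) = res (M := D.L) (U := ⊤) (V := ⊤) le_rfl
        ((Units.map (pg X g).toMonoidHom a * (hu g).unit).val • r) := fun hr g a => by
    rw [res_self]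
    refine (actTop_smul _ g _ _).trans ?_
    rw [hr, smul_smul]; rfl
  exact equiv_of_frames (A := A) (B := B) (ι := Γ(X.V, ⊤)ˣ) (U := fun _ => ⊤) (fun _ => ⟨1, trivial⟩)
    (m := fun a => a.val • s) (fun a => hs.units_smul a) (p := fun a => a.val • t) (fun a => ht.units_smul a)
    (fun i j V hi hj a h => by
      rw [res_smul, res_smul, smul_smul] at h
      rw [res_smul, res_smul, smul_smul, hs.smul_inj _ h]) (fun g a => Units.map (pg X g).toMonoidHom a * (hu g).unit)
    (fun g i => le_rfl) (key hc) (key hd)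

lemma IsTrivializedBy.tensor (h : A.IsTrivializedBy c) (h' : B.IsTrivializedBy d) :
    (tensor A B).IsTrivializedBy fun g => c g * d g := by
  obtain ⟨s, hs, hc⟩ := h
  obtain ⟨t, ht, hd⟩ := h'
  refine ⟨tmul s t, hs.tmul ht, fun g => (tensor_act A B g ⟨⊤, s, hs, t, ht⟩).trans ?_⟩
  exact (congrArg₂ tmul (hc g) (hd g)).trans (smul_tmul _ _ _ _)

lemma IsTrivializedBy.pull {A : GLineBundle Y} {c : G → Γ(Y.V, ⊤)} (f : X ⟶ Y) (h : A.IsTrivializedBy c) :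
    (pull f A).IsTrivializedBy fun g => f.hom.appTop (c g) := by
  obtain ⟨s, hs, hc⟩ := h
  refine ⟨pullSec f.hom s, hs.pullSec f.hom, fun g => (pull_act f A g ⟨⊤, s, hs⟩).trans ((res_self _).trans ?_)⟩
  exact (congrArg (pullSec f.hom) (hc g)).trans (pullSec_smul f.hom _ _)

/-- The bundle is `𝒪_X` with `φ_g (g^* 1) = c_g`. Again all frames `a • 1`, with `a` a unit, are
used so that the family is stable under the action to be constructed. -/
lemma exists_isTrivializedBy (hc : IsMulCocycle c) (hu : ∀ g, IsUnit (c g)) :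
    ∃ A : GLineBundle X, A.IsTrivializedBy c := by
  -- The cocycle identity gives `c 1 = c 1 * c 1`, and `c 1` can be cancelled.
  have h1 : c 1 = 1 := by
    have := hc 1 1
    rw [mul_one, pg_one] at this
    exact ((hu 1).mul_eq_left.1 this.symm)
  have hs := isFrame_oneSec (X := X.V) ⊤
  obtain ⟨Λ, hΛ⟩ := exists_lin (X := X) (L := unitM X.V) (ι := Γ(X.V, ⊤)ˣ) (U := fun _ => ⊤) (fun _ => ⟨1, trivial⟩)
    (m := fun a => a.val • oneSec ⊤) (fun a => hs.units_smul a)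
    (fun g a => Units.map (pg X g).toMonoidHom a * (hu g).unit) (fun _ _ => rfl)
    (fun g i j V hi hj a hi' hj' h => by
      rw [res_smul, res_smul, smul_smul] at h
      have h2 := congr((sg X g).app V $(hs.smul_inj _ h))
      have e : ∀ (a : Γ(X.V, ⊤)) (h : V ≤ ⊤) (h' : sg X g ⁻¹ᵁ V ≤ ⊤), (sg X g).app V (fres h a) = fres h' (pg X g a) :=
        fun a h h' => (fres_self _).symm.trans (fapp_res (sg X g) h le_rfl a h')
      rw [map_mul, e _ _ hj', e _ _ hi'] at h2
      rw [res_smul, res_smul, smul_smul]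
      refine congrArg (· • res hi' (oneSec ⊤)) ?_
      change fres hj' (pg X g j.val * c g) = _ * fres hi' (pg X g i.val * c g)
      rw [fres_mul, fres_mul, h2, mul_assoc])
    (fun a V h h' => by
      refine congrArg (fun z => res h (z • oneSec ⊤)) ?_
      change pg X 1 a.val * c 1 = a.val
      rw [pg_one, h1, mul_one])
    (fun g k a V h h' => by
      refine congrArg (fun z => res h (z • oneSec ⊤)) ?_
      change pg X (g * k) a.val * c (g * k) = pg X k (pg X g a.val * c g) * c k
      rw [pg_mul, hc, map_mul, mul_assoc])
  refine ⟨⟨unitM X.V, isLineBundle_unit, Λ⟩, oneSec ⊤, hs, fun g => ?_⟩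
  have h2 := (hΛ g 1).trans (res_self _)
  refine (congrArg (Λ.act g) (one_smul Γ(X.V, ⊤) (oneSec ⊤)).symm).trans (h2.trans ?_)
  refine congrArg (· • oneSec ⊤) ?_
  change pg X g 1 * c g = c g
  rw [map_one, one_mul]

/-- A global frame amounts to an isomorphism with `𝒪_X`; the cochain then exists automatically, as
every global section is a multiple of the frame. -/
lemma exists_isTrivializedBy_iff : (∃ c, A.IsTrivializedBy c) ↔ Nonempty (A.L ≅ unitM X.V) := by
  constructor
  · rintro ⟨c, s, hs, -⟩
    exact (exists_iso (ι := Unit) (U := fun _ => ⊤) (fun _ => ⟨(), trivial⟩) (m := fun _ => s) (fun _ => hs)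
      (p := fun _ => oneSec ⊤) (fun _ => isFrame_oneSec ⊤) fun i j V hi hj a h => by
        have h2 := hs.smul_inj hi ((one_smul _ (res hj s)).trans h)
        rw [← h2, one_smul]).nonempty
  · rintro ⟨e⟩
    have hs := (isFrame_oneSec (X := X.V) ⊤).iso_app e.symm
    choose c hc using fun g => hs.exists_smul_top (A.lin.actTop g (e.inv.app ⊤ (oneSec ⊤)))
    exact ⟨c, _, hs, hc⟩

lemma exists_isTrivializedBy_iff_forgetLin (A : GLineBundle X) :
    (∃ c, A.IsTrivializedBy c) ↔ forgetLin X (Quotient.mk _ A) = 1 := by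
  rw [exists_isTrivializedBy_iff]
  exact ⟨fun h => Quotient.sound h, fun h => Quotient.exact h⟩

end GLineBundle

end TrivialBundles

/-! ### Isomorphisms of functors from natural bijective relations. -/

section Relations

universe w
variable {𝒞 : Type*} [Category 𝒞] {F F' : 𝒞 ⥤ AddCommGrpCat.{w}}

/-- A natural additive relation that is the graph of a bijection yields an isomorphism of functors. -/
theorem nonempty_iso_of_relation (r : ∀ X, F.obj X → F'.obj X → Prop)
    (total : ∀ X a, ∃ b, r X a b) (surj : ∀ X b, ∃ a, r X a b)
    (unique : ∀ X a b b', r X a b → r X a b' → b = b') (inj : ∀ X a a' b, r X a b → r X a' b → a = a')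
    (add : ∀ X a a' b b', r X a b → r X a' b' → r X (a + a') (b + b'))
    (nat : ∀ {X Y} (f : X ⟶ Y) a b, r X a b → r Y (F.map f a) (F'.map f b)) : Nonempty (F ≅ F') := by
  choose φ hφ using total
  let e : ∀ X, F.obj X ≃+ F'.obj X := fun X => AddEquiv.ofBijective
    (AddMonoidHom.mk' (φ X) fun a a' => unique X _ _ _ (hφ X _) (add X _ _ _ _ (hφ X a) (hφ X a')))
    ⟨fun a a' h => inj X _ _ _ (hφ X a) (by rw [show φ X a = φ X a' from h]; exact hφ X a'), fun b => by
      obtain ⟨a, ha⟩ := surj X b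
      exact ⟨a, unique X _ _ _ (hφ X a) ha⟩⟩
  refine ⟨NatIso.ofComponents (fun X => (e X).toAddCommGrpIso) fun {X Y} f => ?_⟩
  ext a
  exact unique Y _ _ _ (hφ Y _) (nat f _ _ (hφ X a))

end Relations

/-! ### The kernel of `η` as first cohomology of the units. -/

section KernelEta

open groupCohomology

variable {k : Type u} [Field k] {G : Type u} [Group G]

/-- The underlying `G`-scheme. -/
noncomputable abbrev GSch.toScheme (X : GSch k G) : Action Scheme.{u} G := ((Sch.toScheme k).mapAction G).obj X

/-- The `G`-module of global units. -/
noncomputable abbrev unitsRep (X : GSch k G) : Rep.{u + 1} (ULift.{u + 1} ℤ) (ULift.{u + 1} G) :=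
  Rep.of (moduleRho (unitsFunctor k) X)

/-- The functions `c_g = f(g⁻¹)` for a cochain `f` with values in the global units. -/
noncomputable def cochainVal {X : GSch k G} (f : ULift.{u + 1} G → unitsRep X) (g : G) : Γ(X.toScheme.V, ⊤) :=
  unitVal (X := op X.V) (f ⟨g⁻¹⟩)

lemma isUnit_cochainVal {X : GSch k G} (f : ULift.{u + 1} G → unitsRep X) (g : G) : IsUnit (cochainVal f g) :=
  isUnit_unitVal (X := op X.V) _

lemma unitVal_rho {X : GSch k G} (g : ULift.{u + 1} G) (a : unitsRep X) :
    unitVal (X := op X.V) ((unitsRep X).ρ g a) = pg X.toScheme g.down⁻¹ (unitVal (X := op X.V) a) := rfl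

/-- The inversion in `cochainVal` reconciles two conventions: `g` acts on units by pullback along
`g⁻¹`, a left action, while linearizations act on the right. Under it `f (gh) = g f(h) + f(g)`
becomes `c_{gh} = h^*(c_g) c_h`. -/
lemma isMulCocycle_cochainVal_iff {X : GSch k G} (f : ULift.{u + 1} G → unitsRep X) :
    IsMulCocycle (X := X.toScheme) (cochainVal f) ↔ f ∈ cocycles₁ (unitsRep X) := by
  rw [mem_cocycles₁_iff]
  constructor
  · intro h g h'
    refine unitVal_injective (X := op X.V) ?_
    have := h h'.down⁻¹ g.down⁻¹
    rw [cochainVal, mul_inv_rev, inv_inv, inv_inv, cochainVal, inv_inv, cochainVal, inv_inv] at this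
    exact this
  · intro h g h'
    have := congrArg (unitVal (X := op X.V)) (h ⟨h'⁻¹⟩ ⟨g⁻¹⟩)
    rw [cochainVal, mul_inv_rev]
    refine this.trans ?_
    exact (unitVal_add _ _).trans (congrArg (· * cochainVal f h') ((unitVal_rho _ _).trans
      (by rw [inv_inv]; rfl)))

lemma exists_cochainVal {X : GSch k G} {c : G → Γ(X.toScheme.V, ⊤)} (hc : ∀ g, IsUnit (c g)) :
    ∃ f : ULift.{u + 1} G → unitsRep X, cochainVal f = c := by
  choose x hx using fun g => exists_unitVal (X := op X.V) (hc g)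
  refine ⟨fun g => x g.down⁻¹, funext fun g => ?_⟩
  rw [cochainVal, inv_inv]
  exact hx g

/-- `a` is the class of a linearized line bundle with a global frame, and `b` is the class of the cocycle
describing its linearization. -/
def IsClass (X : (GSch k G)ᵒᵖ) (a : (kerFunctor (eta k G)).obj X) (b : (groupHOne G (unitsFunctor k)).obj X) : Prop :=
  ∃ (A : GLineBundle X.unop.toScheme) (f : cocycles₁ (unitsRep X.unop)),
    (show Additive (PicG X.unop.toScheme) from a.1) = Additive.ofMul (Quotient.mk _ A) ∧
    A.IsTrivializedBy (cochainVal f.1) ∧ b = (show H1 (unitsRep X.unop) from H1π _ f)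

/-- A class in the kernel of `η` has trivial underlying bundle, hence a global frame. Stating the
correspondence as a relation avoids fixing a representative and a frame. -/
lemma isClass_total (X : (GSch k G)ᵒᵖ) (a) : ∃ b, IsClass X a b := by
  obtain ⟨A, hA⟩ := Quotient.exists_rep (Additive.toMul (show Additive (PicG X.unop.toScheme) from a.1))
  obtain ⟨c, hc⟩ := (GLineBundle.exists_isTrivializedBy_iff_forgetLin A).2 (by
    rw [hA]
    exact a.2)
  obtain ⟨f, rfl⟩ := exists_cochainVal hc.isUnit
  exact ⟨_, A, ⟨f, (isMulCocycle_cochainVal_iff f).1 hc.isMulCocycle⟩, congrArg Additive.ofMul hA.symm, hc, rfl⟩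

lemma isClass_surj (X : (GSch k G)ᵒᵖ) (b) : ∃ a, IsClass X a b := by
  refine H1_induction_on (A := unitsRep X.unop) (C := fun b => ∃ a, IsClass X a b) b fun f => ?_
  obtain ⟨A, hA⟩ := GLineBundle.exists_isTrivializedBy ((isMulCocycle_cochainVal_iff f.1).2 f.2)
    (isUnit_cochainVal f.1)
  exact ⟨⟨Additive.ofMul (Quotient.mk _ A), (GLineBundle.exists_isTrivializedBy_iff_forgetLin A).1 ⟨_, hA⟩⟩,
    A, f, rfl, hA, rfl⟩

/-- Two cocycles are cohomologous if and only if they differ by a change of frame. -/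
lemma H1π_eq_iff_cochainVal {X : GSch k G} (f f' : cocycles₁ (unitsRep X)) :
    H1π (unitsRep X) f = H1π (unitsRep X) f' ↔
      ∃ a : Γ(X.toScheme.V, ⊤)ˣ, ∀ g, cochainVal f.1 g * a = pg X.toScheme g a * cochainVal f'.1 g := by
  rw [H1π_eq_iff]
  constructor
  · rintro ⟨x, hx⟩
    refine ⟨(isUnit_unitVal (X := op X.V) x).unit, fun g => ?_⟩
    have h1 : (unitsRep X).ρ ⟨g⁻¹⟩ x - x = f.1 ⟨g⁻¹⟩ - f'.1 ⟨g⁻¹⟩ := congrFun hx ⟨g⁻¹⟩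
    have h2 : f.1 ⟨g⁻¹⟩ + x = (unitsRep X).ρ ⟨g⁻¹⟩ x + f'.1 ⟨g⁻¹⟩ := by
      rw [sub_eq_sub_iff_add_eq_add] at h1
      rw [h1, add_comm]
    have h3 := congrArg (unitVal (X := op X.V)) h2
    refine h3.trans ((unitVal_add _ _).trans (congrArg (· * cochainVal f'.1 g) ((unitVal_rho _ _).trans
      (by rw [inv_inv]; rfl))))
  · rintro ⟨a, ha⟩
    obtain ⟨x, hx⟩ := exists_unitVal (X := op X.V) a.isUnit
    refine ⟨x, funext fun g => ?_⟩
    change (unitsRep X).ρ g x - x = f.1 g - f'.1 g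
    rw [sub_eq_sub_iff_add_eq_add]
    refine unitVal_injective (X := op X.V) ?_
    have h := ha g.down⁻¹
    rw [cochainVal, cochainVal, inv_inv, ← hx] at h
    exact h.symm

/-- Neither the representing bundle nor the frame matters: frames transport along isomorphisms, and
a change of frame is a coboundary. -/
lemma isClass_unique (X : (GSch k G)ᵒᵖ) (a b b') (h : IsClass X a b) (h' : IsClass X a b') : b = b' := by
  obtain ⟨A, f, hA, hf, rfl⟩ := h
  obtain ⟨A', f', hA', hf', rfl⟩ := h'
  have e : A'.Equiv A := Quotient.exact (Additive.ofMul.injective (hA'.symm.trans hA))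
  exact (H1π_eq_iff_cochainVal f f').2 ((hf'.congr e).exists_unit hf)

/-- If the cocycles are cohomologous, one frame can be rescaled by the unit `u` until they coincide;
then the bundles are isomorphic. -/
lemma isClass_inj (X : (GSch k G)ᵒᵖ) (a a' b) (h : IsClass X a b) (h' : IsClass X a' b) : a = a' := by
  obtain ⟨A, f, hA, hf, rfl⟩ := h
  obtain ⟨A', f', hA', hf', hff'⟩ := h'
  obtain ⟨u, hu⟩ := (H1π_eq_iff_cochainVal f f').1 hff'
  have h1 := hf'.smul u
  rw [show (fun g => pg X.unop.toScheme g u * cochainVal f'.1 g * u⁻¹.val) = cochainVal f.1 from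
    funext fun g => by rw [← hu, mul_assoc, Units.mul_inv, mul_one]] at h1
  exact Subtype.ext (hA.trans ((congrArg Additive.ofMul (Quotient.sound (hf.equiv h1))).trans hA'.symm))

lemma isClass_add (X : (GSch k G)ᵒᵖ) (a a' b b') (h : IsClass X a b) (h' : IsClass X a' b') :
    IsClass X (a + a') (b + b') := by
  obtain ⟨A, f, hA, hf, rfl⟩ := h
  obtain ⟨A', f', hA', hf', rfl⟩ := h'
  refine ⟨A.tensor A', f + f', congrArg₂ (· + ·) hA hA', hf.tensor hf', ?_⟩
  exact (map_add (H1π (unitsRep X.unop)).hom f f').symm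

lemma functor_map_H1π {R H : Type u} [CommRing R] [Group H] {A B : Rep.{u} R H} (φ : A ⟶ B) (z : cocycles₁ A) :
    ((groupCohomology.functor R H 1).map φ) (H1π A z) = H1π B (mapCocycles₁.{u, u} (MonoidHom.id H) φ z) :=
  congr($(H1π_comp_map (MonoidHom.id H) φ) z)

/-- The pullback of a frame is a frame, and its cocycle is the pullback of the cocycle. -/
lemma isClass_map {X Y : (GSch k G)ᵒᵖ} (f : X ⟶ Y) (a b) (h : IsClass X a b) :
    IsClass Y ((kerFunctor (eta k G)).map f a) ((groupHOne G (unitsFunctor k)).map f b) := by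
  obtain ⟨A, z, hA, hz, rfl⟩ := h
  refine ⟨A.pull (((Sch.toScheme k).mapAction G).map f.unop),
    mapCocycles₁.{u + 1, u + 1} (MonoidHom.id _) ((moduleFunctor G (unitsFunctor k)).map f) z, ?_, hz.pull _, ?_⟩
  · exact congrArg ((picGOver k G).map f) hA
  · exact functor_map_H1π (A := unitsRep X.unop) (B := unitsRep Y.unop) ((moduleFunctor G (unitsFunctor k)).map f) z

variable (k G)

/-- The kernel of `Pic^G → Pic` is `H^1(G, H^0(-, 𝒪^×))`. -/
theorem nonempty_kerEtaIso : Nonempty (kerFunctor (eta k G) ≅ groupHOne G (unitsFunctor k)) :=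
  nonempty_iso_of_relation IsClass isClass_total isClass_surj isClass_unique isClass_inj isClass_add isClass_map

end KernelEta

end EquivariantPicard

theorem mainTheorem6 (k : Type u) [Field k] (G : Type u) [Group G] [Finite G] :
    EquivariantPicard.IsContracted (EquivariantPicard.kerFunctor (EquivariantPicard.eta k G)) ∧
    Nonempty (EquivariantPicard.kerFunctor (EquivariantPicard.eta k G) ≅
      EquivariantPicard.groupHOne G (EquivariantPicard.unitsFunctor k)) ∧
    Nonempty (EquivariantPicard.contraction
        (EquivariantPicard.kerFunctor (EquivariantPicard.eta k G)) ≅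
      EquivariantPicard.groupHOne G (EquivariantPicard.etaleHZero k)) := by
  obtain ⟨e⟩ := EquivariantPicard.nonempty_kerEtaIso k G
  obtain ⟨h, ⟨i⟩⟩ := EquivariantPicard.isContracted_groupHOne_units k G
  obtain ⟨h₁, h₂⟩ := EquivariantPicard.isContracted_of_iso e h
    -- The isomorphism `C(-, ℤ) ≅ H^0_ét(-, ℤ)` is natural on all schemes in `Sch k`, so it induces
    -- an isomorphism of `G`-modules and of their `H^1`.
    ⟨i ≪≫ (EquivariantPicard.groupHOneFunctor G).mapIso (EquivariantPicard.etaleHZeroIso k).symm⟩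
  exact ⟨h₁, ⟨e⟩, h₂⟩
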